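/- **Setting.** Let $M$ be a smooth manifold (Hausdorff, second countable, without boundary, of dimension $n$), $\mathfrak g$ a finite-dimensional real Lie algebra, and $L\to M$ a smooth Lie algebra bundle with fibre $\mathfrak g$ and structure group $\mathrm{Aut}(\mathfrak g)$. Let $\mathrm{Inn}(\mathfrak g)\subset \mathrm{Aut}(\mathfrak g)$ be the subgroup generated by the automorphisms $\exp(\mathrm{ad}\,u)$, $u\in\mathfrak g$, and let $\mathrm{Aut}^{\delta}(\mathfrak g)$ be the group $\mathrm{Aut}(\mathfrak g)$ with the coarsest topology that is finer than the usual one and makes the projection to the discrete set $\mathrm{Aut}(\mathfrak g)/\mathrm{Inn}(\mathfrak g)$ continuous. *Couplings.* Consider smooth linear connections $\nabla$ on $L$ with $\nabla_X[u,v]=[\nabla_Xu,v]+[u,\nabla_Xv]$ whose curvature has the form $R^\nabla(X,Y)u=[\Omega(X,Y),u]$ for some smooth $L$-valued 2-form $\Omega$. Two of them are in the same class if $\nabla'_Xu=\nabla_Xu+[l(X),u]$ for some smooth bundle map $l:TM\to L$. The set of classes is $\mathrm{Coup}(L)$, the set of couplings of $L$ with $TM$. *Locally trivial structures.* A locally trivial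 structure on $L$ with structure group $\mathrm{Aut}^\delta(\mathfrak g)$ is an open covering $\{U_\alpha\}$ of $M$ with smooth trivializations $\varphi_\alpha:U_\alpha\times\mathfrak g\to L|_{U_\alpha}$ by fibrewise Lie algebra isomorphisms such that all maps $x\mapsto\varphi_\beta(x)^{-1}\varphi_\alpha(x)$, $U_\alpha\cap U_\beta\to\mathrm{Aut}^\delta(\mathfrak g)$, are continuous. Two such structures $\{\varphi_\alpha\}$, $\{\varphi'_\beta\}$ are equivalent if all maps $x\mapsto\varphi'_\beta(x)^{-1}\varphi_\alpha(x)$, $U_\alpha\cap U'_\beta\to \mathrm{Aut}^\delta(\mathfrak g)$, are continuous. The set of equivalence classes is $\mathrm{LAB}^\delta(L)$. **Theorem.** 1. There is a unique map $f:\mathrm{Coup}(L)\to\mathrm{LAB}^\delta(L)$ with the following property. For every connection $\nabla$ as above, every atlas of charts $\chi_\alpha:U_\alpha\cong\mathbb R^n$ with central points $x_\alpha=\chi_\alpha^{-1}(0)$, and all Lie algebra isomorphisms $\psi_\alpha:\mathfrak g\to L_{x_\alpha}$, let $\varphi^\nabla_\alpha(x):\mathfrak g\to L_x$ be $\psi_\alpha$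 followed by $\nabla$-parallel transport along the radial path $t\mapsto\chi_\alpha^{-1}(t\chi_\alpha(x))$, $0\le t\le 1$. Then $\{\varphi^\nabla_\alpha\}$ is a locally trivial structure with structure group $\mathrm{Aut}^\delta(\mathfrak g)$, and $f([\nabla])=[\{\varphi^\nabla_\alpha\}]$. 2. There is a unique map $g:\mathrm{LAB}^\delta(L)\to\mathrm{Coup}(L)$ with the following property. For every locally trivial structure $\Phi=\{\varphi_\alpha\}$ with structure group $\mathrm{Aut}^\delta(\mathfrak g)$ and every smooth partition of unity $H=\{h_\alpha\}$ subordinate to $\{U_\alpha\}$, the formula $$\nabla^{\Phi,H}_X(u)=\sum_\alpha\varphi_\alpha\,\partial_X\bigl(\varphi_\alpha^{-1}(h_\alpha u)\bigr)$$ defines a connection of the above kind, and $g([\Phi])=[\nabla^{\Phi,H}]$. 3. The maps $f$ and $g$ are inverse to each other: $g\circ f=\mathrm{id}$ and $f\circ g=\mathrm{id}$. So couplings of $L$ with $TM$ correspond one-to-one to equivalence classes of locally trivial structures on $L$ with structure group $\mathrm{Aut}^\delta(\mathfrak g)$. -/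

import Mathlib

open Bundle Set
open scoped Manifold ContDiff Topology

universe u w

/-- A Lie algebra structure over `ℝ` on a normed space. The norm only serves to give the space its
usual topology and smooth structure; Mathlib's `LieRing` and `LieAlgebra` are derived below. -/
class RealLieAlgebra (𝔤 : Type*) [NormedAddCommGroup 𝔤] [NormedSpace ℝ 𝔤]
    extends Bracket 𝔤 𝔤 where
  add_lie' : ∀ x y z : 𝔤, ⁅x + y, z⁆ = ⁅x, z⁆ + ⁅y, z⁆
  lie_add' : ∀ x y z : 𝔤, ⁅x, y + z⁆ = ⁅x, y⁆ + ⁅x, z⁆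
  lie_self' : ∀ x : 𝔤, ⁅x, x⁆ = 0
  leibniz_lie' : ∀ x y z : 𝔤, ⁅x, ⁅y, z⁆⁆ = ⁅⁅x, y⁆, z⁆ + ⁅y, ⁅x, z⁆⁆
  lie_smul' : ∀ (t : ℝ) (x y : 𝔤), ⁅x, t • y⁆ = t • ⁅x, y⁆

namespace RealLieAlgebra

variable (𝔤 : Type*) [NormedAddCommGroup 𝔤] [NormedSpace ℝ 𝔤] [RealLieAlgebra 𝔤]

instance toLieRing : LieRing 𝔤 where
  add_lie := add_lie'
  lie_add := lie_add'
  lie_self := lie_self'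
  leibniz_lie := leibniz_lie'

instance toLieAlgebra : LieAlgebra ℝ 𝔤 where
  lie_smul := lie_smul'

end RealLieAlgebra

noncomputable section

section Automorphisms

variable (𝔤 : Type*) [NormedAddCommGroup 𝔤] [NormedSpace ℝ 𝔤] [FiniteDimensional ℝ 𝔤]
  [RealLieAlgebra 𝔤]

/-- The group `Aut(𝔤)`, with its usual topology as a subgroup of `GL(𝔤)`. -/
def LieAut : Subgroup (𝔤 →L[ℝ] 𝔤)ˣ where
  carrier := {a | ∀ u v : 𝔤, (a : 𝔤 →L[ℝ] 𝔤) ⁅u, v⁆ =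
    ⁅(a : 𝔤 →L[ℝ] 𝔤) u, (a : 𝔤 →L[ℝ] 𝔤) v⁆}
  mul_mem' := by
    intro a b ha hb u v
    change (a : 𝔤 →L[ℝ] 𝔤) ((b : 𝔤 →L[ℝ] 𝔤) ⁅u, v⁆) = _
    rw [hb u v, ha]
    rfl
  one_mem' := by intro u v; simp
  inv_mem' := by
    intro a ha u v
    have key (x : 𝔤) : (a : 𝔤 →L[ℝ] 𝔤) (((a⁻¹ : (𝔤 →L[ℝ] 𝔤)ˣ) : 𝔤 →L[ℝ] 𝔤) x) = x :=
      congrArg (fun T : 𝔤 →L[ℝ] 𝔤 ↦ T x) a.mul_inv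
    have key' (x : 𝔤) : ((a⁻¹ : (𝔤 →L[ℝ] 𝔤)ˣ) : 𝔤 →L[ℝ] 𝔤) ((a : 𝔤 →L[ℝ] 𝔤) x) = x :=
      congrArg (fun T : 𝔤 →L[ℝ] 𝔤 ↦ T x) a.inv_mul
    have h := ha (((a⁻¹ : (𝔤 →L[ℝ] 𝔤)ˣ) : 𝔤 →L[ℝ] 𝔤) u) (((a⁻¹ : (𝔤 →L[ℝ] 𝔤)ˣ) : 𝔤 →L[ℝ] 𝔤) v)
    rw [key, key] at h
    rw [← h, key']

/-- The adjoint operator `ad u = ⁅u, ·⁆` as a continuous linear map. -/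
def adCLM (u : 𝔤) : 𝔤 →L[ℝ] 𝔤 := LinearMap.toContinuousLinearMap (LieAlgebra.ad ℝ 𝔤 u)

/-- The group `Inn(𝔤)` generated by the automorphisms `exp (ad u)`, `u ∈ 𝔤`. -/
def LieInn : Subgroup (LieAut 𝔤) :=
  Subgroup.closure {a | ∃ u : 𝔤, ((a : (𝔤 →L[ℝ] 𝔤)ˣ) : 𝔤 →L[ℝ] 𝔤) = NormedSpace.exp (adCLM 𝔤 u)}

instance LieInn_normal : (LieInn 𝔤).Normal where
  conj_mem := by
    intro a ha b
    unfold LieInn at ha ⊢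
    induction ha using Subgroup.closure_induction with
    | mem a ha =>
      obtain ⟨u, hu⟩ := ha
      refine Subgroup.subset_closure
        ⟨((b : (𝔤 →L[ℝ] 𝔤)ˣ) : 𝔤 →L[ℝ] 𝔤) u, ?_⟩
      have hb := b.2
      have key (x : 𝔤) : ((b : (𝔤 →L[ℝ] 𝔤)ˣ) : 𝔤 →L[ℝ] 𝔤)
          ((((b : (𝔤 →L[ℝ] 𝔤)ˣ)⁻¹ : (𝔤 →L[ℝ] 𝔤)ˣ) : 𝔤 →L[ℝ] 𝔤) x) = x :=
        congrArg (fun T : 𝔤 →L[ℝ] 𝔤 ↦ T x) (b : (𝔤 →L[ℝ] 𝔤)ˣ).mul_inv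
      have hconj : adCLM 𝔤 (((b : (𝔤 →L[ℝ] 𝔤)ˣ) : 𝔤 →L[ℝ] 𝔤) u) =
          ((b : (𝔤 →L[ℝ] 𝔤)ˣ) : 𝔤 →L[ℝ] 𝔤) * adCLM 𝔤 u *
            (((b : (𝔤 →L[ℝ] 𝔤)ˣ)⁻¹ : (𝔤 →L[ℝ] 𝔤)ˣ) : 𝔤 →L[ℝ] 𝔤) := by
        ext x
        have h := hb u ((((b : (𝔤 →L[ℝ] 𝔤)ˣ)⁻¹ : (𝔤 →L[ℝ] 𝔤)ˣ) : 𝔤 →L[ℝ] 𝔤) x)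
        rw [key] at h
        exact h.symm
      have : CompleteSpace 𝔤 := FiniteDimensional.complete ℝ 𝔤
      let : NormedAlgebra ℚ (𝔤 →L[ℝ] 𝔤) := NormedAlgebra.restrictScalars ℚ ℝ (𝔤 →L[ℝ] 𝔤)
      rw [hconj, NormedSpace.exp_units_conj, ← hu]
      rfl
    | one => simp
    | mul x y _ _ hx hy =>
      have : b * (x * y) * b⁻¹ = (b * x * b⁻¹) * (b * y * b⁻¹) := by group
      rw [this]; exact mul_mem hx hy
    | inv x _ hx =>
      have : b * x⁻¹ * b⁻¹ = (b * x * b⁻¹)⁻¹ := by group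
      rw [this]; exact inv_mem hx

/-- The group `Aut(𝔤)` carrying the topology of `Aut^δ(𝔤)`. -/
def AutDelta : Type _ := LieAut 𝔤

instance : Group (AutDelta 𝔤) := inferInstanceAs (Group (LieAut 𝔤))

/-- The coarsest topology that is finer than the usual one and for which the quotient map to
`Aut(𝔤) / Inn(𝔤)`, with the discrete topology on the quotient, is continuous. -/
instance : TopologicalSpace (AutDelta 𝔤) :=
  (inferInstanceAs (TopologicalSpace (LieAut 𝔤))) ⊓
    TopologicalSpace.induced (QuotientGroup.mk : LieAut 𝔤 → LieAut 𝔤 ⧸ LieInn 𝔤) ⊥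

instance : IsTopologicalGroup (AutDelta 𝔤) := by
  let t1 : TopologicalSpace (LieAut 𝔤) := inferInstance
  let t2 : TopologicalSpace (LieAut 𝔤) :=
    TopologicalSpace.induced (QuotientGroup.mk' (LieInn 𝔤)) ⊥
  have h1 : @IsTopologicalGroup (LieAut 𝔤) t1 _ := inferInstance
  have h2 : @IsTopologicalGroup (LieAut 𝔤) t2 _ := by
    let : TopologicalSpace (LieAut 𝔤 ⧸ LieInn 𝔤) := ⊥
    have : DiscreteTopology (LieAut 𝔤 ⧸ LieInn 𝔤) := ⟨rfl⟩
    have : IsTopologicalGroup (LieAut 𝔤 ⧸ LieInn 𝔤) := {}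
    exact topologicalGroup_induced (QuotientGroup.mk' (LieInn 𝔤))
  exact topologicalGroup_inf h1 h2

variable {𝔤}

/-- A Lie algebra automorphism as an element of `Aut^δ(𝔤)`. -/
def AutDelta.ofLieEquiv (e : 𝔤 ≃ₗ⁅ℝ⁆ 𝔤) : AutDelta 𝔤 :=
  ⟨ContinuousLinearEquiv.toUnit e.toLinearEquiv.toContinuousLinearEquiv,
    fun u v ↦ LieEquiv.map_lie e u v⟩

theorem AutDelta.ofLieEquiv_trans (e e' : 𝔤 ≃ₗ⁅ℝ⁆ 𝔤) :
    AutDelta.ofLieEquiv (e.trans e') = AutDelta.ofLieEquiv e' * AutDelta.ofLieEquiv e :=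
  Subtype.ext (Units.ext (ContinuousLinearMap.ext fun _ ↦ rfl))

theorem AutDelta.ofLieEquiv_refl :
    AutDelta.ofLieEquiv (LieEquiv.refl : 𝔤 ≃ₗ⁅ℝ⁆ 𝔤) = 1 :=
  Subtype.ext (Units.ext (ContinuousLinearMap.ext fun _ ↦ rfl))

theorem AutDelta.ofLieEquiv_symm (e : 𝔤 ≃ₗ⁅ℝ⁆ 𝔤) :
    AutDelta.ofLieEquiv e.symm = (AutDelta.ofLieEquiv e)⁻¹ := by
  refine eq_inv_of_mul_eq_one_left ?_
  rw [← AutDelta.ofLieEquiv_trans, ← AutDelta.ofLieEquiv_refl]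
  congr 1
  ext x
  exact e.symm_apply_apply x

end Automorphisms

section Bundle

variable {n : ℕ} {M : Type u} [TopologicalSpace M] [ChartedSpace (EuclideanSpace ℝ (Fin n)) M]
  [IsManifold (𝓡 n) ∞ M]
  (𝔤 : Type*) [NormedAddCommGroup 𝔤] [NormedSpace ℝ 𝔤] [FiniteDimensional ℝ 𝔤]
  [RealLieAlgebra 𝔤]
  (L : M → Type*) [∀ x, LieRing (L x)] [∀ x, LieAlgebra ℝ (L x)]
  [∀ x, TopologicalSpace (L x)] [∀ x, IsTopologicalAddGroup (L x)]
  [∀ x, ContinuousSMul ℝ (L x)]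
  [TopologicalSpace (TotalSpace 𝔤 L)] [FiberBundle 𝔤 L] [VectorBundle ℝ 𝔤 L]
  [ContMDiffVectorBundle ∞ 𝔤 L (𝓡 n)]

/-- A smooth local trivialization `φ : U × 𝔤 → L|_U` by Lie algebra isomorphisms
`φ x : 𝔤 ≃ L x`, `x ∈ U`. The values `φ x` for `x ∉ U` carry no information. As `φ x` is linear and
`𝔤` is finite dimensional, `φ` is smooth iff it is smooth in `x` for each fixed vector of `𝔤`. -/
structure LieTrivialization where
  base : Set M
  isOpen_base : IsOpen base
  toEquiv : ∀ x : M, 𝔤 ≃ₗ⁅ℝ⁆ L x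
  smooth : ∀ v : 𝔤, ContMDiffOn (𝓡 n) ((𝓡 n).prod 𝓘(ℝ, 𝔤)) ∞
    (fun x ↦ TotalSpace.mk' 𝔤 x (toEquiv x v)) base

/-- `L` is a Lie algebra bundle with fibre `𝔤` and structure group `Aut(𝔤)`: a smooth vector bundle
with fibrewise brackets, locally isomorphic to `U × 𝔤` by fibrewise Lie algebra isomorphisms. -/
def IsLieAlgebraBundle : Prop :=
  ∀ x : M, ∃ φ : LieTrivialization (n := n) 𝔤 L, x ∈ φ.base

variable {𝔤 L}

/-- Smooth vector fields on `M`. -/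
def IsSmoothField (X : ∀ x : M, TangentSpace (𝓡 n) x) : Prop :=
  ContMDiff (𝓡 n) (𝓡 n).tangent ∞ (fun x ↦ (TotalSpace.mk x (X x) : TangentBundle (𝓡 n) M))

variable (n 𝔤) in
/-- Smooth sections of `L`. -/
def IsSmoothSection (u : ∀ x : M, L x) : Prop :=
  ContMDiff (𝓡 n) ((𝓡 n).prod 𝓘(ℝ, 𝔤)) ∞ (fun x ↦ TotalSpace.mk' 𝔤 x (u x))

variable (n 𝔤 L) in
/-- A linear connection on `L`: a smooth covariant derivative that satisfies the Leibniz rule for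
the fibrewise brackets. In Mathlib's convention, `∇ u x (X x)` is `(∇_X u)(x)`. -/
structure LieConnection extends CovariantDerivative (𝓡 n) 𝔤 L where
  smooth : CovariantDerivative.ContMDiffCovariantDerivative toCovariantDerivative ∞
  map_lie : ∀ u v : (∀ x : M, L x), IsSmoothSection n 𝔤 u → IsSmoothSection n 𝔤 v →
    ∀ (x : M) (X : TangentSpace (𝓡 n) x),
      toFun (fun y ↦ ⁅u y, v y⁆) x X = ⁅toFun u x X, v x⁆ + ⁅u x, toFun v x X⁆

/-- The curvature `R(X, Y) u = ∇_X ∇_Y u - ∇_Y ∇_X u - ∇_[X, Y] u`. -/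
def LieConnection.curvature (D : LieConnection n 𝔤 L) (X Y : ∀ x : M, TangentSpace (𝓡 n) x)
    (u : ∀ x : M, L x) (x : M) : L x :=
  D.toFun (fun y ↦ D.toFun u y (Y y)) x (X x) - D.toFun (fun y ↦ D.toFun u y (X y)) x (Y x)
    - D.toFun u x (VectorField.mlieBracket (𝓡 n) X Y x)

/-- A connection is in accordance with `Aut^δ(𝔤)` if `R(X, Y) u = [Ω(X, Y), u]` for some smooth
differential 2-form `Ω` on `M` with values in `L`. -/
def LieConnection.InAccordance (D : LieConnection n 𝔤 L) : Prop :=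
  ∃ Ω : ∀ x : M, (TangentSpace (𝓡 n) x) [⋀^Fin 2]→ₗ[ℝ] L x,
    (∀ X Y : (∀ x : M, TangentSpace (𝓡 n) x), IsSmoothField X → IsSmoothField Y →
      IsSmoothSection n 𝔤 (fun x ↦ Ω x ![X x, Y x])) ∧
    ∀ (X Y : ∀ x : M, TangentSpace (𝓡 n) x) (u : ∀ x : M, L x),
      IsSmoothField X → IsSmoothField Y → IsSmoothSection n 𝔤 u →
      ∀ x, D.curvature X Y u x = ⁅Ω x ![X x, Y x], u x⁆

variable (n 𝔤 L) in
/-- The connections that are in accordance with `Aut^δ(𝔤)`. -/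
def AccordantConnection : Type _ := {D : LieConnection n 𝔤 L // D.InAccordance}

/-- Two connections are in the same class if `∇'_X u = ∇_X u + [l(X), u]` for some smooth bundle map
`l : TM → L`. -/
def AccordantConnection.Rel (D D' : AccordantConnection n 𝔤 L) : Prop :=
  ∃ l : ∀ x : M, TangentSpace (𝓡 n) x →ₗ[ℝ] L x,
    (∀ X : (∀ x : M, TangentSpace (𝓡 n) x), IsSmoothField X →
      IsSmoothSection n 𝔤 (fun x ↦ l x (X x))) ∧
    ∀ u : (∀ x : M, L x), IsSmoothSection n 𝔤 u → ∀ (x : M) (X : TangentSpace (𝓡 n) x),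
      D'.1.toFun u x X = D.1.toFun u x X + ⁅l x X, u x⁆

variable (n 𝔤 L) in
instance AccordantConnection.setoid : Setoid (AccordantConnection n 𝔤 L) where
  r := AccordantConnection.Rel
  iseqv := by
    refine ⟨fun D ↦ ⟨0, fun X _ ↦ ?_, fun u _ x X ↦ by simp⟩, ?_, ?_⟩
    · exact contMDiff_zeroSection ℝ L
    · rintro D D' ⟨l, hl, h⟩
      refine ⟨fun x ↦ -l x, fun X hX ↦ (hl X hX).neg_section, fun u hu x X ↦ ?_⟩
      rw [h u hu x X, LinearMap.neg_apply, neg_lie, add_neg_cancel_right]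
    · rintro D D' D'' ⟨l, hl, h⟩ ⟨l', hl', h'⟩
      refine ⟨fun x ↦ l x + l' x, fun X hX ↦ (hl X hX).add_section (hl' X hX),
        fun u hu x X ↦ ?_⟩
      rw [h' u hu x X, h u hu x X, LinearMap.add_apply, add_lie, add_assoc]

variable (n 𝔤 L) in
/-- `Coup(L)`: the couplings of `L` with `TM`. -/
def Coup : Type _ := Quotient (AccordantConnection.setoid n 𝔤 L)

/-- The transition function `x ↦ φ'(x)⁻¹ ∘ φ(x)`, which is meaningful on the intersection of the
bases. -/
def LieTrivialization.transition (φ φ' : LieTrivialization (n := n) 𝔤 L) (x : M) : AutDelta 𝔤 :=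
  AutDelta.ofLieEquiv ((φ.toEquiv x).trans (φ'.toEquiv x).symm)

/-- Two trivializations are `δ`-compatible if their transition function is continuous as a map to
`Aut^δ(𝔤)`. -/
def LieTrivialization.DeltaCompatible (φ φ' : LieTrivialization (n := n) 𝔤 L) : Prop :=
  ContinuousOn (φ.transition φ') (φ.base ∩ φ'.base)

variable (n 𝔤 L) in
/-- A locally trivial structure on `L` with structure group `Aut^δ(𝔤)`, indexed by `ι`. -/
structure DeltaStructure (ι : Type w) where
  triv : ι → LieTrivialization (n := n) 𝔤 L
  cover : ∀ x : M, ∃ α, x ∈ (triv α).base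
  compatible : ∀ α β, (triv α).DeltaCompatible (triv β)

/-- Equivalence of locally trivial structures, possibly over different coverings: all trivializations
of the one are `δ`-compatible with all trivializations of the other. -/
def DeltaStructure.Equivalent {ι κ : Type w} (Φ : DeltaStructure n 𝔤 L ι)
    (Ψ : DeltaStructure n 𝔤 L κ) : Prop :=
  ∀ α β, (Φ.triv α).DeltaCompatible (Ψ.triv β)

variable (n 𝔤 L) in
instance DeltaStructure.setoid : Setoid (Σ ι : Type u, DeltaStructure n 𝔤 L ι) where
  r Φ Ψ := Φ.2.Equivalent Ψ.2
  iseqv := by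
    refine ⟨fun Φ ↦ Φ.2.compatible, ?_, ?_⟩
    · intro Φ Ψ h β α
      have := (h α β).inv
      unfold LieTrivialization.DeltaCompatible
      rw [inter_comm]
      refine this.congr fun x _ ↦ ?_
      simp only [LieTrivialization.transition, Pi.inv_apply]
      rw [← AutDelta.ofLieEquiv_symm]
      rfl
    · intro Φ Ψ Θ h h' α γ x hx
      obtain ⟨β, hβ⟩ := Ψ.2.cover x
      have h1 : ContinuousAt ((Φ.2.triv α).transition (Ψ.2.triv β)) x :=
        (h α β).continuousAt ((((Φ.2.triv α).isOpen_base.inter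
          (Ψ.2.triv β).isOpen_base)).mem_nhds ⟨hx.1, hβ⟩)
      have h2 : ContinuousAt ((Ψ.2.triv β).transition (Θ.2.triv γ)) x :=
        (h' β γ).continuousAt ((((Ψ.2.triv β).isOpen_base.inter
          (Θ.2.triv γ).isOpen_base)).mem_nhds ⟨hβ, hx.2⟩)
      refine ((h2.mul h1).congr (Filter.Eventually.of_forall fun y ↦ ?_)).continuousWithinAt
      simp only [LieTrivialization.transition, Pi.mul_apply]
      rw [← AutDelta.ofLieEquiv_trans]
      congr 1
      ext v
      simp [LieEquiv.trans_apply]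

variable (n 𝔤 L) in
/-- `LAB^δ(L)`: equivalence classes of locally trivial structures on `L` with structure group
`Aut^δ(𝔤)`. -/
def LABDelta : Type _ := Quotient (DeltaStructure.setoid n 𝔤 L)

variable (n 𝔤 L) in
/-- An atlas of charts `U_α ≅ ℝⁿ`, with the points `x_α ∈ U_α` that correspond to `0 ∈ ℝⁿ` as central
points, and Lie algebra isomorphisms `ψ_α : 𝔤 ≃ L x_α`. -/
structure RadialAtlas (ι : Type w) where
  chart : ι → OpenPartialHomeomorph M (EuclideanSpace ℝ (Fin n))
  mem_maximalAtlas : ∀ α, chart α ∈ IsManifold.maximalAtlas (𝓡 n) ∞ M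
  target_eq : ∀ α, (chart α).target = univ
  cover : ∀ x : M, ∃ α, x ∈ (chart α).source
  frame : ∀ α, 𝔤 ≃ₗ⁅ℝ⁆ L ((chart α).symm 0)

/-- The radial path in `U_α` from `x_α` (at `t = 0`) to `x` (at `t = 1`). -/
def RadialAtlas.path {ι : Type w} (𝒜 : RadialAtlas n 𝔤 L ι) (α : ι) (x : M) (t : ℝ) : M :=
  (𝒜.chart α).symm (t • 𝒜.chart α x)

/-- The curve `s`, `t ∈ [0, 1]`, in the total space of `L` is parallel along `γ`: it lies over `γ` and
its covariant derivative vanishes. If `c` is the fibre coordinate of `s` in a local trivialization `e`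
around `γ t`, the covariant derivative of `s` at `t` is `e⁻¹ (c' t) + ∇_{γ' t} (e⁻¹ (c t))`, where
the second term differentiates the local section with constant coordinate `c t`. -/
def LieConnection.IsParallelAlong (D : LieConnection n 𝔤 L) (γ : ℝ → M)
    (s : ℝ → TotalSpace 𝔤 L) : Prop :=
  ∀ t ∈ Icc (0 : ℝ) 1, (s t).proj = γ t ∧
    let e := trivializationAt 𝔤 L (γ t)
    let c : ℝ → 𝔤 := fun τ ↦ (e (s τ)).2
    ∃ c' : 𝔤, HasDerivWithinAt c c' (Icc (0 : ℝ) 1) t ∧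
      e.symm (γ t) c' +
        D.toFun (fun y ↦ e.symm y (c t)) (γ t) (mfderiv 𝓘(ℝ, ℝ) (𝓡 n) γ t (1 : ℝ)) = 0

/-- `Φ` consists of the trivializations `φ_α^∇` over the charts of `𝒜`, where `φ_α^∇ x` is `ψ_α`
followed by parallel transport along the radial path from `x_α` to `x`. -/
def DeltaStructure.IsRadialTransport {ι : Type w} (Φ : DeltaStructure n 𝔤 L ι)
    (𝒜 : RadialAtlas n 𝔤 L ι) (D : LieConnection n 𝔤 L) : Prop :=
  ∀ α, (Φ.triv α).base = (𝒜.chart α).source ∧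
    ∀ x ∈ (𝒜.chart α).source, ∀ v : 𝔤, ∃ s : ℝ → TotalSpace 𝔤 L,
      D.IsParallelAlong (𝒜.path α x) s ∧
      s 0 = TotalSpace.mk' 𝔤 ((𝒜.chart α).symm 0) (𝒜.frame α v) ∧
      s 1 = TotalSpace.mk' 𝔤 x ((Φ.triv α).toEquiv x v)

/-- `f` sends the class of every connection `∇`, for all choices of an atlas, of central points and
of isomorphisms `ψ_α`, to the class of the trivializations `φ_α^∇` (which, in particular, form a
locally trivial structure with structure group `Aut^δ(𝔤)`). -/
def IsParallelTransportMap (f : Coup n 𝔤 L → LABDelta n 𝔤 L) : Prop :=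
  ∀ (ι : Type u) (𝒜 : RadialAtlas n 𝔤 L ι) (D : AccordantConnection n 𝔤 L),
    ∃ Φ : DeltaStructure n 𝔤 L ι, Φ.IsRadialTransport 𝒜 D.1 ∧
      f (Quotient.mk _ D) = Quotient.mk _ ⟨ι, Φ⟩

/-- The flat connection of a trivialization: `∇^φ_X u = φ (∂_X (φ⁻¹ u))`. -/
def LieTrivialization.flatDeriv (φ : LieTrivialization (n := n) 𝔤 L) (u : ∀ x : M, L x) (x : M)
    (X : TangentSpace (𝓡 n) x) : L x :=
  φ.toEquiv x (mfderiv (𝓡 n) 𝓘(ℝ, 𝔤) (fun y ↦ (φ.toEquiv y).symm (u y)) x X)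

/-- `∇^{Φ,H}_X u = ∑_α ∇^{φ_α}_X (h_α u)`. Where `x` is outside of the support of `h_α`, and so wherever
`φ_α` is not defined, the summand is zero because `h_α u` vanishes near `x`. -/
def DeltaStructure.glue {ι : Type w} (Φ : DeltaStructure n 𝔤 L ι)
    (H : SmoothPartitionOfUnity ι (𝓡 n) M univ) (u : ∀ x : M, L x) (x : M)
    (X : TangentSpace (𝓡 n) x) : L x :=
  ∑ᶠ α, (Φ.triv α).flatDeriv (fun y ↦ H α y • u y) x X

/-- `g` sends the class of every `Φ`, for all choices of a subordinate partition of unity `H`, to the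
class of `∇^{Φ,H}` (which, in particular, is a connection in accordance with `Aut^δ(𝔤)`). -/
def IsGluingMap (g : LABDelta n 𝔤 L → Coup n 𝔤 L) : Prop :=
  ∀ (ι : Type u) (Φ : DeltaStructure n 𝔤 L ι) (H : SmoothPartitionOfUnity ι (𝓡 n) M univ),
    H.IsSubordinate (fun α ↦ (Φ.triv α).base) →
    ∃ D : AccordantConnection n 𝔤 L,
      (∀ u : (∀ x : M, L x), IsSmoothSection n 𝔤 u → ∀ (x : M) (X : TangentSpace (𝓡 n) x),
        D.1.toFun u x X = Φ.glue H u x X) ∧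
      g (Quotient.mk _ ⟨ι, Φ⟩) = Quotient.mk _ D

end Bundle

end

/-! Call a connection `∇` adapted to a trivialization `φ` if its connection form `ω(X) = φ⁻¹ ∇_X φ`
takes values in `ad 𝔤`, the space of inner derivations. The proof studies the relation "`∇` is
adapted to every trivialization of `Φ`" (`AdaptedTo`). Each connection in accordance is adapted to
some `Φ`, and each `Φ` has an adapted connection. Structures to which one connection is adapted are
equivalent, and connections adapted to one structure lie in the same class. The relation also
survives a change of either side within its class. So it is the graph of a bijection between
couplings and classes of structures. Radial transport and gluing both produce adapted pairs, which
forces `f` and `g` to be this bijection and its inverse.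

From `∇` to `Φ`: in a radial gauge, `A(y) y = 0`, one has `d/dt (t A(ty) v) = F(ty)(ty, v)`. The
curvature `F` takes values in `ad 𝔤`, hence so does `A` (`Submodule.mem_of_radial`,
`IsRadial.adapted`). That radial transport is smooth is smooth dependence on parameters for linear
differential equations, obtained by inverting `1` minus a Volterra operator on short time intervals.

From `Φ` to `∇`: in the trivialization `φ_β` the glued connection has the form `∑ h_α a_α⁻¹ da_α`,
where `a_α = φ_α⁻¹ φ_β`.

Comparison: for `a = φ'⁻¹ φ` the change of gauge reads `a⁻¹ da = ω - a⁻¹ ω' a`, and conjugation by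
automorphisms preserves `ad 𝔤`. What remains is that `a⁻¹ da` has values in `ad 𝔤` exactly when `a`
stays locally in one coset of `Inn(𝔤)`. Both directions use a coordinate `ζ` near `1` whose zeros
are exponentials of elements of `ad 𝔤` and which is constant along maps with logarithmic derivative
in `ad 𝔤` (`exists_transversal_coordinate`). One direction is immediate. In the other, `Inn(𝔤)` may
fail to be closed; but it is a countable union of images of finite products of exponentials, so `ζ`
takes only countably many values on it near `1`, and a continuous function on a ball with countably
many values is constant.

Finally, a linear right inverse `σ` of `ad` over `ad 𝔤` turns curvature forms into `Ω` and
differences of connection forms into `l`; partitions of unity make both global. -/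

set_option linter.unusedSectionVars false

/-! ### The exponential map along a subspace of an algebra -/

section ExpSubspace

open NormedSpace

variable {V : Type*} [NormedRing V] [NormedAlgebra ℝ V] [FiniteDimensional ℝ V]

theorem contDiff_normedSpace_exp {n : WithTop ℕ∞} : ContDiff ℝ n (exp : V → V) := by
  have : CompleteSpace V := FiniteDimensional.complete ℝ V
  have h : AnalyticOnNhd ℝ (exp : V → V) univ := fun x _ ↦ exp_analytic x
  exact h.contDiff

theorem exp_neg_mul_exp (h : V) : exp (-h) * exp h = 1 := by
  have : CompleteSpace V := FiniteDimensional.complete ℝ V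
  let : NormedAlgebra ℚ V := NormedAlgebra.restrictScalars ℚ ℝ V
  rw [← exp_add_of_commute (Commute.neg_left (Commute.refl h)), neg_add_cancel, exp_zero]

theorem exp_mul_exp_neg (h : V) : exp h * exp (-h) = 1 := by
  simpa using exp_neg_mul_exp (-h)

/-- A subspace of a finite dimensional space is the kernel of a continuous projection. -/
theorem Submodule.exists_isCompl_projection {E : Type*} [NormedAddCommGroup E] [NormedSpace ℝ E]
    [FiniteDimensional ℝ E] (𝔥 : Submodule ℝ E) :
    ∃ W : Submodule ℝ E, IsCompl 𝔥 W ∧ ∃ P : E →L[ℝ] E,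
      (∀ x, P x = 0 ↔ x ∈ 𝔥) ∧ ∀ z ∈ W, P z = z := by
  obtain ⟨W, hW⟩ := 𝔥.exists_isCompl
  refine ⟨W, hW, LinearMap.toContinuousLinearMap
    (W.subtype ∘ₗ Submodule.projectionOnto W 𝔥 hW.symm), fun x ↦ ?_, fun z hz ↦ ?_⟩
  · simp
  · exact congrArg Subtype.val (Submodule.projectionOnto_apply_left hW.symm ⟨z, hz⟩)

/-- Composed with a projection whose kernel is `𝔥`, the function has derivative zero, so it is
constant. -/
theorem Submodule.mem_of_hasDerivWithinAt_mem {E : Type*} [NormedAddCommGroup E] [NormedSpace ℝ E]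
    [FiniteDimensional ℝ E] (𝔥 : Submodule ℝ E) {f f' : ℝ → E}
    (hf : ∀ t ∈ Icc (0 : ℝ) 1, HasDerivWithinAt f (f' t) (Icc 0 1) t)
    (hf' : ∀ t ∈ Icc (0 : ℝ) 1, f' t ∈ 𝔥) (h0 : f 0 ∈ 𝔥) : f 1 ∈ 𝔥 := by
  obtain ⟨W, -, P, hP, -⟩ := 𝔥.exists_isCompl_projection
  have hd : ∀ t ∈ Icc (0 : ℝ) 1, HasDerivWithinAt (fun t ↦ P (f t)) 0 (Icc 0 1) t := fun t ht ↦ by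
    have := P.hasFDerivAt.comp_hasDerivWithinAt t (hf t ht)
    rwa [(hP _).2 (hf' t ht)] at this
  have hc := constant_of_derivWithin_zero (f := fun t ↦ P (f t)) (a := 0) (b := 1)
    (fun t ht ↦ (hd t ht).differentiableWithinAt)
    (fun t ht ↦ (hd t (Ico_subset_Icc_self ht)).derivWithin
      (uniqueDiffOn_Icc zero_lt_one t (Ico_subset_Icc_self ht))) 1 (by simp)
  rw [← hP, hc, hP]
  exact h0

/-- The derivative of a function with values in a subspace. -/
theorem Submodule.fderiv_mem_of_eventually {E F : Type*} [NormedAddCommGroup E] [NormedSpace ℝ E]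
    [FiniteDimensional ℝ E] [NormedAddCommGroup F] [NormedSpace ℝ F]
    (𝔥 : Submodule ℝ E) {f : F → E} {f' : F →L[ℝ] E} {x : F} (hf : HasFDerivAt f f' x)
    (h : ∀ᶠ y in 𝓝 x, f y ∈ 𝔥) (v : F) : f' v ∈ 𝔥 := by
  obtain ⟨W, -, P, hP, -⟩ := 𝔥.exists_isCompl_projection
  have h1 : HasFDerivAt (fun y ↦ P (f y)) (P.comp f') x := P.hasFDerivAt.comp x hf
  have h2 : HasFDerivAt (fun y ↦ P (f y)) (0 : F →L[ℝ] E) x :=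
    (hasFDerivAt_const (0 : E) x).congr_of_eventuallyEq (h.mono fun y hy ↦ (hP _).2 hy)
  rw [← hP]
  exact congrArg (fun T : F →L[ℝ] E ↦ T v) (h1.unique h2)

/-- If conjugation by `exp h`, `h ∈ 𝔥`, preserves `𝔥`, the logarithmic derivative of `exp` along
`𝔥` has values in `𝔥`. -/
theorem exp_neg_mul_fderiv_exp_mem (𝔥 : Submodule ℝ V)
    (hconj : ∀ h ∈ 𝔥, ∀ k ∈ 𝔥, exp (-h) * k * exp h ∈ 𝔥) {h k : V} (hh : h ∈ 𝔥) (hk : k ∈ 𝔥) :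
    exp (-h) * fderiv ℝ exp h k ∈ 𝔥 := by
  have : CompleteSpace V := FiniteDimensional.complete ℝ V
  obtain ⟨W, -, P, hP, -⟩ := 𝔥.exists_isCompl_projection
  have hexp : Continuous (exp : V → V) := contDiff_normedSpace_exp (n := 0) |>.continuous
  have hd : HasDerivAt (fun s : ℝ ↦ P (exp (-h) * exp (h + s • k)))
      (P (exp (-h) * fderiv ℝ exp h k)) 0 := by
    have h1 : HasDerivAt (fun s : ℝ ↦ h + s • k) k 0 := by
      simpa using ((hasDerivAt_id (0 : ℝ)).smul_const k).const_add h
    have h2 : HasFDerivAt (exp : V → V) (fderiv ℝ exp h) (h + (0 : ℝ) • k) := by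
      rw [zero_smul, add_zero]
      exact ((contDiff_normedSpace_exp (n := 1)).differentiable one_ne_zero h).hasFDerivAt
    exact P.hasFDerivAt.comp_hasDerivAt 0 ((h2.comp_hasDerivAt 0 h1).const_mul (exp (-h)))
  have hG : Continuous fun q : ℝ × ℝ ↦ P (exp (-(q.2 • h)) * k * exp (q.2 • (h + q.1 • k))) := by
    fun_prop
  -- Duhamel's formula in the form of an estimate. The function `r ↦ P (exp (-rh) exp (r(h + sk)))`
  -- has derivative `s P (exp (-rh) k exp (r(h + sk)))`. As `s → 0`, the factor after `s` tends to
  -- `P (exp (-rh) k exp (rh)) = 0`, uniformly for `r` in the compact interval. The increment from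
  -- `r = 0` to `r = 1` is therefore `o(s)`.
  have hz : HasDerivAt (fun s : ℝ ↦ P (exp (-h) * exp (h + s • k))) 0 0 := by
    rw [hasDerivAt_iff_isLittleO, Asymptotics.isLittleO_iff]
    intro ε hε
    have hev : ∀ᶠ s in 𝓝 (0 : ℝ), ∀ r ∈ Icc (0 : ℝ) 1,
        ‖P (exp (-(r • h)) * k * exp (r • (h + s • k)))‖ < ε := by
      refine isCompact_Icc.eventually_forall_of_forall_eventually fun r hr ↦ ?_
      have : Filter.Tendsto (fun q : ℝ × ℝ ↦ ‖P (exp (-(q.2 • h)) * k * exp (q.2 • (h + q.1 • k)))‖)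
          (𝓝 (0, r)) (𝓝 0) := by
        have := hG.norm.tendsto (0, r)
        have h0 : P (exp (-(r • h)) * k * exp (r • h)) = 0 :=
          (hP _).2 (hconj _ (𝔥.smul_mem r hh) k hk)
        simpa [h0] using this
      exact this.eventually_lt_const hε
    filter_upwards [hev] with s hs
    have hder : ∀ r ∈ Icc (0 : ℝ) 1, HasDerivWithinAt
        (fun r : ℝ ↦ P (exp (-(r • h)) * exp (r • (h + s • k))))
        (s • P (exp (-(r • h)) * k * exp (r • (h + s • k)))) (Icc 0 1) r := by
      intro r _
      have e1 := hasDerivAt_exp_smul_const (𝕂 := ℝ) (-h) r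
      have e2 := hasDerivAt_exp_smul_const' (𝕂 := ℝ) (h + s • k) r
      have e3 := (P.hasFDerivAt.comp_hasDerivAt r (e1.mul e2)).hasDerivWithinAt (s := Icc 0 1)
      simp only [smul_neg] at e3
      refine e3.congr_deriv ?_
      rw [← map_smul]
      congr 1
      simp only [mul_add, mul_neg, neg_mul, mul_assoc, add_mul, mul_smul_comm, smul_mul_assoc]
      abel
    have hb := norm_image_sub_le_of_norm_deriv_le_segment_01' (C := |s| * ε) hder (by
      intro r hr
      rw [norm_smul, Real.norm_eq_abs]
      exact mul_le_mul_of_nonneg_left (hs r (Ico_subset_Icc_self hr)).le (abs_nonneg s))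
    simp only [one_smul, zero_smul, neg_zero, exp_zero, mul_one] at hb
    simpa [exp_neg_mul_exp, mul_comm] using hb
  rw [← hP]
  exact hd.unique hz

/-- Near `1`, the sets `g * exp 𝔥` are the fibres of a submersion `ζ`: it is constant along maps
whose logarithmic derivative has values in `𝔥`. -/
theorem exists_transversal_coordinate (𝔥 : Submodule ℝ V)
    (hconj : ∀ h ∈ 𝔥, ∀ k ∈ 𝔥, exp (-h) * k * exp h ∈ 𝔥) :
    ∃ (N : Set V) (ζ : V → V), IsOpen N ∧ 1 ∈ N ∧ ζ 1 = 0 ∧ ContinuousOn ζ N ∧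
      (∀ g ∈ N, ζ g = 0 → ∃ h ∈ 𝔥, g = exp h) ∧
      (∃ ζ' : V →L[ℝ] V, HasFDerivAt ζ ζ' 1 ∧ ∀ k, ζ' k = 0 → k ∈ 𝔥) ∧
      ∀ {F : Type w} [NormedAddCommGroup F] [NormedSpace ℝ F] (b : F → V) (b' : F →L[ℝ] V) (x : F),
        HasFDerivAt b b' x → b x ∈ N → (∀ v, ∃ k ∈ 𝔥, b' v = b x * k) →
        HasFDerivAt (fun y ↦ ζ (b y)) (0 : F →L[ℝ] V) x := by
  have : CompleteSpace V := FiniteDimensional.complete ℝ V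
  obtain ⟨W, hW, P, hP, hPW⟩ := 𝔥.exists_isCompl_projection
  -- With `W` a complement of `𝔥`, the map `(h, z) ↦ (1 + z) exp h` has the invertible derivative
  -- `(h, z) ↦ h + z` at `0`. The coordinate `ζ` is the `W`-component of its local inverse.
  let Ψ : 𝔥 × W → V := fun q ↦ (1 + (q.2 : V)) * exp (q.1 : V)
  have hΨ : ContDiff ℝ 1 Ψ := by
    have h1 : ContDiff ℝ 1 fun q : 𝔥 × W ↦ exp (q.1 : V) :=
      contDiff_normedSpace_exp.comp (𝔥.subtypeL.contDiff.comp contDiff_fst)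
    have h2 : ContDiff ℝ 1 fun q : 𝔥 × W ↦ (1 + (q.2 : V)) :=
      contDiff_const.add (W.subtypeL.contDiff.comp contDiff_snd)
    exact h2.mul h1
  let e : (𝔥 × W) ≃L[ℝ] V := (Submodule.prodEquivOfIsCompl 𝔥 W hW).toContinuousLinearEquiv
  have he : ∀ q : 𝔥 × W, e q = q.1 + q.2 := fun q ↦ rfl
  have hΨ0 : Ψ 0 = 1 := by simp [Ψ]
  have hΨ' : HasFDerivAt Ψ (e : (𝔥 × W) →L[ℝ] V) 0 := by
    have h1 : HasFDerivAt (fun q : 𝔥 × W ↦ exp (q.1 : V))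
        ((1 : V →L[ℝ] V).comp (𝔥.subtypeL.comp (ContinuousLinearMap.fst ℝ 𝔥 W))) 0 := by
      refine HasFDerivAt.comp (g := (exp : V → V)) (0 : 𝔥 × W) ?_
        (𝔥.subtypeL.comp (ContinuousLinearMap.fst ℝ 𝔥 W)).hasFDerivAt
      simpa using (hasFDerivAt_exp_zero (𝕂 := ℝ) (𝔸 := V))
    have h2 : HasFDerivAt (fun q : 𝔥 × W ↦ (1 + (q.2 : V)))
        (W.subtypeL.comp (ContinuousLinearMap.snd ℝ 𝔥 W)) 0 :=
      (W.subtypeL.comp (ContinuousLinearMap.snd ℝ 𝔥 W)).hasFDerivAt.const_add 1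
    refine (h2.mul' h1).congr_fderiv (ContinuousLinearMap.ext fun q ↦ ?_)
    simp [he]
  let G := hΨ.contDiffAt.toOpenPartialHomeomorph Ψ hΨ' one_ne_zero
  have hG : ContDiffAt ℝ 1 G.symm 1 := by
    have := hΨ.contDiffAt.to_localInverse hΨ' one_ne_zero
    rw [hΨ0] at this
    exact this
  have hGΨ : ∀ q, G q = Ψ q := fun q ↦ rfl
  have h0s : (0 : 𝔥 × W) ∈ G.source :=
    hΨ.contDiffAt.mem_toOpenPartialHomeomorph_source hΨ' one_ne_zero
  have h1t : (1 : V) ∈ G.target := by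
    have := G.map_source h0s
    rwa [hGΨ, hΨ0] at this
  have hG1 : G.symm 1 = 0 := by
    have := G.left_inv h0s
    rwa [hGΨ, hΨ0] at this
  -- The neighbourhood is shrunk so that `1 + z` is invertible and so close to `1` that the estimate
  -- `h8` at the end forces a vector to vanish.
  have hinv : ∀ᶠ g in 𝓝 (1 : V), IsUnit (1 + ((G.symm g).2 : V)) ∧
      ‖P‖ * ‖1 - Ring.inverse (1 + ((G.symm g).2 : V))‖ < 1 := by
    have hc : ContinuousAt (fun g ↦ (1 + ((G.symm g).2 : V))) 1 :=
      continuousAt_const.add (W.subtypeL.continuous.continuousAt.comp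
        (continuousAt_snd.comp hG.continuousAt))
    have h1 : (1 + ((G.symm 1).2 : V)) = 1 := by simp [hG1]
    have hc' : Filter.Tendsto (fun g ↦ (1 + ((G.symm g).2 : V))) (𝓝 1) (𝓝 1) := by
      have := hc.tendsto
      rwa [h1] at this
    have hi : Filter.Tendsto (fun z : V ↦ ‖P‖ * ‖1 - Ring.inverse z‖) (𝓝 1) (𝓝 0) := by
      have : ContinuousAt (fun z : V ↦ ‖P‖ * ‖1 - Ring.inverse z‖) ((1 : Vˣ) : V) :=
        continuousAt_const.mul (continuousAt_const.sub
          (NormedRing.inverse_continuousAt (1 : Vˣ))).norm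
      simpa [ContinuousAt] using this
    exact (hc'.eventually (Units.nhds (1 : Vˣ))).and
      ((hi.comp hc').eventually_lt_const zero_lt_one)
  have htgt : ∀ᶠ g in 𝓝 (1 : V), g ∈ G.target := G.open_target.mem_nhds h1t
  obtain ⟨N, hN, hNo, h1N⟩ := eventually_nhds_iff.1
    ((htgt.and (hG.eventually (by simp))).and hinv)
  have hζd : ∀ g ∈ N, HasFDerivAt (fun g ↦ ((G.symm g).2 : V))
      ((W.subtypeL.comp (ContinuousLinearMap.snd ℝ 𝔥 W)).comp (fderiv ℝ G.symm g)) g := fun g hg ↦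
    (W.subtypeL.comp (ContinuousLinearMap.snd ℝ 𝔥 W)).hasFDerivAt.comp g
      ((hN g hg).1.2.differentiableAt one_ne_zero).hasFDerivAt
  have hηd : ∀ g ∈ N, HasFDerivAt (fun g ↦ ((G.symm g).1 : V))
      ((𝔥.subtypeL.comp (ContinuousLinearMap.fst ℝ 𝔥 W)).comp (fderiv ℝ G.symm g)) g := fun g hg ↦
    (𝔥.subtypeL.comp (ContinuousLinearMap.fst ℝ 𝔥 W)).hasFDerivAt.comp g
      ((hN g hg).1.2.differentiableAt one_ne_zero).hasFDerivAt
  have hfac : ∀ g ∈ N, (1 + ((G.symm g).2 : V)) * exp ((G.symm g).1 : V) = g := fun g hg ↦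
    G.right_inv (hN g hg).1.1
  refine ⟨N, fun g ↦ ((G.symm g).2 : V), hNo, h1N, by simp [hG1],
    fun g hg ↦ (hζd g hg).continuousAt.continuousWithinAt, fun g hg h0 ↦
      ⟨(G.symm g).1, (G.symm g).1.2, by
        have := hfac g hg
        beta_reduce at h0
        rw [h0] at this
        simpa using this.symm⟩,
    ⟨_, hζd 1 h1N, fun k hk ↦ ?_⟩, ?_⟩
  · have h1 : HasFDerivAt G.symm (e.symm : V →L[ℝ] 𝔥 × W) 1 := by
      refine G.hasFDerivAt_symm h1t ?_
      rw [hG1]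
      exact hΨ'
    rw [h1.fderiv] at hk
    have h2 : (e.symm k).2 = 0 := Subtype.ext hk
    have h3 := he (e.symm k)
    rw [e.apply_symm_apply, h2] at h3
    rw [h3]
    simp
  · intro F _ _ b b' x hb hbN hlog
    have hζ := (hζd _ hbN).comp x hb
    have hη := (hηd _ hbN).comp x hb
    refine hζ.congr_fderiv (ContinuousLinearMap.ext fun v ↦ ?_)
    obtain ⟨k, hk, hbk⟩ := hlog v
    set z := (G.symm (b x)).2 with hz
    set h := (G.symm (b x)).1 with hh
    set q := fderiv ℝ G.symm (b x) (b' v) with hq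
    have hE : HasFDerivAt (fun y ↦ exp ((G.symm (b y)).1 : V)) _ x :=
      ((contDiff_normedSpace_exp (n := 1)).differentiable one_ne_zero (h : V)).hasFDerivAt.comp x hη
    have hprod := (hζ.const_add (1 : V)).mul' hE
    have hbeq : b =ᶠ[𝓝 x] ((fun y ↦ 1 + ((G.symm (b y)).2 : V)) *
        fun y ↦ exp ((G.symm (b y)).1 : V)) :=
      (hb.continuousAt.eventually (hNo.mem_nhds hbN)).mono fun y hy ↦ (hfac _ hy).symm
    have hb2 := congrArg (fun T : F →L[ℝ] V ↦ T v) (hb.unique (hprod.congr_of_eventuallyEq hbeq))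
    have hb3 : b' v = (1 + (z : V)) * fderiv ℝ exp (h : V) (q.1 : V) + (q.2 : V) * exp (h : V) := by
      simpa using hb2
    have hk2 := exp_neg_mul_fderiv_exp_mem 𝔥 hconj h.2 q.1.2
    set k2 := exp (-(h : V)) * fderiv ℝ exp (h : V) (q.1 : V) with hk2d
    have hk2' : fderiv ℝ exp (h : V) (q.1 : V) = exp (h : V) * k2 := by
      rw [hk2d, ← mul_assoc, exp_mul_exp_neg, one_mul]
    have hu := (hN _ hbN).2.1
    -- Two expressions for the derivative of `b = (1 + z) exp h` are compared: `b k` by hypothesis,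
    -- and the product rule, in which the derivative of `exp h` is `exp h * k2` with `k2 ∈ 𝔥`.
    have h4 : (q.2 : V) * exp (h : V) = (1 + (z : V)) * (exp (h : V) * (k - k2)) := by
      rw [hbk, ← hfac _ hbN, ← hz, ← hh, hk2'] at hb3
      rw [mul_sub, mul_sub]
      rw [eq_sub_iff_add_eq, ← mul_assoc (1 + (z : V)) _ k, hb3]
      abel
    have h5 : Ring.inverse (1 + (z : V)) * q.2 = exp (h : V) * (k - k2) * exp (-(h : V)) := by
      calc Ring.inverse (1 + (z : V)) * q.2
          = Ring.inverse (1 + (z : V)) * ((q.2 * exp (h : V)) * exp (-(h : V))) := by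
            rw [mul_assoc (q.2 : V), exp_mul_exp_neg, mul_one]
        _ = _ := by rw [h4, ← mul_assoc, ← mul_assoc, Ring.inverse_mul_cancel _ hu, one_mul]
    have h6 : P (Ring.inverse (1 + (z : V)) * q.2) = 0 := by
      rw [hP, h5]
      simpa using hconj (-h) (𝔥.neg_mem h.2) _ (𝔥.sub_mem hk hk2)
    -- `(1 + z)⁻¹ z'` lies in `𝔥` and is killed by `P`, while `P` fixes `z' ∈ W`. So `z' = P ((1 -
    -- (1 + z)⁻¹) z')`, which is a contraction applied to `z'`, and `z' = 0`.
    have h7 : (q.2 : V) = P ((1 - Ring.inverse (1 + (z : V))) * q.2) := by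
      rw [sub_mul, one_mul, map_sub, h6, sub_zero, hPW _ q.2.2]
    have h8 : ‖(q.2 : V)‖ ≤ ‖P‖ * ‖1 - Ring.inverse (1 + (z : V))‖ * ‖(q.2 : V)‖ := by
      conv_lhs => rw [h7]
      rw [mul_assoc]
      exact (P.le_opNorm _).trans (mul_le_mul_of_nonneg_left (norm_mul_le _ _) (norm_nonneg _))
    have h9 : ‖(q.2 : V)‖ = 0 := by
      nlinarith [(hN _ hbN).2.2, norm_nonneg (q.2 : V)]
    exact norm_eq_zero.1 h9

end ExpSubspace

/-! ### Inner derivations and cosets of the inner automorphisms -/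

section InnerAutomorphisms

variable {𝔤 : Type*} [NormedAddCommGroup 𝔤] [NormedSpace ℝ 𝔤] [FiniteDimensional ℝ 𝔤]
  [RealLieAlgebra 𝔤]

variable (𝔤) in
/-- The adjoint representation as a linear map to continuous linear maps. -/
noncomputable def adLinear : 𝔤 →L[ℝ] 𝔤 →L[ℝ] 𝔤 :=
  LinearMap.toContinuousLinearMap
    ((LinearMap.toContinuousLinearMap : (𝔤 →ₗ[ℝ] 𝔤) ≃ₗ[ℝ] 𝔤 →L[ℝ] 𝔤).toLinearMap ∘ₗ
      (LieAlgebra.ad ℝ 𝔤 : 𝔤 →ₗ[ℝ] Module.End ℝ 𝔤))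

@[simp]
theorem adLinear_apply (u v : 𝔤) : adLinear 𝔤 u v = ⁅u, v⁆ := rfl

variable (𝔤) in
/-- The subspace `ad 𝔤` of inner derivations. -/
noncomputable def innerDer : Submodule ℝ (𝔤 →L[ℝ] 𝔤) :=
  LinearMap.range (adLinear 𝔤).toLinearMap

theorem adLinear_mem (u : 𝔤) : adLinear 𝔤 u ∈ innerDer 𝔤 := ⟨u, rfl⟩

theorem mem_innerDer {T : 𝔤 →L[ℝ] 𝔤} : T ∈ innerDer 𝔤 ↔ ∃ u, adLinear 𝔤 u = T := Iff.rfl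

variable (𝔤) in
/-- A linear map that chooses `u` for each inner derivation `ad u`. -/
theorem exists_innerDer_section :
    ∃ σ : (𝔤 →L[ℝ] 𝔤) →L[ℝ] 𝔤, ∀ T ∈ innerDer 𝔤, adLinear 𝔤 (σ T) = T := by
  obtain ⟨g, hg⟩ := ((adLinear 𝔤).toLinearMap.rangeRestrict).exists_rightInverse_of_surjective
    (LinearMap.range_rangeRestrict _)
  obtain ⟨s, hs⟩ := LinearMap.exists_extend g
  refine ⟨LinearMap.toContinuousLinearMap s, fun T hT ↦ ?_⟩
  have h1 : s T = g ⟨T, hT⟩ := congrArg (fun f ↦ f ⟨T, hT⟩) hs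
  have h2 := congrArg (fun f ↦ ((f ⟨T, hT⟩ : LinearMap.range (adLinear 𝔤).toLinearMap) :
    𝔤 →L[ℝ] 𝔤)) hg
  change adLinear 𝔤 (s T) = T
  rw [h1]
  exact h2

/-- The operator underlying an automorphism. -/
noncomputable def autCLM (a : LieAut 𝔤) : 𝔤 →L[ℝ] 𝔤 := ((a : (𝔤 →L[ℝ] 𝔤)ˣ) : 𝔤 →L[ℝ] 𝔤)

theorem autCLM_mul (a b : LieAut 𝔤) : autCLM (a * b) = autCLM a * autCLM b := rfl

theorem autCLM_one : autCLM (1 : LieAut 𝔤) = 1 := rfl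

theorem autCLM_injective : Function.Injective (autCLM : LieAut 𝔤 → 𝔤 →L[ℝ] 𝔤) :=
  fun _ _ h ↦ Subtype.ext (Units.ext h)

theorem autCLM_inv_mul (a : LieAut 𝔤) : autCLM a⁻¹ * autCLM a = 1 := by
  rw [← autCLM_mul, inv_mul_cancel, autCLM_one]

theorem autCLM_mul_inv (a : LieAut 𝔤) : autCLM a * autCLM a⁻¹ = 1 := by
  rw [← autCLM_mul, mul_inv_cancel, autCLM_one]

theorem autCLM_lie (a : LieAut 𝔤) (u v : 𝔤) : autCLM a ⁅u, v⁆ = ⁅autCLM a u, autCLM a v⁆ := a.2 u v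

theorem autCLM_conj_ad (a : LieAut 𝔤) (u : 𝔤) :
    autCLM a⁻¹ * adLinear 𝔤 u * autCLM a = adLinear 𝔤 (autCLM a⁻¹ u) := by
  ext x
  have h := autCLM_lie a⁻¹ u (autCLM a x)
  have h2 : autCLM a⁻¹ (autCLM a x) = x := congrArg (fun T : 𝔤 →L[ℝ] 𝔤 ↦ T x) (autCLM_inv_mul a)
  rw [h2] at h
  exact h

theorem conj_mem_innerDer (a : LieAut 𝔤) {T : 𝔤 →L[ℝ] 𝔤} (hT : T ∈ innerDer 𝔤) :
    autCLM a⁻¹ * T * autCLM a ∈ innerDer 𝔤 := by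
  obtain ⟨u, rfl⟩ := mem_innerDer.1 hT
  rw [autCLM_conj_ad]
  exact adLinear_mem _

variable (𝔤) in
/-- The derivations of `𝔤`. -/
def IsLieDer (T : 𝔤 →L[ℝ] 𝔤) : Prop := ∀ u v : 𝔤, T ⁅u, v⁆ = ⁅T u, v⁆ + ⁅u, T v⁆

theorem isLieDer_adLinear (u : 𝔤) : IsLieDer 𝔤 (adLinear 𝔤 u) := fun x y ↦ by
  simp only [adLinear_apply]
  exact leibniz_lie u x y

theorem hasDerivWithinAt_ringInverse {V : Type*} [NormedRing V] [NormedAlgebra ℝ V]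
    [CompleteSpace V] {Y : ℝ → V} {Y' : V} {s : Set ℝ} {t : ℝ} (hY : HasDerivWithinAt Y Y' s t)
    (hu : IsUnit (Y t)) :
    HasDerivWithinAt (fun t ↦ Ring.inverse (Y t))
      (-(Ring.inverse (Y t) * Y' * Ring.inverse (Y t))) s t := by
  obtain ⟨y, hy⟩ := hu
  have h := hasFDerivAt_ringInverse (𝕜 := ℝ) y
  rw [hy] at h
  have h2 := h.comp_hasDerivWithinAt t hY
  have h3 : Ring.inverse (Y t) = ↑y⁻¹ := by rw [← hy, Ring.inverse_unit]
  rw [h3]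
  exact h2

/-- A solution of `Y' = B Y`, where `B` consists of derivations, consists of automorphisms. -/
theorem map_lie_of_hasDerivWithinAt {B Y : ℝ → 𝔤 →L[ℝ] 𝔤} {a b : ℝ} (hYa : Y a = 1)
    (hB : ∀ t ∈ Icc a b, IsLieDer 𝔤 (B t)) (hu : ∀ t ∈ Icc a b, IsUnit (Y t))
    (hY : ∀ t ∈ Icc a b, HasDerivWithinAt Y (B t * Y t) (Icc a b) t) {t : ℝ} (ht : t ∈ Icc a b)
    (u v : 𝔤) : Y t ⁅u, v⁆ = ⁅Y t u, Y t v⁆ := by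
  have : CompleteSpace 𝔤 := FiniteDimensional.complete ℝ 𝔤
  -- The candidate for a constant is `Y⁻¹ ⁅Y u, Y v⁆`: the derivation property of `B` cancels the
  -- derivative of `Y⁻¹` against that of the bracket.
  have hd : ∀ t ∈ Icc a b, HasDerivWithinAt
      (fun t ↦ Ring.inverse (Y t) (adLinear 𝔤 (Y t u) (Y t v))) 0 (Icc a b) t := by
    intro t ht
    have h1 := hasDerivWithinAt_ringInverse (hY t ht) (hu t ht)
    have hx (x : 𝔤) : HasDerivWithinAt (fun t ↦ Y t x) (B t (Y t x)) (Icc a b) t := by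
      simpa using (hY t ht).clm_apply (hasDerivWithinAt_const t (Icc a b) x)
    have h2 := h1.clm_apply
      (((adLinear 𝔤).hasFDerivAt.comp_hasDerivWithinAt t (hx u)).clm_apply (hx v))
    refine h2.congr_deriv ?_
    have h3 : Ring.inverse (Y t) * (B t * Y t) * Ring.inverse (Y t) =
        Ring.inverse (Y t) * B t := by
      rw [mul_assoc, mul_assoc, Ring.mul_inverse_cancel _ (hu t ht), mul_one]
    simp only [Function.comp_apply, h3, neg_apply, adLinear_apply]
    rw [← hB t ht]
    exact neg_add_cancel _
  have hc := constant_of_derivWithin_zero (fun t ht ↦ (hd t ht).differentiableWithinAt)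
    (fun s hs ↦ (hd s (Ico_subset_Icc_self hs)).derivWithin
      (uniqueDiffOn_Icc (hs.1.trans_lt hs.2) s (Ico_subset_Icc_self hs))) t ht
  have h4 : Y t (Ring.inverse (Y t) (adLinear 𝔤 (Y t u) (Y t v))) = ⁅Y t u, Y t v⁆ :=
    congrArg (fun T : 𝔤 →L[ℝ] 𝔤 ↦ T ⁅Y t u, Y t v⁆) (Ring.mul_inverse_cancel (Y t) (hu t ht))
  rw [← h4]
  beta_reduce at hc
  rw [hc, hYa]
  simp

/-- `exp (ad u)` as an automorphism. -/
theorem exists_lieInn_eq_exp (u : 𝔤) :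
    ∃ a ∈ LieInn 𝔤, autCLM a = NormedSpace.exp (adLinear 𝔤 u) := by
  have : CompleteSpace 𝔤 := FiniteDimensional.complete ℝ 𝔤
  -- `exp (t ad u)` solves `Y' = (ad u) Y`, and `ad u` is a derivation, so the time-one value
  -- preserves brackets.
  have hlie := fun x y ↦ map_lie_of_hasDerivWithinAt (B := fun _ ↦ adLinear 𝔤 u)
    (Y := fun t : ℝ ↦ NormedSpace.exp (t • adLinear 𝔤 u)) (a := 0) (b := 1)
    (by simp) (fun _ _ ↦ isLieDer_adLinear u)
    (fun t _ ↦ ⟨⟨_, _, exp_mul_exp_neg (t • adLinear 𝔤 u), exp_neg_mul_exp _⟩, rfl⟩)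
    (fun t _ ↦ (hasDerivAt_exp_smul_const' (𝕂 := ℝ) (adLinear 𝔤 u) t).hasDerivWithinAt)
    (t := 1) (by simp) x y
  simp only [one_smul] at hlie
  exact ⟨⟨⟨_, _, exp_mul_exp_neg (adLinear 𝔤 u), exp_neg_mul_exp _⟩, hlie⟩,
    Subgroup.subset_closure ⟨u, rfl⟩, rfl⟩

/-- For `h = ad u`, `exp h` is an automorphism `a`, and `a⁻¹ (ad w) a = ad (a⁻¹ w)`. This is the
conjugation hypothesis of `exists_transversal_coordinate` for `𝔥 = ad 𝔤`. -/
theorem exp_conj_mem_innerDer :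
    ∀ h ∈ innerDer 𝔤, ∀ k ∈ innerDer 𝔤,
      NormedSpace.exp (-h) * k * NormedSpace.exp h ∈ innerDer 𝔤 := by
  intro h hh k hk
  obtain ⟨u, rfl⟩ := mem_innerDer.1 hh
  obtain ⟨a, -, ha⟩ := exists_lieInn_eq_exp u
  have h1 : autCLM a⁻¹ = NormedSpace.exp (-adLinear 𝔤 u) := by
    have := autCLM_inv_mul a
    rw [ha] at this
    calc autCLM a⁻¹ = autCLM a⁻¹ * (NormedSpace.exp (adLinear 𝔤 u) *
          NormedSpace.exp (-adLinear 𝔤 u)) := by rw [exp_mul_exp_neg, mul_one]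
      _ = _ := by rw [← mul_assoc, this, one_mul]
  rw [← h1, ← ha]
  exact conj_mem_innerDer a hk

/-- A family of automorphisms with logarithmic derivative in `ad 𝔤` stays in one coset of
`Inn 𝔤`. -/
theorem eventually_inv_mul_mem_lieInn {E : Type w} [NormedAddCommGroup E] [NormedSpace ℝ E]
    {α : E → LieAut 𝔤} {y₀ : E}
    (hα : ∀ᶠ y in 𝓝 y₀, ∃ α' : E →L[ℝ] 𝔤 →L[ℝ] 𝔤, HasFDerivAt (fun y ↦ autCLM (α y)) α' y ∧
      ∀ v, ∃ k ∈ innerDer 𝔤, α' v = autCLM (α y) * k) :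
    ∀ᶠ y in 𝓝 y₀, (α y₀)⁻¹ * α y ∈ LieInn 𝔤 := by
  obtain ⟨N, ζ, hN, h1N, hζ1, -, hexp, -, hder⟩ :=
    exists_transversal_coordinate.{w} (innerDer 𝔤) exp_conj_mem_innerDer
  -- Left translation brings the family to `1` at `y₀` without changing its logarithmic derivative.
  let b : E → 𝔤 →L[ℝ] 𝔤 := fun y ↦ autCLM ((α y₀)⁻¹ * α y)
  have hb0 : b y₀ = 1 := by simp [b, autCLM_one]
  obtain ⟨α', hα', -⟩ := hα.self_of_nhds
  have hbc : ContinuousAt b y₀ := continuousAt_const.mul hα'.continuousAt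
  have hbN : ∀ᶠ y in 𝓝 y₀, b y ∈ N := hbc.eventually (by rw [hb0]; exact hN.mem_nhds h1N)
  obtain ⟨r, hr, hball⟩ := Metric.eventually_nhds_iff_ball.1 (hα.and hbN)
  -- On a ball, which is convex, `ζ ∘ b` has derivative zero and so keeps its value `0`. Each `b y`
  -- is then the exponential of an inner derivation.
  have hz : ∀ y ∈ Metric.ball y₀ r, HasFDerivAt (fun y ↦ ζ (b y)) (0 : E →L[ℝ] _) y := by
    intro y hy
    obtain ⟨⟨α', hα', hlog⟩, hyN⟩ := hball y hy
    refine hder b _ y (hα'.const_mul (autCLM (α y₀)⁻¹)) hyN fun v ↦ ?_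
    obtain ⟨k, hk, hv⟩ := hlog v
    refine ⟨k, hk, ?_⟩
    simp only [smul_apply, smul_eq_mul, hv]
    rw [← mul_assoc]
    rfl
  filter_upwards [Metric.ball_mem_nhds y₀ hr] with y hy
  have hconst : ζ (b y) = ζ (b y₀) :=
    (convex_ball y₀ r).is_const_of_fderivWithin_eq_zero (𝕜 := ℝ) (f := fun y ↦ ζ (b y))
      (fun z hz' ↦ (hz z hz').differentiableAt.differentiableWithinAt)
      (fun z hz' ↦ by
        rw [fderivWithin_of_isOpen Metric.isOpen_ball hz']
        exact (hz z hz').fderiv) hy (Metric.mem_ball_self hr)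
  rw [hb0, hζ1] at hconst
  obtain ⟨h, hh, hbh⟩ := hexp _ (hball y hy).2 hconst
  obtain ⟨u, rfl⟩ := mem_innerDer.1 hh
  obtain ⟨a, ha, hae⟩ := exists_lieInn_eq_exp u
  rw [← hae] at hbh
  rw [autCLM_injective hbh]
  exact ha

/-- Products of `k` exponentials of inner derivations. -/
noncomputable def expProd : (k : ℕ) → (Fin k → 𝔤) → 𝔤 →L[ℝ] 𝔤
  | 0, _ => 1
  | k + 1, h => NormedSpace.exp (adLinear 𝔤 (h 0)) * expProd k (fun i ↦ h i.succ)

theorem exists_lieInn_eq_expProd (k : ℕ) (h : Fin k → 𝔤) :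
    ∃ a ∈ LieInn 𝔤, autCLM a = expProd k h := by
  induction k with
  | zero => exact ⟨1, one_mem _, rfl⟩
  | succ k ih =>
    obtain ⟨a, ha, ha'⟩ := ih fun i ↦ h i.succ
    obtain ⟨b, hb, hb'⟩ := exists_lieInn_eq_exp (h 0)
    exact ⟨b * a, mul_mem hb ha, by rw [autCLM_mul, ha', hb', expProd]⟩

/-- Inverses of generators are again generators, `exp (ad u)⁻¹ = exp (ad (-u))`, so words of
exponentials suffice. Hence `Inn(𝔤)` is covered by countably many images of finite-dimensional
spaces. -/
theorem exists_expProd_eq_of_mem_lieInn {a : LieAut 𝔤} (ha : a ∈ LieInn 𝔤) :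
    ∃ (k : ℕ) (h : Fin k → 𝔤), autCLM a = expProd k h := by
  have step (u : 𝔤) (y : LieAut 𝔤) (h : ∃ (k : ℕ) (h : Fin k → 𝔤), autCLM y = expProd k h) :
      ∃ (k : ℕ) (h : Fin k → 𝔤), NormedSpace.exp (adLinear 𝔤 u) * autCLM y = expProd k h := by
    obtain ⟨k, h, hk⟩ := h
    exact ⟨k + 1, Fin.cons u h, by rw [expProd, hk]; simp⟩
  unfold LieInn at ha
  induction ha using Subgroup.closure_induction_left with
  | one => exact ⟨0, Fin.elim0, rfl⟩
  | mul_left x hx y _ ih =>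
    obtain ⟨u, hu⟩ := hx
    rw [autCLM_mul]
    have hxe : autCLM x = NormedSpace.exp (adLinear 𝔤 u) := hu
    rw [hxe]
    exact step u y ih
  | inv_mul_cancel x hx y _ ih =>
    obtain ⟨u, hu⟩ := hx
    have hxe : autCLM x = NormedSpace.exp (adLinear 𝔤 u) := hu
    have hxi : autCLM x⁻¹ = NormedSpace.exp (adLinear 𝔤 (-u)) := by
      have h1 := autCLM_inv_mul x
      rw [hxe] at h1
      rw [map_neg]
      calc autCLM x⁻¹ = autCLM x⁻¹ * (NormedSpace.exp (adLinear 𝔤 u) *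
            NormedSpace.exp (-adLinear 𝔤 u)) := by rw [exp_mul_exp_neg, mul_one]
        _ = _ := by rw [← mul_assoc, h1, one_mul]
    rw [autCLM_mul, hxi]
    exact step (-u) y ih

/-- If `q` has logarithmic derivative `T` and `exp h` has `k₁`, then `exp h * q` has `T + q⁻¹ k₁ q`,
and conjugation by the automorphism `q` preserves `ad 𝔤`. So the transversal coordinate is locally
constant along `expProd k`. -/
theorem hasFDerivAt_expProd (k : ℕ) (h : Fin k → 𝔤) :
    ∃ p' : (Fin k → 𝔤) →L[ℝ] 𝔤 →L[ℝ] 𝔤, HasFDerivAt (expProd k) p' h ∧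
      ∀ v, ∃ T ∈ innerDer 𝔤, p' v = expProd k h * T := by
  induction k with
  | zero => exact ⟨0, hasFDerivAt_const _ _, fun v ↦ ⟨0, zero_mem _, by simp⟩⟩
  | succ k ih =>
    let tailL : (Fin (k + 1) → 𝔤) →L[ℝ] (Fin k → 𝔤) :=
      ContinuousLinearMap.pi fun i ↦ ContinuousLinearMap.proj i.succ
    let headL : (Fin (k + 1) → 𝔤) →L[ℝ] 𝔤 →L[ℝ] 𝔤 :=
      (adLinear 𝔤).comp (ContinuousLinearMap.proj 0)
    obtain ⟨p', hp', hlog⟩ := ih (tailL h)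
    have h1 : HasFDerivAt (fun h : Fin (k + 1) → 𝔤 ↦ NormedSpace.exp (headL h)) _ h :=
      ((contDiff_normedSpace_exp (n := 1)).differentiable one_ne_zero
        (headL h)).hasFDerivAt.comp h headL.hasFDerivAt
    have h2 : HasFDerivAt (fun h : Fin (k + 1) → 𝔤 ↦ expProd k (tailL h)) _ h :=
      hp'.comp h tailL.hasFDerivAt
    refine ⟨_, h1.mul' h2, fun v ↦ ?_⟩
    obtain ⟨T, hT, hTv⟩ := hlog (tailL v)
    have hk1 := exp_neg_mul_fderiv_exp_mem (innerDer 𝔤) exp_conj_mem_innerDer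
      (adLinear_mem (h 0)) (adLinear_mem (v 0))
    set k1 := NormedSpace.exp (-adLinear 𝔤 (h 0)) *
      fderiv ℝ NormedSpace.exp (adLinear 𝔤 (h 0)) (adLinear 𝔤 (v 0)) with hk1d
    have hk1' : fderiv ℝ NormedSpace.exp (headL h) (headL v) =
        NormedSpace.exp (headL h) * k1 := by
      rw [hk1d, ← mul_assoc]
      change _ = NormedSpace.exp (adLinear 𝔤 (h 0)) * _ * _
      rw [exp_mul_exp_neg, one_mul]
      rfl
    obtain ⟨a, -, ha⟩ := exists_lieInn_eq_expProd k (tailL h)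
    refine ⟨T + autCLM a⁻¹ * k1 * autCLM a, add_mem hT (conj_mem_innerDer a hk1), ?_⟩
    have hexp : expProd (k + 1) h = NormedSpace.exp (headL h) * autCLM a := by rw [ha]; rfl
    rw [hexp]
    have : autCLM a * (autCLM a⁻¹ * k1 * autCLM a) = k1 * autCLM a := by
      rw [← mul_assoc, ← mul_assoc, autCLM_mul_inv a, one_mul]
    rw [mul_add, mul_assoc _ (autCLM a) (_ * _), this]
    simp only [add_apply, smul_apply, ContinuousLinearMap.comp_apply, smul_eq_mul, MulOpposite.smul_eq_mul_unop,
      MulOpposite.unop_op, hTv, hk1', ← ha]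
    simp only [mul_assoc]
    rw [ha]
    rfl

/-- A differentiable family of automorphisms in one coset of `Inn 𝔤` has logarithmic derivative in
`ad 𝔤`. As `Inn 𝔤` need not be closed, this uses that it meets only countably many fibres of a
transversal coordinate. -/
theorem fderiv_mem_of_eventually_inv_mul_mem_lieInn {E : Type*} [NormedAddCommGroup E]
    [NormedSpace ℝ E] {α : E → LieAut 𝔤} {y₀ : E} {α' : E →L[ℝ] 𝔤 →L[ℝ] 𝔤}
    (hα' : HasFDerivAt (fun y ↦ autCLM (α y)) α' y₀)
    (hc : ∀ᶠ y in 𝓝 y₀, ContinuousAt (fun y ↦ autCLM (α y)) y)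
    (hα : ∀ᶠ y in 𝓝 y₀, (α y₀)⁻¹ * α y ∈ LieInn 𝔤) (v : E) :
    autCLM (α y₀)⁻¹ * α' v ∈ innerDer 𝔤 := by
  obtain ⟨N, ζ, hN, h1N, hζ1, hζc, -, ⟨ζ', hζ', hker⟩, hder⟩ :=
    exists_transversal_coordinate (innerDer 𝔤) exp_conj_mem_innerDer
  -- For each `k`, `ζ ∘ expProd k` is locally constant on an open subset of a second countable
  -- space, so it takes countably many values there. The union over `k` accounts for all values of
  -- `ζ` on `Inn(𝔤) ∩ N`.
  have hcount : (⋃ k : ℕ, (fun h : Fin k → 𝔤 ↦ ζ (expProd k h)) ''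
      {h | expProd k h ∈ N}).Countable := by
    refine countable_iUnion fun k ↦ ?_
    have hcont : Continuous (expProd (𝔤 := 𝔤) k) := continuous_iff_continuousAt.2 fun h ↦
      (hasFDerivAt_expProd k h).choose_spec.1.continuousAt
    have hO : IsOpen {h : Fin k → 𝔤 | expProd k h ∈ N} := hN.preimage hcont
    have hloc : ∀ h ∈ {h : Fin k → 𝔤 | expProd k h ∈ N}, ∃ U ∈ 𝓝[{h | expProd k h ∈ N}] h,
        ∀ h' ∈ U, ζ (expProd k h') = ζ (expProd k h) := by
      intro h hh
      obtain ⟨r, hr, hball⟩ := Metric.isOpen_iff.1 hO h hh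
      refine ⟨Metric.ball h r, mem_nhdsWithin_of_mem_nhds (Metric.ball_mem_nhds h hr),
        fun h' hh' ↦ ?_⟩
      have hz : ∀ q ∈ Metric.ball h r,
          HasFDerivAt (fun q ↦ ζ (expProd k q)) (0 : (Fin k → 𝔤) →L[ℝ] _) q := by
        intro q hq
        obtain ⟨p', hp', hlog⟩ := hasFDerivAt_expProd k q
        exact hder _ p' q hp' (hball hq) hlog
      exact (convex_ball h r).is_const_of_fderivWithin_eq_zero (𝕜 := ℝ)
        (f := fun q ↦ ζ (expProd k q))
        (fun z hz' ↦ (hz z hz').differentiableAt.differentiableWithinAt)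
        (fun z hz' ↦ by
          rw [fderivWithin_of_isOpen Metric.isOpen_ball hz']
          exact (hz z hz').fderiv) hh' (Metric.mem_ball_self hr)
    choose! U hU hUc using hloc
    have : SecondCountableTopology (Fin k → 𝔤) := inferInstance
    obtain ⟨t, hts, htc, hcov⟩ := TopologicalSpace.countable_cover_nhdsWithin hU
    refine (htc.image fun h ↦ ζ (expProd k h)).mono ?_
    rintro _ ⟨h, hh, rfl⟩
    obtain ⟨q, hq, hhq⟩ := mem_iUnion₂.1 (hcov hh)
    exact ⟨q, hq, (hUc q (hts hq) h hhq).symm⟩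
  let b : E → 𝔤 →L[ℝ] 𝔤 := fun y ↦ autCLM ((α y₀)⁻¹ * α y)
  have hb0 : b y₀ = 1 := by simp [b, autCLM_one]
  have hb' : HasFDerivAt b (autCLM (α y₀)⁻¹ • α') y₀ := hα'.const_mul _
  have hbN : ∀ᶠ y in 𝓝 y₀, b y ∈ N :=
    hb'.continuousAt.eventually (by rw [hb0]; exact hN.mem_nhds h1N)
  obtain ⟨r, hr, hball⟩ := Metric.eventually_nhds_iff_ball.1 ((hc.and hα).and hbN)
  have hbc : ContinuousOn (fun y ↦ ζ (b y)) (Metric.ball y₀ r) := fun y hy ↦ by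
    have h1 : ContinuousAt b y := continuousAt_const.mul (hball y hy).1.1
    exact ((hζc.continuousAt (hN.mem_nhds (hball y hy).2)).comp h1).continuousWithinAt
  -- The image of a ball is connected and lies in a countable set, which is totally disconnected: `ζ
  -- ∘ b` is constant near `y₀`.
  have hsub := hcount.isTotallyDisconnected ((fun y ↦ ζ (b y)) '' Metric.ball y₀ r)
    (by
      rintro _ ⟨y, hy, rfl⟩
      obtain ⟨k, h, hk⟩ := exists_expProd_eq_of_mem_lieInn (hball y hy).1.2
      have hbk : b y = expProd k h := hk
      refine mem_iUnion.2 ⟨k, h, ?_, ?_⟩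
      · change expProd k h ∈ N
        rw [← hbk]
        exact (hball y hy).2
      · beta_reduce
        rw [hbk])
    ((convex_ball y₀ r).isPreconnected.image _ hbc)
  have hzero : (fun y ↦ ζ (b y)) =ᶠ[𝓝 y₀] fun _ ↦ 0 := by
    filter_upwards [Metric.ball_mem_nhds y₀ hr] with y hy
    rw [← hζ1, ← hb0]
    exact hsub ⟨y, hy, rfl⟩ ⟨y₀, Metric.mem_ball_self hr, rfl⟩
  -- The chain rule at `b y₀ = 1` puts the logarithmic derivative into the kernel of `ζ'`, which is
  -- contained in `ad 𝔤`.
  have h1 : HasFDerivAt (fun y ↦ ζ (b y)) (ζ'.comp (autCLM (α y₀)⁻¹ • α')) y₀ := by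
    refine HasFDerivAt.comp y₀ ?_ hb'
    rwa [hb0]
  have h2 := h1.unique ((hasFDerivAt_const (0 : 𝔤 →L[ℝ] 𝔤) y₀).congr_of_eventuallyEq hzero)
  exact hker _ (congrArg (fun T : E →L[ℝ] _ ↦ T v) h2)

end InnerAutomorphisms

/-! ### Smooth dependence on parameters for linear differential equations -/

section ParametricLinearODE

universe v

variable {P : Type} [NormedAddCommGroup P] [NormedSpace ℝ P]

/-- A map `K × P → F` as a map from `P` to `C(K, F)`. -/
def curryIcc {F : Type*} [TopologicalSpace F] (a b : ℝ) (f : ℝ × P → F) (hf : Continuous f) (p : P) :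
    C(Icc a b, F) := ⟨fun t ↦ f (t, p), by fun_prop⟩

theorem continuous_curryIcc {F : Type*} [TopologicalSpace F] (a b : ℝ) (f : ℝ × P → F)
    (hf : Continuous f) : Continuous (curryIcc a b f hf) := by
  refine ContinuousMap.continuous_of_continuous_uncurry _ ?_
  change Continuous fun q : P × Icc a b ↦ f (q.2, q.1)
  fun_prop

/-- Induction on `n`: the derivative of the curried map in a direction `v` is the curried map of the
partial derivative of `f` along `v`, which has one order of differentiability less. -/
theorem contDiff_curryIcc [FiniteDimensional ℝ P] {F : Type v} [NormedAddCommGroup F]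
    [NormedSpace ℝ F] (a b : ℝ) (n : ℕ)
    (f : ℝ × P → F) (hf : ContDiff ℝ n f) : ContDiff ℝ n (curryIcc a b f hf.continuous) := by
  induction n generalizing f with
  | zero => exact contDiff_zero.2 (continuous_curryIcc a b f hf.continuous)
  | succ n ih =>
    rw [Nat.cast_succ] at hf
    let f' : ℝ × P → P →L[ℝ] F := fun q ↦ (fderiv ℝ f q).comp (ContinuousLinearMap.inr ℝ ℝ P)
    have hf' : ContDiff ℝ n f' :=
      (hf.fderiv_right (m := n) le_rfl).clm_comp contDiff_const
    have hdv (v : P) : ContDiff ℝ n fun q ↦ f' q v := hf'.clm_apply contDiff_const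
    have hfd : ∀ (t : ℝ) (p : P), HasFDerivAt (fun p ↦ f (t, p)) (f' (t, p)) p := fun t p ↦
      ((hf.differentiable (by simp)) (t, p)).hasFDerivAt.comp p (hasFDerivAt_prodMk_right t p)
    let D : P → P →L[ℝ] C(Icc a b, F) := fun p ↦ LinearMap.toContinuousLinearMap
      { toFun := fun v ↦ curryIcc a b _ (hdv v).continuous p
        map_add' := fun v w ↦ by ext t; exact map_add (f' (t, p)) v w
        map_smul' := fun c v ↦ by ext t; exact map_smul (f' (t, p)) c v }
    have hD : ∀ p, HasFDerivAt (curryIcc a b f hf.continuous) (D p) p := by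
      intro p
      rw [hasFDerivAt_iff_isLittleO, Asymptotics.isLittleO_iff]
      intro ε hε
      -- Compactness of the interval makes the continuity of the partial derivative uniform in `t`,
      -- as differentiability in the sup norm requires.
      have hev : ∀ᶠ q in 𝓝 p, ∀ t ∈ Icc a b, ‖f' (t, q) - f' (t, p)‖ < ε := by
        refine isCompact_Icc.eventually_forall_of_forall_eventually fun t _ ↦ ?_
        have hc : Continuous fun z : P × ℝ ↦ ‖f' (z.2, z.1) - f' (z.2, p)‖ := by
          have := hf'.continuous
          fun_prop
        have := hc.tendsto (p, t)
        simp only [sub_self, norm_zero] at this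
        exact this.eventually_lt_const hε
      obtain ⟨r, hr, hball⟩ := Metric.eventually_nhds_iff_ball.1 hev
      filter_upwards [Metric.ball_mem_nhds p hr] with q hq
      rw [ContinuousMap.norm_le _ (by positivity)]
      intro t
      exact (convex_ball p r).norm_image_sub_le_of_norm_hasFDerivWithin_le'
        (f := fun p ↦ f (t, p)) (f' := fun p ↦ f' (t, p))
        (fun x _ ↦ (hfd t x).hasFDerivWithinAt) (fun x hx ↦ (hball x hx t t.2).le)
        (Metric.mem_ball_self hr) hq
    have hcast : ∀ g : P → C(Icc a b, F), ContDiff ℝ (n + 1) g → ContDiff ℝ (n + 1 : ℕ) g :=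
      fun g hg ↦ by rwa [Nat.cast_succ]
    refine hcast _ (contDiff_succ_iff_fderiv_apply.2
      ⟨fun p ↦ (hD p).differentiableAt, by simp, fun v ↦ ?_⟩)
    have hfv : (fun p ↦ fderiv ℝ (curryIcc a b f hf.continuous) p v) =
        curryIcc a b _ (hdv v).continuous := funext fun p ↦ by rw [(hD p).fderiv]; rfl
    rw [hfv]
    exact ih _ (hdv v)

/-- Smooth dependence of the solution of `y = x + T (B p) y` on `p`. -/
theorem exists_contDiffAt_fixed_point {X Z : Type*} [NormedAddCommGroup X] [NormedSpace ℝ X]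
    [CompleteSpace X] [NormedAddCommGroup Z] [NormedSpace ℝ Z] (T : X →L[ℝ] X →L[ℝ] X) (S : X →L[ℝ] Z)
    {B : P → X} (hB : ContDiff ℝ ∞ B) {W : Set P} (hW : ∀ p ∈ W, ‖T (B p)‖ < 1) (x : X) :
    ∃ Y : P → X, (∀ p ∈ W, Y p = x + T (B p) (Y p)) ∧
      ∀ p ∈ W, ContDiffAt ℝ ∞ (fun p ↦ S (Y p)) p := by
  have hu : ∀ p ∈ W, IsUnit (1 - T (B p)) := fun p hp ↦ (Units.oneSub _ (hW p hp)).isUnit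
  -- The solution is `(1 - T (B p))⁻¹ x`, and inversion is smooth at units. Smoothness in `p` thus
  -- comes from `B` alone.
  refine ⟨fun p ↦ Ring.inverse (1 - T (B p)) x, fun p hp ↦ ?_, fun p hp ↦ ?_⟩
  · have h1 : (1 - T (B p)) (Ring.inverse (1 - T (B p)) x) = x :=
      congrArg (fun R : X →L[ℝ] X ↦ R x) (Ring.mul_inverse_cancel _ (hu p hp))
    have h2 : Ring.inverse (1 - T (B p)) x - T (B p) (Ring.inverse (1 - T (B p)) x) = x := h1
    exact sub_eq_iff_eq_add.1 h2
  · obtain ⟨y, hy⟩ := hu p hp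
    have h1 : ContDiffAt ℝ ∞ (fun p ↦ Ring.inverse (1 - T (B p))) p := by
      refine ContDiffAt.comp p (g := Ring.inverse) ?_
        (contDiffAt_const.sub (T.contDiff.contDiffAt.comp p hB.contDiffAt))
      rw [← hy]
      exact contDiffAt_ringInverse ℝ y
    exact S.contDiff.contDiffAt.comp p (h1.clm_apply contDiffAt_const)

variable {V : Type v} [NormedRing V] [NormedAlgebra ℝ V] [CompleteSpace V]

/-- The primitive of a continuous function on an interval, as a linear map. -/
noncomputable def primitiveIccₗ {a b : ℝ} (hab : a ≤ b) : C(Icc a b, V) →ₗ[ℝ] C(Icc a b, V) where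
  toFun g := ⟨fun t ↦ ∫ s in a..t, IccExtend hab g s,
    (intervalIntegral.continuous_primitive (fun _ _ ↦
      (g.continuous.Icc_extend').intervalIntegrable _ _) a).comp continuous_subtype_val⟩
  map_add' g h := by
    ext t
    exact intervalIntegral.integral_add ((g.continuous.Icc_extend').intervalIntegrable _ _)
      ((h.continuous.Icc_extend').intervalIntegrable _ _)
  map_smul' c g := by
    ext t
    exact intervalIntegral.integral_smul c _

theorem primitiveIcc_bound {a b : ℝ} (hab : a ≤ b) (g : C(Icc a b, V)) :
    ‖primitiveIccₗ hab g‖ ≤ (b - a) * ‖g‖ := by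
  rw [ContinuousMap.norm_le _ (mul_nonneg (sub_nonneg.2 hab) (norm_nonneg _))]
  intro t
  refine (intervalIntegral.norm_integral_le_of_norm_le_const (C := ‖g‖) fun s _ ↦
    g.norm_coe_le_norm _).trans ?_
  rw [mul_comm, abs_of_nonneg (sub_nonneg.2 t.2.1)]
  exact mul_le_mul_of_nonneg_right (sub_le_sub_right t.2.2 a) (norm_nonneg _)

/-- The primitive of a continuous function on an interval. -/
noncomputable def primitiveIcc {a b : ℝ} (hab : a ≤ b) : C(Icc a b, V) →L[ℝ] C(Icc a b, V) :=
  LinearMap.mkContinuous (primitiveIccₗ hab) (b - a) (primitiveIcc_bound hab)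

theorem norm_primitiveIcc_le {a b : ℝ} (hab : a ≤ b) (g : C(Icc a b, V)) :
    ‖primitiveIcc hab g‖ ≤ (b - a) * ‖g‖ :=
  (primitiveIcc hab).le_of_opNorm_le
    (LinearMap.mkContinuous_norm_le _ (sub_nonneg.2 hab) (primitiveIcc_bound hab)) g

/-- Left multiplication by a function, followed by the primitive. -/
noncomputable def volterra {a b : ℝ} (hab : a ≤ b) :
    C(Icc a b, V) →L[ℝ] C(Icc a b, V) →L[ℝ] C(Icc a b, V) :=
  (ContinuousLinearMap.compL ℝ _ _ _ (primitiveIcc hab)).comp (ContinuousLinearMap.mul ℝ _)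

theorem volterra_apply {a b : ℝ} (hab : a ≤ b) (B Y : C(Icc a b, V)) :
    volterra hab B Y = primitiveIcc hab (B * Y) := rfl

theorem norm_volterra_le {a b : ℝ} (hab : a ≤ b) (B : C(Icc a b, V)) :
    ‖volterra hab B‖ ≤ (b - a) * ‖B‖ := by
  refine ContinuousLinearMap.opNorm_le_bound _
    (mul_nonneg (sub_nonneg.2 hab) (norm_nonneg _)) fun Y ↦ ?_
  rw [volterra_apply, mul_assoc]
  exact (norm_primitiveIcc_le hab _).trans
    (mul_le_mul_of_nonneg_left (norm_mul_le _ _) (sub_nonneg.2 hab))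

/-- Smooth dependence on parameters of the fundamental solution of a linear differential equation on
a short interval. -/
theorem exists_contDiffOn_fundamental_solution [FiniteDimensional ℝ P] {B : ℝ × P → V} (hB : ContDiff ℝ ∞ B) {a b : ℝ}
    (hab : a ≤ b) {W : Set P} {C : ℝ} (hC : ∀ t ∈ Icc a b, ∀ p ∈ W, ‖B (t, p)‖ ≤ C)
    (hC0 : 0 ≤ C) (hsmall : (b - a) * C ≤ 1 / 3) :
    ∃ Y : P → ℝ → V, (∀ p ∈ W, Y p a = 1) ∧ (∀ p ∈ W, ∀ t ∈ Icc a b, IsUnit (Y p t)) ∧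
      (∀ p ∈ W, ∀ t ∈ Icc a b, HasDerivWithinAt (Y p) (B (t, p) * Y p t) (Icc a b) t) ∧
      ContDiffOn ℝ ∞ (fun p ↦ Y p b) W := by
  -- `Y' = B Y`, `Y a = 1` is the fixed point equation `Y = 1 + ∫ B Y` in the Banach space of
  -- continuous functions on `[a, b]`.
  let Bc : P → C(Icc a b, V) := curryIcc a b B hB.continuous
  have hBc : ContDiff ℝ ∞ Bc := contDiff_infty.2 fun n ↦
    contDiff_curryIcc a b n B (hB.of_le (by exact_mod_cast le_top))
  have hBn : ∀ p ∈ W, ‖Bc p‖ ≤ C := fun p hp ↦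
    (ContinuousMap.norm_le _ hC0).2 fun t ↦ hC t t.2 p hp
  have hBs : ∀ p ∈ W, (b - a) * ‖Bc p‖ ≤ 1 / 3 := fun p hp ↦
    (mul_le_mul_of_nonneg_left (hBn p hp) (sub_nonneg.2 hab)).trans hsmall
  have hK : ∀ p ∈ W, ‖volterra hab (Bc p)‖ ≤ 1 / 3 := fun p hp ↦
    (norm_volterra_le hab _).trans (hBs p hp)
  have hfix := exists_contDiffAt_fixed_point (P := P) (X := C(Icc a b, V)) (Z := V)
  obtain ⟨Y, hYv, hYs⟩ := hfix (volterra hab)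
    (ContinuousMap.evalCLM ℝ ⟨b, right_mem_Icc.2 hab⟩) (B := Bc) hBc (W := W)
    (fun p hp ↦ (hK p hp).trans_lt (by norm_num)) 1
  have hYeq : ∀ p ∈ W, Y p = 1 + primitiveIcc hab (Bc p * Y p) := hYv
  -- The bound `1/3` gives `‖Y - 1‖ ≤ 1/3 + ‖Y - 1‖ / 3`, hence `‖Y - 1‖ ≤ 1/2`, and all values of
  -- `Y` are invertible.
  have hYone : ∀ p ∈ W, ‖Y p - 1‖ < 1 := fun p hp ↦ by
    have h1 : Y p - 1 = primitiveIcc hab (Bc p) + volterra hab (Bc p) (Y p - 1) := by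
      conv_lhs => rw [hYeq p hp]
      rw [map_sub, volterra_apply, volterra_apply, mul_one]
      abel
    have h2 : ‖Y p - 1‖ ≤ 1 / 3 + 1 / 3 * ‖Y p - 1‖ := by
      conv_lhs => rw [h1]
      exact (norm_add_le _ _).trans (add_le_add ((norm_primitiveIcc_le hab _).trans (hBs p hp))
        ((volterra hab (Bc p)).le_of_opNorm_le (hK p hp) _))
    linarith
  have hYext : ∀ p ∈ W, ∀ t ∈ Icc a b, IccExtend hab (Y p) t =
      1 + ∫ s in a..t, IccExtend hab (Bc p * Y p) s := fun p hp t ht ↦ by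
    rw [IccExtend_of_mem hab _ ht]
    have := congrArg (fun g : C(Icc a b, V) ↦ g ⟨t, ht⟩) (hYeq p hp)
    exact this
  refine ⟨fun p ↦ IccExtend hab (Y p), fun p hp ↦ ?_, fun p hp t ht ↦ ?_, fun p hp t ht ↦ ?_,
    fun p hp ↦ ?_⟩
  · beta_reduce
    rw [hYext p hp a (left_mem_Icc.2 hab)]
    simp
  · beta_reduce
    rw [IccExtend_of_mem hab _ ht]
    have h1 : ‖(1 : V) - Y p ⟨t, ht⟩‖ < 1 := by
      rw [norm_sub_rev]
      exact ((Y p - 1).norm_coe_le_norm ⟨t, ht⟩).trans_lt (hYone p hp)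
    have := (Units.oneSub _ h1).isUnit
    simpa using this
  · have h1 : HasDerivAt (fun t ↦ 1 + ∫ s in a..t, IccExtend hab (Bc p * Y p) s)
        (IccExtend hab (Bc p * Y p) t) t :=
      (((Bc p * Y p).continuous.Icc_extend').integral_hasStrictDerivAt a t).hasDerivAt.const_add 1
    have h2 : IccExtend hab (Bc p * Y p) t = B (t, p) * IccExtend hab (Y p) t := by
      rw [IccExtend_of_mem hab _ ht, IccExtend_of_mem hab _ ht]
      rfl
    rw [← h2]
    exact h1.hasDerivWithinAt.congr (hYext p hp) (hYext p hp t ht)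
  · refine ((hYs p hp).congr_of_eventuallyEq
      (Filter.Eventually.of_forall fun q ↦ ?_)).contDiffWithinAt
    exact IccExtend_right hab _

end ParametricLinearODE

/-! ### Smoothness of operator-valued maps -/

section OperatorValued

variable {E' : Type*} [NormedAddCommGroup E'] [NormedSpace ℝ E'] {H' : Type*} [TopologicalSpace H']
  {I : ModelWithCorners ℝ E' H'} {N : Type*} [TopologicalSpace N] [ChartedSpace H' N]
  {V : Type*} [NormedAddCommGroup V] [NormedSpace ℝ V] [FiniteDimensional ℝ V]
  {G : Type*} [NormedAddCommGroup G] [NormedSpace ℝ G] {k : ℕ∞ω}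

/-- An operator is the sum of its values on a basis. -/
theorem ContinuousLinearMap.eq_sum_smulRight (T : V →L[ℝ] G) :
    T = ∑ i, (LinearMap.toContinuousLinearMap ((Module.finBasis ℝ V).coord i)).smulRight
      (T (Module.finBasis ℝ V i)) := by
  ext v
  conv_lhs => rw [← (Module.finBasis ℝ V).sum_repr v, map_sum]
  simp

theorem contMDiffAt_clm_of_apply {F : N → V →L[ℝ] G} {x : N}
    (h : ∀ v, ContMDiffAt I 𝓘(ℝ, G) k (fun y ↦ F y v) x) :
    ContMDiffAt I 𝓘(ℝ, V →L[ℝ] G) k F x := by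
  have : F = fun y ↦ ∑ i, ContinuousLinearMap.smulRightL ℝ V G
      (LinearMap.toContinuousLinearMap ((Module.finBasis ℝ V).coord i))
      (F y (Module.finBasis ℝ V i)) := by
    funext y
    exact (F y).eq_sum_smulRight
  rw [this]
  refine contMDiffAt_finsetSum fun i _ ↦ ?_
  exact (ContinuousLinearMap.contMDiff _).contMDiffAt.comp x (h _)

theorem contMDiffAt_ringInverse {F : N → V →L[ℝ] V} {x : N}
    (h : ContMDiffAt I 𝓘(ℝ, V →L[ℝ] V) k F x) (hx : IsUnit (F x)) :
    ContMDiffAt I 𝓘(ℝ, V →L[ℝ] V) k (fun y ↦ Ring.inverse (F y)) x := by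
  have : CompleteSpace V := FiniteDimensional.complete ℝ V
  obtain ⟨a, ha⟩ := hx
  have h1 : ContDiffAt ℝ k (Ring.inverse : (V →L[ℝ] V) → V →L[ℝ] V) (F x) := by
    rw [← ha]
    exact contDiffAt_ringInverse ℝ a
  exact h1.contMDiffAt.comp x h

end OperatorValued

/-! ### Coordinates of sections in a Lie trivialization -/

section Frames

variable {n : ℕ} {M : Type u} [TopologicalSpace M] [ChartedSpace (EuclideanSpace ℝ (Fin n)) M]
  [IsManifold (𝓡 n) ∞ M]
  {𝔤 : Type*} [NormedAddCommGroup 𝔤] [NormedSpace ℝ 𝔤] [FiniteDimensional ℝ 𝔤]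
  [RealLieAlgebra 𝔤]
  {L : M → Type*} [∀ x, LieRing (L x)] [∀ x, LieAlgebra ℝ (L x)]
  [∀ x, TopologicalSpace (L x)] [∀ x, IsTopologicalAddGroup (L x)]
  [∀ x, ContinuousSMul ℝ (L x)]
  [TopologicalSpace (TotalSpace 𝔤 L)] [FiberBundle 𝔤 L] [VectorBundle ℝ 𝔤 L]
  [ContMDiffVectorBundle ∞ 𝔤 L (𝓡 n)]

namespace LieTrivialization

variable (φ : LieTrivialization (n := n) 𝔤 L)

/-- The operator that compares a Lie trivialization with the bundle trivialization at `x₀`. -/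
noncomputable def comparison (x₀ y : M) : 𝔤 →L[ℝ] 𝔤 :=
  LinearMap.toContinuousLinearMap
    ((trivializationAt 𝔤 L x₀).linearMapAt ℝ y ∘ₗ (φ.toEquiv y).toLinearEquiv.toLinearMap)

theorem comparison_apply {x₀ y : M} (hy : y ∈ (trivializationAt 𝔤 L x₀).baseSet) (v : 𝔤) :
    φ.comparison x₀ y v = (trivializationAt 𝔤 L x₀ ⟨y, φ.toEquiv y v⟩).2 := by
  change (trivializationAt 𝔤 L x₀).linearMapAt ℝ y (φ.toEquiv y v) = _
  rw [Bundle.Trivialization.linearMapAt_apply, if_pos hy]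

theorem contMDiffAt_comparison {x : M} (hx : x ∈ φ.base) :
    ContMDiffAt (𝓡 n) 𝓘(ℝ, 𝔤 →L[ℝ] 𝔤) ∞ (φ.comparison x) x := by
  refine contMDiffAt_clm_of_apply fun v ↦ ?_
  have h := (φ.smooth v).contMDiffAt (φ.isOpen_base.mem_nhds hx)
  rw [Bundle.contMDiffAt_section] at h
  refine h.congr_of_eventuallyEq ?_
  filter_upwards [(trivializationAt 𝔤 L x).open_baseSet.mem_nhds
    (mem_baseSet_trivializationAt 𝔤 L x)] with y hy
  exact φ.comparison_apply hy v

theorem isUnit_comparison {x₀ y : M} (hy : y ∈ (trivializationAt 𝔤 L x₀).baseSet) :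
    IsUnit (φ.comparison x₀ y) := by
  let E : 𝔤 ≃ₗ[ℝ] 𝔤 := (φ.toEquiv y).toLinearEquiv.trans
    ((trivializationAt 𝔤 L x₀).linearEquivAt ℝ y hy)
  refine ⟨ContinuousLinearEquiv.toUnit E.toContinuousLinearEquiv, ?_⟩
  ext v
  rw [φ.comparison_apply hy]
  rfl

theorem ringInverse_comparison {x₀ y : M} (hy : y ∈ (trivializationAt 𝔤 L x₀).baseSet) (w : L y) :
    Ring.inverse (φ.comparison x₀ y) ((trivializationAt 𝔤 L x₀ ⟨y, w⟩).2) =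
      (φ.toEquiv y).symm w := by
  have h1 := φ.comparison_apply hy ((φ.toEquiv y).symm w)
  rw [LieEquiv.apply_symm_apply] at h1
  rw [← h1, ← mul_apply_eq_comp, Ring.inverse_mul_cancel _ (φ.isUnit_comparison hy)]
  rfl

/-- The bundle coordinate of a section is `comparison` applied to its `φ`-coordinate, and
`comparison` is a smooth family of operators with smooth inverse near `x`. -/
theorem contMDiffAt_section_iff {x : M} (hx : x ∈ φ.base) {u : ∀ y, L y} :
    ContMDiffAt (𝓡 n) ((𝓡 n).prod 𝓘(ℝ, 𝔤)) ∞ (fun y ↦ TotalSpace.mk' 𝔤 y (u y)) x ↔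
      ContMDiffAt (𝓡 n) 𝓘(ℝ, 𝔤) ∞ (fun y ↦ (φ.toEquiv y).symm (u y)) x := by
  have hb := (trivializationAt 𝔤 L x).open_baseSet.mem_nhds (mem_baseSet_trivializationAt 𝔤 L x)
  have hT := φ.contMDiffAt_comparison hx
  rw [Bundle.contMDiffAt_section]
  constructor
  · intro h
    refine ((contMDiffAt_ringInverse hT
      (φ.isUnit_comparison (mem_baseSet_trivializationAt 𝔤 L x))).clm_apply
      h).congr_of_eventuallyEq ?_
    filter_upwards [hb] with y hy
    exact (φ.ringInverse_comparison hy _).symm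
  · intro h
    refine (hT.clm_apply h).congr_of_eventuallyEq ?_
    filter_upwards [hb] with y hy
    rw [φ.comparison_apply hy, LieEquiv.apply_symm_apply]

theorem mdifferentiableAt_section_iff {x : M} (hx : x ∈ φ.base) {u : ∀ y, L y} :
    MDifferentiableAt (𝓡 n) ((𝓡 n).prod 𝓘(ℝ, 𝔤)) (fun y ↦ TotalSpace.mk' 𝔤 y (u y)) x ↔
      MDifferentiableAt (𝓡 n) 𝓘(ℝ, 𝔤) (fun y ↦ (φ.toEquiv y).symm (u y)) x := by
  have hb := (trivializationAt 𝔤 L x).open_baseSet.mem_nhds (mem_baseSet_trivializationAt 𝔤 L x)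
  have hT := φ.contMDiffAt_comparison hx
  rw [mdifferentiableAt_section]
  constructor
  · intro h
    refine (((contMDiffAt_ringInverse hT
      (φ.isUnit_comparison (mem_baseSet_trivializationAt 𝔤 L x))).mdifferentiableAt
      (by simp)).clm_apply h).congr_of_eventuallyEq ?_
    filter_upwards [hb] with y hy
    exact (φ.ringInverse_comparison hy _).symm
  · intro h
    refine ((hT.mdifferentiableAt (by simp)).clm_apply h).congr_of_eventuallyEq ?_
    filter_upwards [hb] with y hy
    rw [φ.comparison_apply hy, LieEquiv.apply_symm_apply]

/-- The section with constant coordinate `v`. -/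
def sec (v : 𝔤) (y : M) : L y := φ.toEquiv y v

theorem contMDiffAt_sec (v : 𝔤) {x : M} (hx : x ∈ φ.base) :
    ContMDiffAt (𝓡 n) ((𝓡 n).prod 𝓘(ℝ, 𝔤)) ∞ (fun y ↦ TotalSpace.mk' 𝔤 y (φ.sec v y)) x :=
  (φ.smooth v).contMDiffAt (φ.isOpen_base.mem_nhds hx)

/-- The operator of the transition function between two trivializations. -/
noncomputable def transCLM (φ φ' : LieTrivialization (n := n) 𝔤 L) (y : M) : 𝔤 →L[ℝ] 𝔤 :=
  autCLM (φ.transition φ' y)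

theorem transCLM_apply (φ φ' : LieTrivialization (n := n) 𝔤 L) (y : M) (v : 𝔤) :
    φ.transCLM φ' y v = (φ'.toEquiv y).symm (φ.toEquiv y v) := rfl

theorem contMDiffAt_transCLM (φ φ' : LieTrivialization (n := n) 𝔤 L) {x : M} (hx : x ∈ φ.base)
    (hx' : x ∈ φ'.base) :
    ContMDiffAt (𝓡 n) 𝓘(ℝ, 𝔤 →L[ℝ] 𝔤) ∞ (φ.transCLM φ') x :=
  contMDiffAt_clm_of_apply fun v ↦ (φ'.contMDiffAt_section_iff hx').1 (φ.contMDiffAt_sec v hx)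

end LieTrivialization

end Frames

/-! ### Extension of local sections by bump functions -/

section Extension

variable {n : ℕ} {M : Type u} [TopologicalSpace M] [T2Space M]
  [ChartedSpace (EuclideanSpace ℝ (Fin n)) M] [IsManifold (𝓡 n) ∞ M]
  {F : Type*} [NormedAddCommGroup F] [NormedSpace ℝ F]
  {V : M → Type*} [∀ x, AddCommGroup (V x)] [∀ x, Module ℝ (V x)] [∀ x, TopologicalSpace (V x)]
  [TopologicalSpace (TotalSpace F V)] [FiberBundle F V] [VectorBundle ℝ F V]

/-- A smooth local section agrees near a point with a smooth global section. -/
theorem exists_contMDiff_section_eventuallyEq {s : ∀ x, V x} {U : Set M} (hU : IsOpen U)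
    (hs : ContMDiffOn (𝓡 n) ((𝓡 n).prod 𝓘(ℝ, F)) ∞ (fun x ↦ TotalSpace.mk' F x (s x)) U) {x : M}
    (hx : x ∈ U) :
    ∃ s' : ∀ x, V x,
      ContMDiff (𝓡 n) ((𝓡 n).prod 𝓘(ℝ, F)) ∞ (fun x ↦ TotalSpace.mk' F x (s' x)) ∧
      ∀ᶠ y in 𝓝 x, s' y = s y := by
  obtain ⟨f, -, hf⟩ := (SmoothBumpFunction.nhds_basis_tsupport (I := 𝓡 n) x).mem_iff.1
    (hU.mem_nhds hx)
  refine ⟨(f : M → ℝ) • s, ContMDiffOn.smul_section_of_tsupport f.contMDiff.contMDiffOn hU hf hs,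
    ?_⟩
  filter_upwards [f.eventuallyEq_one] with y hy
  simp [hy]

end Extension

/-! ### The connection form in a Lie trivialization -/

section ConnectionForm

variable {n : ℕ} {M : Type u} [TopologicalSpace M] [ChartedSpace (EuclideanSpace ℝ (Fin n)) M]
  [IsManifold (𝓡 n) ∞ M]
  {𝔤 : Type*} [NormedAddCommGroup 𝔤] [NormedSpace ℝ 𝔤] [FiniteDimensional ℝ 𝔤]
  [RealLieAlgebra 𝔤]
  {L : M → Type*} [∀ x, LieRing (L x)] [∀ x, LieAlgebra ℝ (L x)]
  [∀ x, TopologicalSpace (L x)] [∀ x, IsTopologicalAddGroup (L x)]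
  [∀ x, ContinuousSMul ℝ (L x)]
  [TopologicalSpace (TotalSpace 𝔤 L)] [FiberBundle 𝔤 L] [VectorBundle ℝ 𝔤 L]
  [ContMDiffVectorBundle ∞ 𝔤 L (𝓡 n)]

namespace LieConnection

variable (D : LieConnection n 𝔤 L)

theorem toFun_congr {u u' : ∀ x, L x} {x : M}
    (hu : MDifferentiableAt (𝓡 n) ((𝓡 n).prod 𝓘(ℝ, 𝔤)) (fun y ↦ TotalSpace.mk' 𝔤 y (u y)) x)
    (hu' : MDifferentiableAt (𝓡 n) ((𝓡 n).prod 𝓘(ℝ, 𝔤)) (fun y ↦ TotalSpace.mk' 𝔤 y (u' y)) x)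
    (h : ∀ᶠ y in 𝓝 x, u y = u' y) : D.toFun u x = D.toFun u' x :=
  D.isCovariantDerivativeOnUniv.congr_of_eventuallyEq hu hu' Filter.univ_mem h

theorem toFun_sum {ι : Type*} (t : Finset ι) {u : ι → ∀ x, L x} {x : M}
    (hu : ∀ i ∈ t, MDifferentiableAt (𝓡 n) ((𝓡 n).prod 𝓘(ℝ, 𝔤))
      (fun y ↦ TotalSpace.mk' 𝔤 y (u i y)) x) :
    MDifferentiableAt (𝓡 n) ((𝓡 n).prod 𝓘(ℝ, 𝔤))
      (fun y ↦ TotalSpace.mk' 𝔤 y ((∑ i ∈ t, u i) y)) x ∧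
    D.toFun (∑ i ∈ t, u i) x = ∑ i ∈ t, D.toFun (u i) x := by
  classical
  induction t using Finset.induction_on with
  | empty =>
    simp only [Finset.sum_empty]
    exact ⟨Bundle.mdifferentiableAt_zeroSection _ _, D.isCovariantDerivativeOnUniv.zero⟩
  | insert i t hi ih =>
    obtain ⟨h1, h2⟩ := ih fun j hj ↦ hu j (Finset.mem_insert_of_mem hj)
    have h3 := hu i (Finset.mem_insert_self _ _)
    rw [Finset.sum_insert hi, Finset.sum_insert hi, ← h2]
    exact ⟨mdifferentiableAt_add_section h3 h1, D.isCovariantDerivativeOnUniv.add h3 h1⟩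

/-- The connection form in a trivialization: `ω(X) v = φ⁻¹ (∇_X (φ v))`. -/
noncomputable def connForm (φ : LieTrivialization (n := n) 𝔤 L) (x : M) :
    TangentSpace (𝓡 n) x →ₗ[ℝ] 𝔤 →L[ℝ] 𝔤 where
  -- Outside `φ.base` the sections `φ.sec v` need not be differentiable, and `φ⁻¹ (∇_X (φ v))` need
  -- not be linear in `v`. Linear extension from a basis gives an operator at every point; on
  -- `φ.base`, `connForm_eq` recovers the formula for every `v`.
  toFun X := ∑ i, (LinearMap.toContinuousLinearMap ((Module.finBasis ℝ 𝔤).coord i)).smulRight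
    ((φ.toEquiv x).symm (D.toFun (φ.sec (Module.finBasis ℝ 𝔤 i)) x X))
  map_add' X Y := by
    rw [← Finset.sum_add_distrib]
    refine Finset.sum_congr rfl fun i _ ↦ ?_
    ext v
    simp
  map_smul' c X := by
    rw [Finset.smul_sum]
    refine Finset.sum_congr rfl fun i _ ↦ ?_
    ext v
    rw [map_smul, ← LieEquiv.coe_toLinearEquiv, map_smul]
    exact smul_comm _ _ _

variable (φ : LieTrivialization (n := n) 𝔤 L)

theorem connForm_apply (x : M) (X : TangentSpace (𝓡 n) x) (v : 𝔤) :
    D.connForm φ x X v = ∑ i, (Module.finBasis ℝ 𝔤).repr v i •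
      (φ.toEquiv x).symm (D.toFun (φ.sec (Module.finBasis ℝ 𝔤 i)) x X) := by
  simp [connForm]

/-- The covariant derivative in a trivialization: `φ⁻¹ (∇_X u) = ∂_X (φ⁻¹ u) + ω(X) (φ⁻¹ u)`. -/
theorem symm_toFun {x : M} (hx : x ∈ φ.base) {u : ∀ x, L x}
    (hu : MDifferentiableAt (𝓡 n) ((𝓡 n).prod 𝓘(ℝ, 𝔤)) (fun y ↦ TotalSpace.mk' 𝔤 y (u y)) x)
    (X : TangentSpace (𝓡 n) x) :
    (φ.toEquiv x).symm (D.toFun u x X) =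
      mvfderiv (𝓡 n) (fun y ↦ (φ.toEquiv y).symm (u y)) x X +
        D.connForm φ x X ((φ.toEquiv x).symm (u x)) := by
  set b := Module.finBasis ℝ 𝔤 with hb
  set c : M → 𝔤 := fun y ↦ (φ.toEquiv y).symm (u y) with hc
  have hcd : MDifferentiableAt (𝓡 n) 𝓘(ℝ, 𝔤) c x := (φ.mdifferentiableAt_section_iff hx).1 hu
  let ci (i : Fin (Module.finrank ℝ 𝔤)) : 𝔤 →L[ℝ] ℝ := LinearMap.toContinuousLinearMap (b.coord i)
  have hci (i) : HasMFDerivAt (𝓡 n) 𝓘(ℝ, ℝ) (fun y ↦ ci i (c y)) x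
      ((ci i).comp (mfderiv (𝓡 n) 𝓘(ℝ, 𝔤) c x)) :=
    (ci i).hasMFDerivAt.comp x hcd.hasMFDerivAt
  have hsec (v : 𝔤) := (φ.contMDiffAt_sec v hx).mdifferentiableAt (by simp)
  -- The section is expanded in the frame `φ(b i)`, so that the Leibniz rule separates the
  -- derivative of the coefficients from that of the frame.
  have hu_eq : u = ∑ i, (fun y ↦ ci i (c y)) • φ.sec (b i) := by
    funext y
    rw [Finset.sum_apply]
    have h1 : c y = ∑ i, ci i (c y) • b i := (b.sum_repr (c y)).symm
    have h2 := congrArg (φ.toEquiv y) h1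
    rw [hc, LieEquiv.apply_symm_apply] at h2
    rw [h2]
    simp only [← LieEquiv.coe_toLinearEquiv, map_sum, map_smul]
    rfl
  have hterm (i) : D.toFun ((fun y ↦ ci i (c y)) • φ.sec (b i)) x =
      ci i (c x) • D.toFun (φ.sec (b i)) x +
        (mvfderiv (𝓡 n) (fun y ↦ ci i (c y)) x).smulRight (φ.sec (b i) x) :=
    D.isCovariantDerivativeOnUniv.leibniz (hsec _) (hci i).mdifferentiableAt
  have hD := (D.toFun_sum Finset.univ (u := fun i ↦ (fun y ↦ ci i (c y)) • φ.sec (b i)) (x := x)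
    fun i _ ↦ MDifferentiableAt.smul_section (hci i).mdifferentiableAt (hsec _)).2
  rw [← hu_eq] at hD
  rw [hD, sum_apply, connForm_apply, ← hb]
  have h1 : mvfderiv (𝓡 n) c x X = ∑ i, ci i (mvfderiv (𝓡 n) c x X) • b i :=
    (b.sum_repr _).symm
  rw [h1, ← Finset.sum_add_distrib]
  simp only [← LieEquiv.coe_toLinearEquiv, map_sum]
  refine Finset.sum_congr rfl fun i _ ↦ ?_
  have h2 : mvfderiv (𝓡 n) (fun y ↦ ci i (c y)) x X = ci i (mvfderiv (𝓡 n) c x X) := by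
    rw [mvfderiv, (hci i).mfderiv]
    rfl
  rw [hterm, add_apply, map_add, smul_apply, map_smul, ContinuousLinearMap.smulRight_apply, h2,
    map_smul, add_comm]
  congr 2
  exact (φ.toEquiv x).symm_apply_apply (b i)

theorem connForm_eq {x : M} (hx : x ∈ φ.base) (X : TangentSpace (𝓡 n) x) (v : 𝔤) :
    D.connForm φ x X v = (φ.toEquiv x).symm (D.toFun (φ.sec v) x X) := by
  have h := D.symm_toFun φ hx ((φ.contMDiffAt_sec v hx).mdifferentiableAt (by simp)) X
  have h1 : (fun y ↦ (φ.toEquiv y).symm (φ.sec v y)) = fun _ ↦ v :=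
    funext fun y ↦ (φ.toEquiv y).symm_apply_apply v
  rw [h, h1, mvfderiv_const, zero_apply, zero_add]
  exact congrArg _ ((φ.toEquiv x).symm_apply_apply v).symm

variable [T2Space M]

/-- This is the Leibniz rule for brackets applied to constant sections. As that rule is given for
global smooth sections, the constant sections are first replaced by global ones with the same germ
at `x`. -/
theorem isLieDer_connForm {x : M} (hx : x ∈ φ.base) (X : TangentSpace (𝓡 n) x) :
    IsLieDer 𝔤 (D.connForm φ x X) := by
  intro v w
  obtain ⟨u₁, hu₁, h₁⟩ := exists_contMDiff_section_eventuallyEq φ.isOpen_base (φ.smooth v) hx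
  obtain ⟨u₂, hu₂, h₂⟩ := exists_contMDiff_section_eventuallyEq φ.isOpen_base (φ.smooth w) hx
  have hs (v) := (φ.contMDiffAt_sec v hx).mdifferentiableAt (n := ∞) (by simp)
  have e₁ : D.toFun u₁ x = D.toFun (φ.sec v) x :=
    D.toFun_congr ((hu₁ x).mdifferentiableAt (by simp)) (hs v) h₁
  have e₂ : D.toFun u₂ x = D.toFun (φ.sec w) x :=
    D.toFun_congr ((hu₂ x).mdifferentiableAt (by simp)) (hs w) h₂
  have h3 : ∀ᶠ y in 𝓝 x, φ.sec ⁅v, w⁆ y = ⁅u₁ y, u₂ y⁆ := by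
    filter_upwards [h₁, h₂] with y hy₁ hy₂
    rw [hy₁, hy₂]
    exact LieEquiv.map_lie _ _ _
  have e₃ : D.toFun (φ.sec ⁅v, w⁆) x = D.toFun (fun y ↦ ⁅u₁ y, u₂ y⁆) x := by
    refine D.toFun_congr (hs _) ((hs ⁅v, w⁆).congr_of_eventuallyEq ?_) h3
    filter_upwards [h3] with y hy
    rw [hy]
  rw [D.connForm_eq φ hx, D.connForm_eq φ hx, D.connForm_eq φ hx, e₃,
    D.map_lie u₁ u₂ hu₁ hu₂, e₁, e₂, h₁.self_of_nhds, h₂.self_of_nhds, ← LieEquiv.coe_toLinearEquiv,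
    map_add]
  simp only [LieEquiv.coe_toLinearEquiv, LieEquiv.map_lie, LieEquiv.symm_apply_apply]

/-- A connection is local, so `u` may be replaced by a global smooth section with the same germ, to
which `D.smooth` applies. -/
theorem contMDiffAt_toFun_hom {u : ∀ x, L x} {x : M}
    (hu : ∀ᶠ y in 𝓝 x, ContMDiffAt (𝓡 n) ((𝓡 n).prod 𝓘(ℝ, 𝔤)) ∞
      (fun y ↦ TotalSpace.mk' 𝔤 y (u y)) y) :
    ContMDiffAt (𝓡 n) ((𝓡 n).prod 𝓘(ℝ, EuclideanSpace ℝ (Fin n) →L[ℝ] 𝔤)) ∞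
      (fun y ↦ TotalSpace.mk' (EuclideanSpace ℝ (Fin n) →L[ℝ] 𝔤)
        (E := fun y ↦ TangentSpace (𝓡 n) y →L[ℝ] L y) y (D.toFun u y)) x := by
  obtain ⟨U, hU, hUo, hxU⟩ := eventually_nhds_iff.1 hu
  obtain ⟨u', hu', h'⟩ := exists_contMDiff_section_eventuallyEq hUo
    (fun y hy ↦ (hU y hy).contMDiffWithinAt) hxU
  have h1 := D.smooth.contMDiff.contMDiff (σ := u') (by simpa using hu'.contMDiffOn)
  rw [contMDiffOn_univ] at h1
  refine (h1 x).congr_of_eventuallyEq ?_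
  filter_upwards [h'.eventually_nhds, hu] with y hy hy2
  congr 1
  exact D.toFun_congr (hy2.mdifferentiableAt (by simp)) ((hu' y).mdifferentiableAt (by simp))
    (hy.mono fun _ h ↦ h.symm)

theorem contMDiffAt_toFun {u : ∀ x, L x} {x : M} {X : ∀ x : M, TangentSpace (𝓡 n) x}
    (hu : ∀ᶠ y in 𝓝 x, ContMDiffAt (𝓡 n) ((𝓡 n).prod 𝓘(ℝ, 𝔤)) ∞
      (fun y ↦ TotalSpace.mk' 𝔤 y (u y)) y)
    (hX : ContMDiffAt (𝓡 n) (𝓡 n).tangent ∞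
      (fun x ↦ (TotalSpace.mk x (X x) : TangentBundle (𝓡 n) M)) x) :
    ContMDiffAt (𝓡 n) ((𝓡 n).prod 𝓘(ℝ, 𝔤)) ∞
      (fun y ↦ TotalSpace.mk' 𝔤 y (D.toFun u y (X y))) x :=
  (D.contMDiffAt_toFun_hom hu).clm_bundle_apply hX

theorem contMDiffAt_connForm {x : M} (hx : x ∈ φ.base) {X : ∀ x : M, TangentSpace (𝓡 n) x}
    (hX : ContMDiffAt (𝓡 n) (𝓡 n).tangent ∞
      (fun x ↦ (TotalSpace.mk x (X x) : TangentBundle (𝓡 n) M)) x) :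
    ContMDiffAt (𝓡 n) 𝓘(ℝ, 𝔤 →L[ℝ] 𝔤) ∞ (fun y ↦ D.connForm φ y (X y)) x := by
  refine contMDiffAt_clm_of_apply fun v ↦ ?_
  have hb := φ.isOpen_base.mem_nhds hx
  have h1 := D.contMDiffAt_toFun (u := φ.sec v) (by
    filter_upwards [hb] with y hy using φ.contMDiffAt_sec v hy) hX
  refine ((φ.contMDiffAt_section_iff hx).1 h1).congr_of_eventuallyEq ?_
  filter_upwards [hb] with y hy
  rw [D.connForm_eq φ hy]

end LieConnection

end ConnectionForm

/-! ### Curvature of an operator-valued 1-form on a vector space -/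

section CurvatureCalculus

variable {E : Type*} [NormedAddCommGroup E] [NormedSpace ℝ E]
  {G : Type*} [NormedAddCommGroup G] [NormedSpace ℝ G]

/-- The curvature `dA + A ∧ A` of an operator valued 1-form. -/
noncomputable def curvForm (A : E → E →L[ℝ] G →L[ℝ] G) (y v w : E) : G →L[ℝ] G :=
  fderiv ℝ A y v w - fderiv ℝ A y w v + (A y v * A y w - A y w * A y v)

theorem curvature_algebra_add {V : Type*} [NormedRing V] [NormedAlgebra ℝ V]
    (T : E →L[ℝ] E →L[ℝ] V) (S : E →L[ℝ] V) (v v' w : E) :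
    T (v + v') w - T w (v + v') + (S (v + v') * S w - S w * S (v + v')) =
      T v w - T w v + (S v * S w - S w * S v) + (T v' w - T w v' + (S v' * S w - S w * S v')) := by
  rw [map_add, add_apply, map_add, map_add, add_mul, mul_add]
  abel

theorem curvature_algebra_smul {V : Type*} [NormedRing V] [NormedAlgebra ℝ V]
    (T : E →L[ℝ] E →L[ℝ] V) (S : E →L[ℝ] V) (c : ℝ) (v w : E) :
    T (c • v) w - T w (c • v) + (S (c • v) * S w - S w * S (c • v)) =
      c • (T v w - T w v + (S v * S w - S w * S v)) := by
  rw [map_smul, smul_apply, map_smul, map_smul, smul_mul_assoc, mul_smul_comm, smul_add, smul_sub,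
    smul_sub]

theorem curvForm_add_left (A : E → E →L[ℝ] G →L[ℝ] G) (y v v' w : E) :
    curvForm A y (v + v') w = curvForm A y v w + curvForm A y v' w := by
  exact curvature_algebra_add _ _ _ _ _

theorem curvForm_smul_left (A : E → E →L[ℝ] G →L[ℝ] G) (y : E) (c : ℝ) (v w : E) :
    curvForm A y (c • v) w = c • curvForm A y v w := by
  exact curvature_algebra_smul _ _ _ _ _

theorem curvForm_swap (A : E → E →L[ℝ] G →L[ℝ] G) (y v w : E) :
    curvForm A y v w = -curvForm A y w v := by
  simp only [curvForm]
  abel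

theorem curvForm_self (A : E → E →L[ℝ] G →L[ℝ] G) (y v : E) : curvForm A y v v = 0 := by
  simp [curvForm]

theorem hasFDerivAt_covariant {A : E → E →L[ℝ] G →L[ℝ] G} {c : E → G} {Y : E → E} {y : E}
    (hA : DifferentiableAt ℝ A y) (hc : DifferentiableAt ℝ (fderiv ℝ c) y)
    (hc' : DifferentiableAt ℝ c y) (hY : DifferentiableAt ℝ Y y) (h : E) :
    fderiv ℝ (fun z ↦ fderiv ℝ c z (Y z) + A z (Y z) (c z)) y h =
      fderiv ℝ (fderiv ℝ c) y h (Y y) + fderiv ℝ c y (fderiv ℝ Y y h) +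
        (fderiv ℝ A y h (Y y) (c y) + A y (fderiv ℝ Y y h) (c y) + A y (Y y) (fderiv ℝ c y h)) := by
  have h1 := hc.hasFDerivAt.clm_apply hY.hasFDerivAt
  have h2 := (hA.hasFDerivAt.clm_apply hY.hasFDerivAt).clm_apply hc'.hasFDerivAt
  rw [HasFDerivAt.fderiv (f := fun z ↦ fderiv ℝ c z (Y z) + A z (Y z) (c z)) (h1.add h2)]
  simp [ContinuousLinearMap.flip_apply]
  abel

/-- The commutator of covariant derivatives is the curvature. -/
theorem curvForm_apply {A : E → E →L[ℝ] G →L[ℝ] G} {c : E → G} {X Y : E → E} {y : E}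
    (hA : DifferentiableAt ℝ A y) (hc : ContDiffAt ℝ 2 c y)
    (hX : DifferentiableAt ℝ X y) (hY : DifferentiableAt ℝ Y y) :
    (fderiv ℝ (fun z ↦ fderiv ℝ c z (Y z) + A z (Y z) (c z)) y (X y) +
        A y (X y) (fderiv ℝ c y (Y y) + A y (Y y) (c y))) -
      (fderiv ℝ (fun z ↦ fderiv ℝ c z (X z) + A z (X z) (c z)) y (Y y) +
        A y (Y y) (fderiv ℝ c y (X y) + A y (X y) (c y))) -
      (fderiv ℝ c y (VectorField.lieBracket ℝ X Y y) +
        A y (VectorField.lieBracket ℝ X Y y) (c y)) =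
      curvForm A y (X y) (Y y) (c y) := by
  have hc1 : DifferentiableAt ℝ (fderiv ℝ c) y :=
    (hc.fderiv_right (m := 1) (by norm_num)).differentiableAt (by norm_num)
  have hc2 : DifferentiableAt ℝ c y := hc.differentiableAt (by norm_num)
  -- Symmetry of the second derivative of `c` removes the second-order terms; the derivatives of `X`
  -- and `Y` are absorbed by the Lie bracket.
  have hs := (hc.isSymmSndFDerivAt (by simp)).eq (X y) (Y y)
  rw [hasFDerivAt_covariant hA hc1 hc2 hY, hasFDerivAt_covariant hA hc1 hc2 hX, hs,
    VectorField.lieBracket_eq, curvForm]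
  simp only [map_sub, map_add, add_apply, sub_apply, mul_apply_eq_comp]
  abel

end CurvatureCalculus

/-! ### Charts onto the whole of `ℝⁿ` -/

section Charts

variable {n : ℕ} {M : Type u} [TopologicalSpace M] [ChartedSpace (EuclideanSpace ℝ (Fin n)) M]

variable (n M) in
/-- A smooth chart of `M` onto the whole of `ℝⁿ`. -/
structure FullChart where
  chart : OpenPartialHomeomorph M (EuclideanSpace ℝ (Fin n))
  mem_maximalAtlas : chart ∈ IsManifold.maximalAtlas (𝓡 n) ∞ M
  target_eq : chart.target = univ

namespace FullChart

variable [IsManifold (𝓡 n) ∞ M] (χ : FullChart n M)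

/-- The domain of a chart. -/
def source : Set M := χ.chart.source

/-- The inverse of a chart. -/
def inv (y : EuclideanSpace ℝ (Fin n)) : M := χ.chart.symm y

theorem isOpen_source : IsOpen χ.source := χ.chart.open_source

theorem inv_mem (y : EuclideanSpace ℝ (Fin n)) : χ.inv y ∈ χ.source :=
  χ.chart.map_target (by rw [χ.target_eq]; trivial)

theorem chart_inv (y : EuclideanSpace ℝ (Fin n)) : χ.chart (χ.inv y) = y :=
  χ.chart.right_inv (by rw [χ.target_eq]; trivial)

theorem inv_chart {x : M} (hx : x ∈ χ.source) : χ.inv (χ.chart x) = x := χ.chart.left_inv hx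

theorem contMDiff_inv : ContMDiff 𝓘(ℝ, EuclideanSpace ℝ (Fin n)) (𝓡 n) ∞ χ.inv := by
  have h := contMDiffOn_symm_of_mem_maximalAtlas χ.mem_maximalAtlas
  rw [χ.target_eq, contMDiffOn_univ] at h
  exact h

theorem continuous_inv : Continuous χ.inv := χ.contMDiff_inv.continuous

theorem mdifferentiableAt_inv (y : EuclideanSpace ℝ (Fin n)) :
    MDifferentiableAt 𝓘(ℝ, EuclideanSpace ℝ (Fin n)) (𝓡 n) χ.inv y :=
  (χ.contMDiff_inv y).mdifferentiableAt (by simp)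

theorem contMDiffAt_chart {x : M} (hx : x ∈ χ.source) :
    ContMDiffAt (𝓡 n) 𝓘(ℝ, EuclideanSpace ℝ (Fin n)) ∞ χ.chart x :=
  contMDiffAt_of_mem_maximalAtlas χ.mem_maximalAtlas hx

theorem isInvertible_mfderiv_inv (y : EuclideanSpace ℝ (Fin n)) :
    (mfderiv 𝓘(ℝ, EuclideanSpace ℝ (Fin n)) (𝓡 n) χ.inv y).IsInvertible := by
  have hj := (χ.mdifferentiableAt_inv y).hasMFDerivAt
  have hc := ((χ.contMDiffAt_chart (χ.inv_mem y)).mdifferentiableAt (by simp)).hasMFDerivAt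
  have hj' : HasMFDerivAt 𝓘(ℝ, EuclideanSpace ℝ (Fin n)) (𝓡 n) χ.inv (χ.chart (χ.inv y))
      (mfderiv 𝓘(ℝ, EuclideanSpace ℝ (Fin n)) (𝓡 n) χ.inv y) := by
    rw [χ.chart_inv]
    exact hj
  have h1 : χ.chart ∘ χ.inv = id := funext χ.chart_inv
  have h2 : χ.inv ∘ χ.chart =ᶠ[𝓝 (χ.inv y)] id := by
    filter_upwards [χ.isOpen_source.mem_nhds (χ.inv_mem y)] with x hx using χ.inv_chart hx
  refine ContinuousLinearMap.IsInvertible.of_inverse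
    (g := mfderiv (𝓡 n) 𝓘(ℝ, EuclideanSpace ℝ (Fin n)) χ.chart (χ.inv y)) ?_ ?_
  · exact hasMFDerivAt_unique (hj'.comp (χ.inv y) hc)
      ((hasMFDerivAt_id (I := 𝓡 n) (χ.inv y)).congr_of_eventuallyEq h2)
  · exact hasMFDerivAt_unique (hc.comp y hj)
      ((hasMFDerivAt_id (I := 𝓘(ℝ, EuclideanSpace ℝ (Fin n))) y).congr_of_eventuallyEq
        (Filter.Eventually.of_forall fun z ↦ congrFun h1 z))

/-- The coordinate field of a chart in the direction `e`. -/
noncomputable def coordField (e : EuclideanSpace ℝ (Fin n)) (x : M) : TangentSpace (𝓡 n) x :=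
  mfderiv 𝓘(ℝ, EuclideanSpace ℝ (Fin n)) (𝓡 n) χ.inv (χ.chart x) e

theorem coordField_inv (e y : EuclideanSpace ℝ (Fin n)) :
    χ.coordField e (χ.inv y) = mfderiv 𝓘(ℝ, EuclideanSpace ℝ (Fin n)) (𝓡 n) χ.inv y e := by
  rw [coordField, χ.chart_inv]

theorem contMDiffOn_coordField (e : EuclideanSpace ℝ (Fin n)) :
    ContMDiffOn (𝓡 n) (𝓡 n).tangent ∞
      (fun x ↦ (TotalSpace.mk x (χ.coordField e x) : TangentBundle (𝓡 n) M)) χ.source := by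
  intro x hx
  refine ContMDiffAt.contMDiffWithinAt ?_
  have h1 := χ.contMDiff_inv.contMDiff_tangentMap (m := ∞) (by simp)
  have h2 : ContMDiffAt 𝓘(ℝ, EuclideanSpace ℝ (Fin n)) 𝓘(ℝ, EuclideanSpace ℝ (Fin n)).tangent ∞
      (fun y ↦ (TotalSpace.mk y e : TangentBundle 𝓘(ℝ, EuclideanSpace ℝ (Fin n)) _)) (χ.chart x) :=
    contMDiffAt_vectorSpace_iff_contDiffAt.2 contDiffAt_const
  refine ((h1 _).comp x (h2.comp x (χ.contMDiffAt_chart hx))).congr_of_eventuallyEq ?_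
  filter_upwards [χ.isOpen_source.mem_nhds hx] with z hz
  change TotalSpace.mk z _ = TotalSpace.mk (χ.inv (χ.chart z)) _
  rw [χ.inv_chart hz]
  rfl

/-- The components of a vector field in a chart. -/
noncomputable def comp (X : ∀ x : M, TangentSpace (𝓡 n) x) (y : EuclideanSpace ℝ (Fin n)) :
    EuclideanSpace ℝ (Fin n) :=
  VectorField.mpullback 𝓘(ℝ, EuclideanSpace ℝ (Fin n)) (𝓡 n) χ.inv X y

theorem mfderiv_inv_comp (X : ∀ x : M, TangentSpace (𝓡 n) x) (y : EuclideanSpace ℝ (Fin n)) :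
    mfderiv 𝓘(ℝ, EuclideanSpace ℝ (Fin n)) (𝓡 n) χ.inv y (χ.comp X y) = X (χ.inv y) :=
  (χ.isInvertible_mfderiv_inv y).self_apply_inverse _

theorem comp_eq_of_mfderiv {X : ∀ x : M, TangentSpace (𝓡 n) x} {y v : EuclideanSpace ℝ (Fin n)}
    (h : mfderiv 𝓘(ℝ, EuclideanSpace ℝ (Fin n)) (𝓡 n) χ.inv y v = X (χ.inv y)) :
    χ.comp X y = v :=
  (χ.isInvertible_mfderiv_inv y).inverse_apply_eq.2 h.symm

theorem contDiffAt_comp {X : ∀ x : M, TangentSpace (𝓡 n) x} {y : EuclideanSpace ℝ (Fin n)}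
    (hX : ContMDiffAt (𝓡 n) (𝓡 n).tangent ∞
      (fun x ↦ (TotalSpace.mk x (X x) : TangentBundle (𝓡 n) M)) (χ.inv y)) :
    ContDiffAt ℝ ∞ (χ.comp X) y :=
  contMDiffAt_vectorSpace_iff_contDiffAt.1
    (hX.mpullback_vectorField_preimage (χ.contMDiff_inv y) (χ.isInvertible_mfderiv_inv y)
      (by simp))

theorem comp_mlieBracket {X Y : ∀ x : M, TangentSpace (𝓡 n) x} (hX : IsSmoothField X)
    (hY : IsSmoothField Y) (y : EuclideanSpace ℝ (Fin n)) :
    χ.comp (VectorField.mlieBracket (𝓡 n) X Y) y =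
      VectorField.lieBracket ℝ (χ.comp X) (χ.comp Y) y := by
  have : IsManifold (𝓡 n) (minSmoothness ℝ 2) M :=
    IsManifold.of_le (n := ∞) (by simpa using ENat.LEInfty.out)
  rw [comp, VectorField.mpullback_mlieBracket ((hX _).mdifferentiableAt (by simp))
    ((hY _).mdifferentiableAt (by simp)) (χ.contMDiff_inv y)
    (by simpa using ENat.LEInfty.out),
    ← VectorField.mlieBracketWithin_univ, VectorField.mlieBracketWithin_eq_lieBracketWithin]
  exact congrFun (VectorField.lieBracketWithin_univ (V := χ.comp X) (W := χ.comp Y)) y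

end FullChart

end Charts

/-! ### Connection and curvature forms in a chart -/

section CoordForm

variable {n : ℕ} {M : Type u} [TopologicalSpace M] [ChartedSpace (EuclideanSpace ℝ (Fin n)) M]
  [IsManifold (𝓡 n) ∞ M]
  {𝔤 : Type*} [NormedAddCommGroup 𝔤] [NormedSpace ℝ 𝔤] [FiniteDimensional ℝ 𝔤]
  [RealLieAlgebra 𝔤]
  {L : M → Type*} [∀ x, LieRing (L x)] [∀ x, LieAlgebra ℝ (L x)]
  [∀ x, TopologicalSpace (L x)] [∀ x, IsTopologicalAddGroup (L x)]
  [∀ x, ContinuousSMul ℝ (L x)]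
  [TopologicalSpace (TotalSpace 𝔤 L)] [FiberBundle 𝔤 L] [VectorBundle ℝ 𝔤 L]
  [ContMDiffVectorBundle ∞ 𝔤 L (𝓡 n)]

namespace LieConnection

variable (D : LieConnection n 𝔤 L) (φ : LieTrivialization (n := n) 𝔤 L) (χ : FullChart n M)

/-- The connection form in a trivialization and a chart. -/
noncomputable def coordForm (y : EuclideanSpace ℝ (Fin n)) :
    EuclideanSpace ℝ (Fin n) →L[ℝ] 𝔤 →L[ℝ] 𝔤 :=
  LinearMap.toContinuousLinearMap ((D.connForm φ (χ.inv y)).comp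
    (mfderiv 𝓘(ℝ, EuclideanSpace ℝ (Fin n)) (𝓡 n) χ.inv y).toLinearMap)

theorem coordForm_apply (y e : EuclideanSpace ℝ (Fin n)) :
    D.coordForm φ χ y e = D.connForm φ (χ.inv y)
      (mfderiv 𝓘(ℝ, EuclideanSpace ℝ (Fin n)) (𝓡 n) χ.inv y e) := rfl

theorem symm_toFun_coord {y : EuclideanSpace ℝ (Fin n)} (hy : χ.inv y ∈ φ.base) {u : ∀ x, L x}
    (hu : MDifferentiableAt (𝓡 n) ((𝓡 n).prod 𝓘(ℝ, 𝔤)) (fun y ↦ TotalSpace.mk' 𝔤 y (u y))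
      (χ.inv y)) (e : EuclideanSpace ℝ (Fin n)) :
    (φ.toEquiv (χ.inv y)).symm (D.toFun u (χ.inv y)
        (mfderiv 𝓘(ℝ, EuclideanSpace ℝ (Fin n)) (𝓡 n) χ.inv y e)) =
      fderiv ℝ (fun z ↦ (φ.toEquiv (χ.inv z)).symm (u (χ.inv z))) y e +
        D.coordForm φ χ y e ((φ.toEquiv (χ.inv y)).symm (u (χ.inv y))) := by
  rw [D.symm_toFun φ hy hu, coordForm_apply]
  congr 1
  have h : HasFDerivAt (fun z ↦ (φ.toEquiv (χ.inv z)).symm (u (χ.inv z)))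
      ((mvfderiv (𝓡 n) (fun x ↦ (φ.toEquiv x).symm (u x)) (χ.inv y)).comp
        (mfderiv 𝓘(ℝ, EuclideanSpace ℝ (Fin n)) (𝓡 n) χ.inv y) :
          EuclideanSpace ℝ (Fin n) →L[ℝ] 𝔤) y :=
    (((φ.mdifferentiableAt_section_iff hy).1 hu).hasMFDerivAt.comp y
      (χ.mdifferentiableAt_inv y).hasMFDerivAt).hasFDerivAt
  rw [h.fderiv]
  rfl

variable [T2Space M]

theorem contDiffAt_coordForm {y : EuclideanSpace ℝ (Fin n)} (hy : χ.inv y ∈ φ.base) :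
    ContDiffAt ℝ ∞ (D.coordForm φ χ) y := by
  rw [← contMDiffAt_iff_contDiffAt]
  refine contMDiffAt_clm_of_apply fun e ↦ ?_
  have h := D.contMDiffAt_connForm φ hy ((χ.contMDiffOn_coordField e).contMDiffAt
    (χ.isOpen_source.mem_nhds (χ.inv_mem y)))
  refine (h.comp y (χ.contMDiff_inv y)).congr_of_eventuallyEq (Filter.Eventually.of_forall ?_)
  intro z
  change _ = D.connForm φ (χ.inv z) (χ.coordField e (χ.inv z))
  rw [χ.coordField_inv]
  rfl

theorem contDiffAt_symm_section {y : EuclideanSpace ℝ (Fin n)} (hy : χ.inv y ∈ φ.base)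
    {u : ∀ x, L x} (hu : ContMDiffAt (𝓡 n) ((𝓡 n).prod 𝓘(ℝ, 𝔤)) ∞
      (fun y ↦ TotalSpace.mk' 𝔤 y (u y)) (χ.inv y)) :
    ContDiffAt ℝ ∞ (fun z ↦ (φ.toEquiv (χ.inv z)).symm (u (χ.inv z))) y := by
  rw [← contMDiffAt_iff_contDiffAt]
  exact ((φ.contMDiffAt_section_iff hy).1 hu).comp y (χ.contMDiff_inv y)

/-- The curvature of a connection in a trivialization and a chart. -/
theorem symm_curvature {y : EuclideanSpace ℝ (Fin n)} (hy : χ.inv y ∈ φ.base)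
    {X Y : ∀ x : M, TangentSpace (𝓡 n) x} {u : ∀ x, L x} (hX : IsSmoothField X)
    (hY : IsSmoothField Y) (hu : IsSmoothSection n 𝔤 u) :
    (φ.toEquiv (χ.inv y)).symm (D.curvature X Y u (χ.inv y)) =
      curvForm (D.coordForm φ χ) y (χ.comp X y) (χ.comp Y y)
        ((φ.toEquiv (χ.inv y)).symm (u (χ.inv y))) := by
  have hmem : ∀ᶠ z in 𝓝 y, χ.inv z ∈ φ.base :=
    χ.continuous_inv.continuousAt (φ.isOpen_base.mem_nhds hy)
  have hu' (x : M) := (hu x).mdifferentiableAt (n := ∞) (by simp)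
  have key (Z : ∀ x : M, TangentSpace (𝓡 n) x) (z) (hz : χ.inv z ∈ φ.base) :
      (φ.toEquiv (χ.inv z)).symm (D.toFun u (χ.inv z) (Z (χ.inv z))) =
      fderiv ℝ (fun z ↦ (φ.toEquiv (χ.inv z)).symm (u (χ.inv z))) z (χ.comp Z z) +
        D.coordForm φ χ z (χ.comp Z z) ((φ.toEquiv (χ.inv z)).symm (u (χ.inv z))) := by
    rw [← D.symm_toFun_coord φ χ hz (hu' _), χ.mfderiv_inv_comp]
  -- The coordinate formula for `∇_Z u` is used twice: once for the section `∇_Z u` itself, and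
  -- once, through its germ at `y`, under the derivative.
  have key2 (Z W : ∀ x : M, TangentSpace (𝓡 n) x) (hZ : IsSmoothField Z) :
      (φ.toEquiv (χ.inv y)).symm (D.toFun (fun x ↦ D.toFun u x (Z x)) (χ.inv y) (W (χ.inv y))) =
      fderiv ℝ (fun z ↦ fderiv ℝ (fun z ↦ (φ.toEquiv (χ.inv z)).symm (u (χ.inv z))) z (χ.comp Z z) +
        D.coordForm φ χ z (χ.comp Z z) ((φ.toEquiv (χ.inv z)).symm (u (χ.inv z)))) y (χ.comp W y) +
      D.coordForm φ χ y (χ.comp W y)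
        (fderiv ℝ (fun z ↦ (φ.toEquiv (χ.inv z)).symm (u (χ.inv z))) y (χ.comp Z y) +
        D.coordForm φ χ y (χ.comp Z y) ((φ.toEquiv (χ.inv y)).symm (u (χ.inv y)))) := by
    have h1 := D.contMDiffAt_toFun (Filter.Eventually.of_forall fun x ↦ hu x) (hZ (χ.inv y))
    have h2 := D.symm_toFun_coord φ χ hy (h1.mdifferentiableAt (by simp)) (χ.comp W y)
    rw [χ.mfderiv_inv_comp] at h2
    rw [h2, key Z y hy]
    congr 2
    refine Filter.EventuallyEq.fderiv_eq ?_
    filter_upwards [hmem] with z hz using key Z z hz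
  rw [curvature, ← LieEquiv.coe_toLinearEquiv, map_sub, map_sub]
  simp only [LieEquiv.coe_toLinearEquiv]
  rw [key2 Y X hY, key2 X Y hX, key (VectorField.mlieBracket (𝓡 n) X Y) y hy,
    χ.comp_mlieBracket hX hY]
  exact curvForm_apply ((D.contDiffAt_coordForm φ χ hy).differentiableAt (by simp))
    ((contDiffAt_symm_section φ χ hy (hu _)).of_le ENat.LEInfty.out)
    ((χ.contDiffAt_comp (hX _)).differentiableAt (by simp))
    ((χ.contDiffAt_comp (hY _)).differentiableAt (by simp))

/-- The curvature form of a connection in accordance takes values in the inner derivations. -/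
theorem curvForm_mem_innerDer (hD : D.InAccordance) {y : EuclideanSpace ℝ (Fin n)}
    (hy : χ.inv y ∈ φ.base) (v w : EuclideanSpace ℝ (Fin n)) :
    curvForm (D.coordForm φ χ) y v w ∈ innerDer 𝔤 := by
  obtain ⟨Ω, -, hΩ⟩ := hD
  -- `InAccordance` speaks of global fields and sections, so coordinate fields and constant sections
  -- are extended. The curvature form is then `ad` of the coordinate of `Ω(X, Y)`.
  obtain ⟨X, hX, hXv⟩ := exists_contMDiff_section_eventuallyEq χ.isOpen_source
    (χ.contMDiffOn_coordField v) (χ.inv_mem y)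
  obtain ⟨Y, hY, hYw⟩ := exists_contMDiff_section_eventuallyEq χ.isOpen_source
    (χ.contMDiffOn_coordField w) (χ.inv_mem y)
  refine mem_innerDer.2
    ⟨(φ.toEquiv (χ.inv y)).symm (Ω (χ.inv y) ![X (χ.inv y), Y (χ.inv y)]), ?_⟩
  ext c
  obtain ⟨u, hu, huc⟩ := exists_contMDiff_section_eventuallyEq φ.isOpen_base (φ.smooth c) hy
  have h := D.symm_curvature φ χ hy hX hY hu
  have hv : χ.comp X y = v := χ.comp_eq_of_mfderiv
    ((χ.coordField_inv v y).symm.trans hXv.self_of_nhds.symm)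
  have hw : χ.comp Y y = w := χ.comp_eq_of_mfderiv
    ((χ.coordField_inv w y).symm.trans hYw.self_of_nhds.symm)
  rw [hΩ X Y u hX hY hu, hv, hw, huc.self_of_nhds, LieEquiv.map_lie, LieEquiv.symm_apply_apply] at h
  exact h

end LieConnection

end CoordForm

/-! ### Smooth extension of maps, and automorphisms as operators -/

section Preliminaries

/-- A locally defined smooth map agrees near a point with a globally smooth map. -/
theorem exists_contDiff_eventuallyEq {E : Type*} [NormedAddCommGroup E] [NormedSpace ℝ E]
    [FiniteDimensional ℝ E] {F : Type*} [NormedAddCommGroup F] [NormedSpace ℝ F] {f : E → F}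
    {U : Set E} (hU : IsOpen U) (hf : ∀ y ∈ U, ContDiffAt ℝ ∞ f y) {x : E} (hx : x ∈ U) :
    ∃ f' : E → F, ContDiff ℝ ∞ f' ∧ ∀ᶠ y in 𝓝 x, f' y = f y := by
  obtain ⟨ε, hε, hball⟩ := Metric.isOpen_iff.1 hU x hx
  let b : ContDiffBump x := ⟨ε / 4, ε / 2, by positivity, by linarith⟩
  refine ⟨fun y ↦ b y • f y, contDiff_iff_contDiffAt.2 fun y ↦ ?_, ?_⟩
  · by_cases hy : y ∈ U
    · exact b.contDiff.contDiffAt.smul (hf y hy)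
    · have hy2 : y ∉ tsupport b := fun h ↦ hy (hball (by
        rw [b.tsupport_eq] at h
        exact Metric.closedBall_subset_ball (by change ε / 2 < ε; linarith) h))
      refine (contDiffAt_const (c := (0 : F))).congr_of_eventuallyEq ?_
      filter_upwards [(isClosed_tsupport b).isOpen_compl.mem_nhds hy2] with z hz
      rw [image_eq_zero_of_notMem_tsupport hz, zero_smul]
  · filter_upwards [b.eventuallyEq_one] with y hy
    rw [hy, Pi.one_apply, one_smul]

variable {𝔤 : Type*} [NormedAddCommGroup 𝔤] [NormedSpace ℝ 𝔤] [FiniteDimensional ℝ 𝔤]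
  [RealLieAlgebra 𝔤]

theorem isUnit_autCLM (a : LieAut 𝔤) : IsUnit (autCLM a) := ⟨a.1, rfl⟩

theorem ringInverse_autCLM (a : LieAut 𝔤) : Ring.inverse (autCLM a) = autCLM a⁻¹ :=
  Ring.inverse_unit a.1

theorem exists_lieAut_of_isUnit {T : 𝔤 →L[ℝ] 𝔤} (hT : IsUnit T)
    (h : ∀ u v, T ⁅u, v⁆ = ⁅T u, T v⁆) : ∃ a : LieAut 𝔤, autCLM a = T := by
  obtain ⟨a, rfl⟩ := hT
  exact ⟨⟨a, h⟩, rfl⟩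

/-- An element of `Aut(𝔤)` as a Lie algebra isomorphism. -/
noncomputable def LieAut.toLieEquiv (a : LieAut 𝔤) : 𝔤 ≃ₗ⁅ℝ⁆ 𝔤 where
  toFun := autCLM a
  map_add' := map_add _
  map_smul' := map_smul _
  map_lie' := autCLM_lie a _ _
  invFun := autCLM a⁻¹
  left_inv x := DFunLike.congr_fun (autCLM_inv_mul a) x
  right_inv x := DFunLike.congr_fun (autCLM_mul_inv a) x

theorem IsLieDer.neg {T : 𝔤 →L[ℝ] 𝔤} (hT : IsLieDer 𝔤 T) : IsLieDer 𝔤 (-T) := fun u v ↦ by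
  rw [neg_apply, neg_apply, neg_apply, hT u v, neg_lie, lie_neg, neg_add]

end Preliminaries

/-! ### Parallel frames along rays: change of gauge and uniqueness -/

section ParallelFrames

variable {n : ℕ} {M : Type u} [TopologicalSpace M] [ChartedSpace (EuclideanSpace ℝ (Fin n)) M]
  [IsManifold (𝓡 n) ∞ M]
  {𝔤 : Type*} [NormedAddCommGroup 𝔤] [NormedSpace ℝ 𝔤] [FiniteDimensional ℝ 𝔤]
  [RealLieAlgebra 𝔤]
  {L : M → Type*} [∀ x, LieRing (L x)] [∀ x, LieAlgebra ℝ (L x)]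
  [∀ x, TopologicalSpace (L x)] [∀ x, IsTopologicalAddGroup (L x)]
  [∀ x, ContinuousSMul ℝ (L x)]
  [TopologicalSpace (TotalSpace 𝔤 L)] [FiberBundle 𝔤 L] [VectorBundle ℝ 𝔤 L]
  [ContMDiffVectorBundle ∞ 𝔤 L (𝓡 n)]

namespace LieConnection

/-- The automorphism `φ(x)⁻¹ θ(x)` that compares a family of isomorphisms with a trivialization. -/
noncomputable def relAut (θ : ∀ x : M, 𝔤 ≃ₗ⁅ℝ⁆ L x) (φ : LieTrivialization (n := n) 𝔤 L) (x : M) : LieAut 𝔤 :=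
  AutDelta.ofLieEquiv ((θ x).trans (φ.toEquiv x).symm)

theorem autCLM_relAut_apply (θ : ∀ x : M, 𝔤 ≃ₗ⁅ℝ⁆ L x) (φ : LieTrivialization (n := n) 𝔤 L) (x : M)
    (v : 𝔤) : autCLM (relAut θ φ x) v = (φ.toEquiv x).symm (θ x v) := rfl

theorem transCLM_mul_relAut (θ : ∀ x : M, 𝔤 ≃ₗ⁅ℝ⁆ L x) (φ φ' : LieTrivialization (n := n) 𝔤 L)
    (x : M) : φ.transCLM φ' x * autCLM (relAut θ φ x) = autCLM (relAut θ φ' x) := by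
  ext v
  rw [mul_apply_eq_comp, autCLM_relAut_apply, autCLM_relAut_apply, φ.transCLM_apply,
    LieEquiv.apply_symm_apply]

variable (D : LieConnection n 𝔤 L) (χ : FullChart n M)

theorem contDiffAt_transCLM_inv (φ φ' : LieTrivialization (n := n) 𝔤 L)
    {y : EuclideanSpace ℝ (Fin n)} (hy : χ.inv y ∈ φ.base) (hy' : χ.inv y ∈ φ'.base) :
    ContDiffAt ℝ ∞ (fun z ↦ φ.transCLM φ' (χ.inv z)) y := by
  rw [← contMDiffAt_iff_contDiffAt]
  exact (φ.contMDiffAt_transCLM φ' hy hy').comp y (χ.contMDiff_inv y)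

/-- The change of the connection form under a change of trivialization. -/
theorem coordForm_mul_transCLM (φ φ' : LieTrivialization (n := n) 𝔤 L)
    {y : EuclideanSpace ℝ (Fin n)} (hy : χ.inv y ∈ φ.base) (hy' : χ.inv y ∈ φ'.base)
    (e : EuclideanSpace ℝ (Fin n)) :
    D.coordForm φ' χ y e * φ.transCLM φ' (χ.inv y) =
      φ.transCLM φ' (χ.inv y) * D.coordForm φ χ y e -
        fderiv ℝ (fun z ↦ φ.transCLM φ' (χ.inv z)) y e := by
  ext v
  have h := D.symm_toFun_coord φ' χ hy'
    ((φ.contMDiffAt_sec v hy).mdifferentiableAt (by simp)) e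
  have hd := ((contDiffAt_transCLM_inv χ φ φ' hy hy').differentiableAt (by simp)).hasFDerivAt
  have h1 : fderiv ℝ (fun z ↦ (φ'.toEquiv (χ.inv z)).symm (φ.sec v (χ.inv z))) y e =
      fderiv ℝ (fun z ↦ φ.transCLM φ' (χ.inv z)) y e v := by
    have h2 := (hd.clm_apply (hasFDerivAt_const v y)).fderiv
    have h3 := DFunLike.congr_fun h2 e
    refine h3.trans ?_
    simp
  have h4 : (φ'.toEquiv (χ.inv y)).symm (D.toFun (φ.sec v) (χ.inv y)
      (mfderiv 𝓘(ℝ, EuclideanSpace ℝ (Fin n)) (𝓡 n) χ.inv y e)) =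
      φ.transCLM φ' (χ.inv y) (D.coordForm φ χ y e v) := by
    rw [φ.transCLM_apply, coordForm_apply, D.connForm_eq φ hy, LieEquiv.apply_symm_apply]
  rw [h4, h1] at h
  rw [sub_apply, mul_apply_eq_comp, mul_apply_eq_comp, h, add_sub_cancel_left]
  rfl

/-- In the trivialization `φ`, the family `θ ∘ α` along the ray through `y` satisfies the equation
of parallel transport at the time `t`. -/
def IsParallelFrameAt (θ : ∀ x : M, 𝔤 ≃ₗ⁅ℝ⁆ L x) (y : EuclideanSpace ℝ (Fin n)) (α : ℝ → LieAut 𝔤)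
    (s : Set ℝ) (t : ℝ) (φ : LieTrivialization (n := n) 𝔤 L) : Prop :=
  HasDerivWithinAt (fun τ ↦ autCLM (relAut θ φ (χ.inv (τ • y))) * autCLM (α τ))
    (-(D.coordForm φ χ (t • y) y * (autCLM (relAut θ φ (χ.inv (t • y))) * autCLM (α t)))) s t

variable {D χ} {θ : ∀ x : M, 𝔤 ≃ₗ⁅ℝ⁆ L x} {y : EuclideanSpace ℝ (Fin n)} {α β : ℝ → LieAut 𝔤}
  {s : Set ℝ} {t : ℝ} {φ φ' : LieTrivialization (n := n) 𝔤 L}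

/-- With `A' T = T A - dT`, the product rule turns `P' = -A P` into `(T P)' = -A' (T P)`. The
reference family `θ` need not be continuous: only the products `φ⁻¹ θ α` are differentiated. -/
theorem IsParallelFrameAt.change (h : D.IsParallelFrameAt χ θ y α s t φ)
    (hφ : χ.inv (t • y) ∈ φ.base) (hφ' : χ.inv (t • y) ∈ φ'.base) :
    D.IsParallelFrameAt χ θ y α s t φ' := by
  have hray : HasDerivWithinAt (fun τ : ℝ ↦ τ • y) y s t := by
    simpa using (hasDerivAt_id t).hasDerivWithinAt.smul_const y
  have hT := ((contDiffAt_transCLM_inv χ φ φ' hφ hφ').differentiableAt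
    (by simp)).hasFDerivAt.comp_hasDerivWithinAt t hray
  have h2 := HasDerivWithinAt.mul hT h
  have h3 : (fun τ ↦ autCLM (relAut θ φ' (χ.inv (τ • y))) * autCLM (α τ)) =
      (fun τ ↦ φ.transCLM φ' (χ.inv (τ • y))) *
        fun τ ↦ autCLM (relAut θ φ (χ.inv (τ • y))) * autCLM (α τ) := by
    funext τ
    rw [Pi.mul_apply, ← mul_assoc, transCLM_mul_relAut]
  rw [IsParallelFrameAt, h3]
  refine h2.congr_deriv ?_
  have h4 := D.coordForm_mul_transCLM χ φ φ' hφ hφ' y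
  rw [← transCLM_mul_relAut θ φ φ', mul_assoc, ← mul_assoc (D.coordForm φ' χ _ _), h4]
  simp only [Function.comp_apply]
  noncomm_ring

theorem IsParallelFrameAt.congr (h : D.IsParallelFrameAt χ θ y α s t φ) (ht : t ∈ s)
    (hs : ∀ τ ∈ s, β τ = α τ) : D.IsParallelFrameAt χ θ y β s t φ := by
  unfold IsParallelFrameAt
  rw [hs t ht]
  exact HasDerivWithinAt.congr h (fun τ hτ ↦ by rw [hs τ hτ]) (by rw [hs t ht])

/-- Chain rule, together with linearity of the connection form in the direction. It identifies
transport along `r y` with the initial part of transport along `y`. -/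
theorem IsParallelFrameAt.scale {r : ℝ} {s' : Set ℝ} (h : D.IsParallelFrameAt χ θ y α s (r * t) φ)
    (hs : MapsTo (fun τ ↦ r * τ) s' s) :
    D.IsParallelFrameAt χ θ (r • y) (fun τ ↦ α (r * τ)) s' t φ := by
  have h1 : HasDerivWithinAt (fun τ : ℝ ↦ r * τ) r s' t := by
    simpa using ((hasDerivAt_id t).const_mul r).hasDerivWithinAt
  have h2 := HasDerivWithinAt.scomp t h h1 hs
  have e (τ : ℝ) : τ • r • y = (r * τ) • y := by rw [smul_smul, mul_comm]
  unfold IsParallelFrameAt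
  simp only [e]
  refine h2.congr_deriv ?_
  rw [map_smul, smul_mul_assoc, smul_neg]

variable (D χ) in
/-- `θ ∘ α` is a parallel frame along the ray through `y` for the times in `[0, b]`. -/
def IsParallelFrame (θ : ∀ x : M, 𝔤 ≃ₗ⁅ℝ⁆ L x) (y : EuclideanSpace ℝ (Fin n)) (α : ℝ → LieAut 𝔤)
    (b : ℝ) : Prop :=
  ∀ t ∈ Icc 0 b, ∃ φ : LieTrivialization (n := n) 𝔤 L, χ.inv (t • y) ∈ φ.base ∧
    D.IsParallelFrameAt χ θ y α (Icc 0 b) t φ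

theorem IsParallelFrame.at {b : ℝ} (h : D.IsParallelFrame χ θ y α b) (ht : t ∈ Icc 0 b)
    (hφ : χ.inv (t • y) ∈ φ.base) : D.IsParallelFrameAt χ θ y α (Icc 0 b) t φ := by
  obtain ⟨φ', hφ', h'⟩ := h t ht
  exact h'.change hφ' hφ

theorem autCLM_cancel (R a b : LieAut 𝔤) :
    Ring.inverse (autCLM R * autCLM a) * (autCLM R * autCLM b) = autCLM (a⁻¹ * b) := by
  rw [← autCLM_mul, ringInverse_autCLM, ← autCLM_mul, ← autCLM_mul]
  congr 1
  group

/-- Parallel frames with the same initial value agree. -/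
theorem IsParallelFrame.unique {b : ℝ} (h : D.IsParallelFrame χ θ y α b)
    (h' : D.IsParallelFrame χ θ y β b) (h0 : α 0 = β 0) (ht : t ∈ Icc 0 b) : α t = β t := by
  have : CompleteSpace 𝔤 := FiniteDimensional.complete ℝ 𝔤
  -- In a trivialization the two frames are solutions `P`, `Q` of the same equation, so `P⁻¹ Q` has
  -- derivative `P⁻¹ A Q - P⁻¹ A Q = 0`. This product is `α⁻¹ β`, independently of the
  -- trivialization.
  have hd : ∀ t ∈ Icc 0 b,
      HasDerivWithinAt (fun τ ↦ autCLM ((α τ)⁻¹ * β τ)) 0 (Icc 0 b) t := by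
    intro t ht
    obtain ⟨φ, hφ, h1⟩ := h t ht
    have h2 := h'.at ht hφ
    have hu : IsUnit (autCLM (relAut θ φ (χ.inv (t • y))) * autCLM (α t)) :=
      (isUnit_autCLM _).mul (isUnit_autCLM _)
    have h3 := HasDerivWithinAt.mul (hasDerivWithinAt_ringInverse h1 hu) h2
    have e : (fun τ ↦ autCLM ((α τ)⁻¹ * β τ)) =
        (fun τ ↦ Ring.inverse (autCLM (relAut θ φ (χ.inv (τ • y))) * autCLM (α τ))) *
          fun τ ↦ autCLM (relAut θ φ (χ.inv (τ • y))) * autCLM (β τ) := by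
      funext τ
      rw [Pi.mul_apply, autCLM_cancel]
    rw [e]
    refine h3.congr_deriv ?_
    generalize autCLM (relAut θ φ (χ.inv (t • y))) * autCLM (β t) = Q
    generalize hP : autCLM (relAut θ φ (χ.inv (t • y))) * autCLM (α t) = P at hu ⊢
    generalize D.coordForm φ χ (t • y) y = A
    have h5 : Ring.inverse P * (A * P) * Ring.inverse P = Ring.inverse P * A := by
      rw [mul_assoc, mul_assoc, Ring.mul_inverse_cancel _ hu, mul_one]
    rw [mul_neg (Ring.inverse P) (A * P), neg_mul _ (Ring.inverse P), neg_neg, h5]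
    noncomm_ring
  have hc := constant_of_derivWithin_zero (fun t ht ↦ (hd t ht).differentiableWithinAt) (fun t ht ↦
    (hd t (Ico_subset_Icc_self ht)).derivWithin (uniqueDiffOn_Icc (ht.1.trans_lt ht.2) t
      (Ico_subset_Icc_self ht))) t ht
  have h6 : (α t)⁻¹ * β t = 1 := by
    apply autCLM_injective
    rw [hc, h0, inv_mul_cancel]
  exact (inv_mul_eq_one.1 h6)

end LieConnection

end ParallelFrames

/-! ### Existence and smoothness of radial parallel frames -/

section RadialFrames

variable {n : ℕ} {M : Type u} [TopologicalSpace M] [ChartedSpace (EuclideanSpace ℝ (Fin n)) M]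
  [IsManifold (𝓡 n) ∞ M]
  {𝔤 : Type*} [NormedAddCommGroup 𝔤] [NormedSpace ℝ 𝔤] [FiniteDimensional ℝ 𝔤]
  [RealLieAlgebra 𝔤]
  {L : M → Type*} [∀ x, LieRing (L x)] [∀ x, LieAlgebra ℝ (L x)]
  [∀ x, TopologicalSpace (L x)] [∀ x, IsTopologicalAddGroup (L x)]
  [∀ x, ContinuousSMul ℝ (L x)]
  [TopologicalSpace (TotalSpace 𝔤 L)] [FiberBundle 𝔤 L] [VectorBundle ℝ 𝔤 L]
  [ContMDiffVectorBundle ∞ 𝔤 L (𝓡 n)]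

namespace LieConnection

variable (D : LieConnection n 𝔤 L) (χ : FullChart n M)

/-- Near `y₀` there are parallel frames for the times in `[0, b]` that depend smoothly on the ray. -/
def HasParallelFrames (θ : ∀ x : M, 𝔤 ≃ₗ⁅ℝ⁆ L x) (α₀ : LieAut 𝔤) (y₀ : EuclideanSpace ℝ (Fin n))
    (b : ℝ) : Prop :=
  ∃ W : Set (EuclideanSpace ℝ (Fin n)), IsOpen W ∧ y₀ ∈ W ∧
    ∃ α : EuclideanSpace ℝ (Fin n) → ℝ → LieAut 𝔤, ∀ y ∈ W, α y 0 = α₀ ∧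
      D.IsParallelFrame χ θ y (α y) b ∧
      ∀ φ : LieTrivialization (n := n) 𝔤 L, χ.inv (b • y) ∈ φ.base →
        ContDiffAt ℝ ∞ (fun z ↦ autCLM (relAut θ φ (χ.inv (b • z))) * autCLM (α z b)) y

variable {D χ} {θ : ∀ x : M, 𝔤 ≃ₗ⁅ℝ⁆ L x} {α₀ : LieAut 𝔤} {y₀ : EuclideanSpace ℝ (Fin n)}

/-- Over the interval `[0, 0]` the differential equation is void, since on a single point every
value is a derivative. -/
theorem hasParallelFrames_zero (hL : IsLieAlgebraBundle (n := n) 𝔤 L) :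
    D.HasParallelFrames χ θ α₀ y₀ 0 := by
  refine ⟨univ, isOpen_univ, trivial, fun _ _ ↦ α₀, fun y _ ↦ ⟨rfl, ?_, ?_⟩⟩
  · intro t ht
    obtain ⟨φ, hφ⟩ := hL (χ.inv (t • y))
    refine ⟨φ, hφ, ?_⟩
    unfold IsParallelFrameAt
    rw [Icc_self]
    exact HasFDerivWithinAt.of_subsingleton subsingleton_singleton
  · intro φ _
    simp only [zero_smul]
    exact contDiffAt_const

/-- Two derivatives, from the left and from the right, combine to one. -/
theorem IsParallelFrameAt.union {y : EuclideanSpace ℝ (Fin n)} {α : ℝ → LieAut 𝔤} {s s' : Set ℝ}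
    {t : ℝ} {φ : LieTrivialization (n := n) 𝔤 L} (h : D.IsParallelFrameAt χ θ y α s t φ)
    (h' : D.IsParallelFrameAt χ θ y α s' t φ) : D.IsParallelFrameAt χ θ y α (s ∪ s') t φ :=
  HasDerivWithinAt.union h h'

theorem IsParallelFrameAt.of_mem_nhdsWithin {y : EuclideanSpace ℝ (Fin n)} {α : ℝ → LieAut 𝔤}
    {s s' : Set ℝ} {t : ℝ} {φ : LieTrivialization (n := n) 𝔤 L}
    (h : D.IsParallelFrameAt χ θ y α s t φ) (hs : s ∈ 𝓝[s'] t) :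
    D.IsParallelFrameAt χ θ y α s' t φ :=
  HasDerivWithinAt.mono_of_mem_nhdsWithin h hs

/-- Parallel frames on `[0, a]` and on `[a, b]` combine to a parallel frame on `[0, b]`. -/
theorem IsParallelFrame.concat {y : EuclideanSpace ℝ (Fin n)} {α : ℝ → LieAut 𝔤} {a b : ℝ}
    (hab : a ≤ b) {φ : LieTrivialization (n := n) 𝔤 L}
    (hφ : ∀ t ∈ Icc a b, χ.inv (t • y) ∈ φ.base) (h : D.IsParallelFrame χ θ y α a)
    (h' : ∀ t ∈ Icc a b, D.IsParallelFrameAt χ θ y α (Icc a b) t φ) (ha : 0 ≤ a) :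
    D.IsParallelFrame χ θ y α b := by
  intro t ht
  rcases lt_trichotomy t a with hta | rfl | hta
  · obtain ⟨φ', hφ', h1⟩ := h t ⟨ht.1, hta.le⟩
    refine ⟨φ', hφ', h1.of_mem_nhdsWithin ?_⟩
    filter_upwards [self_mem_nhdsWithin, mem_nhdsWithin_of_mem_nhds (Iio_mem_nhds hta)] with τ h1 h2
    exact ⟨h1.1, le_of_lt h2⟩
  · have hmem : t ∈ Icc t b := ⟨le_rfl, hab⟩
    refine ⟨φ, hφ t hmem, ?_⟩
    have h2 := (h.at ⟨ha, le_rfl⟩ (hφ t hmem)).union (h' t hmem)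
    rwa [Icc_union_Icc_eq_Icc ha hab] at h2
  · have hmem : t ∈ Icc a b := ⟨hta.le, ht.2⟩
    refine ⟨φ, hφ t hmem, (h' t hmem).of_mem_nhdsWithin ?_⟩
    filter_upwards [self_mem_nhdsWithin, mem_nhdsWithin_of_mem_nhds (Ioi_mem_nhds hta)] with τ h1 h2
    exact ⟨le_of_lt h2, h1.2⟩

variable [T2Space M]

/-- Parallel frames can be continued over a short interval of time. -/
theorem HasParallelFrames.step {φ : LieTrivialization (n := n) 𝔤 L} {a b : ℝ} (ha : 0 ≤ a)
    (hab : a ≤ b) {A : EuclideanSpace ℝ (Fin n) → EuclideanSpace ℝ (Fin n) →L[ℝ] 𝔤 →L[ℝ] 𝔤}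
    (hA : ContDiff ℝ ∞ A) {W₀ : Set (EuclideanSpace ℝ (Fin n))} (hW₀ : IsOpen W₀) (hy₀ : y₀ ∈ W₀)
    (hφ : ∀ t ∈ Icc a b, ∀ y ∈ W₀, χ.inv (t • y) ∈ φ.base ∧ A (t • y) = D.coordForm φ χ (t • y))
    {C : ℝ} (hC0 : 0 ≤ C) (hC : ∀ t ∈ Icc a b, ∀ y ∈ W₀, ‖A (t • y) y‖ ≤ C)
    (hsmall : (b - a) * C ≤ 1 / 3) (h : D.HasParallelFrames χ θ α₀ y₀ a) :
    D.HasParallelFrames χ θ α₀ y₀ b := by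
  classical
  have : CompleteSpace 𝔤 := FiniteDimensional.complete ℝ 𝔤
  obtain ⟨W, hW, hyW, α, hα⟩ := h
  -- The equation along the ray through `y` is `P' = -A(ty) y P`. The globally smooth `A` stands in
  -- for the connection form, which is known to be smooth only over the trivialization.
  have hB : ContDiff ℝ ∞ (fun p : ℝ × EuclideanSpace ℝ (Fin n) ↦ -(A (p.1 • p.2) p.2)) :=
    ((hA.comp (contDiff_fst.smul contDiff_snd)).clm_apply contDiff_snd).neg
  obtain ⟨Y, hYa, hYu, hYd, hYs⟩ := exists_contDiffOn_fundamental_solution hB hab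
    (W := W₀) (C := C) (fun t ht y hy ↦ by rw [norm_neg]; exact hC t ht y hy) hC0 hsmall
  have hlie : ∀ y ∈ W₀, ∀ t ∈ Icc a b, ∃ c : LieAut 𝔤, autCLM c = Y y t := by
    intro y hy t ht
    refine exists_lieAut_of_isUnit (hYu y hy t ht) ?_
    refine map_lie_of_hasDerivWithinAt (B := fun t ↦ -(A (t • y) y)) (hYa y hy) (fun τ hτ ↦ ?_)
      (hYu y hy) (hYd y hy) ht
    obtain ⟨h1, h2⟩ := hφ τ hτ y hy
    rw [h2]
    exact (D.isLieDer_connForm φ h1 _).neg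
  choose! c hc using hlie
  let R (t : ℝ) (y : EuclideanSpace ℝ (Fin n)) : LieAut 𝔤 := relAut θ φ (χ.inv (t • y))
  -- After time `a` the frame is determined by `R(t) α'(t) = Y(t) R(a) α(a)`. The values of `Y` are
  -- automorphisms because the connection form consists of derivations.
  let α' : EuclideanSpace ℝ (Fin n) → ℝ → LieAut 𝔤 := fun y t ↦
    if t ≤ a then α y t else (R t y)⁻¹ * (c y t * (R a y * α y a))
  have hα'1 (y t) (ht : t ≤ a) : α' y t = α y t := if_pos ht
  have hα'2 (y) (hy : y ∈ W₀) (t) (ht : t ∈ Icc a b) :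
      α' y t = (R t y)⁻¹ * (c y t * (R a y * α y a)) := by
    by_cases h : t ≤ a
    · obtain rfl : t = a := le_antisymm h ht.1
      have h1 : c y t = 1 := autCLM_injective (by rw [hc y hy t ht, hYa y hy, autCLM_one])
      rw [hα'1 y t h, h1, one_mul, inv_mul_cancel_left]
    · exact if_neg h
  have hP (y) (hy : y ∈ W₀) (t) (ht : t ∈ Icc a b) :
      autCLM (R t y) * autCLM (α' y t) = Y y t * (autCLM (R a y) * autCLM (α y a)) := by
    rw [hα'2 y hy t ht, ← hc y hy t ht, ← autCLM_mul, ← autCLM_mul, ← autCLM_mul,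
      mul_inv_cancel_left]
  have haa : a ∈ Icc a b := ⟨le_rfl, hab⟩
  have hbb : b ∈ Icc a b := ⟨hab, le_rfl⟩
  refine ⟨W ∩ W₀, hW.inter hW₀, ⟨hyW, hy₀⟩, α', fun y ⟨hy, hy0⟩ ↦ ⟨?_, ?_, ?_⟩⟩
  · rw [hα'1 y 0 ha, (hα y hy).1]
  · refine IsParallelFrame.concat hab (fun t ht ↦ (hφ t ht y hy0).1) ?_ ?_ ha
    · intro t ht
      obtain ⟨φ', hφ', h1⟩ := (hα y hy).2.1 t ht
      exact ⟨φ', hφ', h1.congr ht fun τ hτ ↦ hα'1 y τ hτ.2⟩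
    · intro t ht
      have h1 := (hYd y hy0 t ht).mul_const (autCLM (R a y) * autCLM (α y a))
      refine (h1.congr (fun τ hτ ↦ hP y hy0 τ hτ) (hP y hy0 t ht)).congr_deriv ?_
      have h2 := hP y hy0 t ht
      change _ = -(_ * (autCLM (R t y) * autCLM (α' y t)))
      rw [h2, ← (hφ t ht y hy0).2, neg_mul, neg_mul, mul_assoc]
  · intro φ' hφ'
    have h1 := (hα y hy).2.2 φ (hφ a haa y hy0).1
    have h2 := (hYs.contDiffAt (hW₀.mem_nhds hy0)).mul h1
    have h3 := ((contDiffAt_transCLM_inv χ φ φ' (hφ b hbb y hy0).1 hφ').comp y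
      (contDiffAt_id.const_smul b)).mul h2
    refine h3.congr_of_eventuallyEq ?_
    filter_upwards [hW₀.mem_nhds hy0] with z hz
    rw [← transCLM_mul_relAut θ φ φ', mul_assoc]
    exact congrArg _ (hP z hz b hbb)

theorem exists_step (hL : IsLieAlgebraBundle (n := n) 𝔤 L) (θ : ∀ x : M, 𝔤 ≃ₗ⁅ℝ⁆ L x)
    (α₀ : LieAut 𝔤) (y₀ : EuclideanSpace ℝ (Fin n)) (t : ℝ) :
    ∃ δ > 0, ∀ a b, 0 ≤ a → a ≤ b → Icc a b ⊆ Metric.ball t δ →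
      D.HasParallelFrames χ θ α₀ y₀ a → D.HasParallelFrames χ θ α₀ y₀ b := by
  obtain ⟨φ, hφ⟩ := hL (χ.inv (t • y₀))
  obtain ⟨A, hA, hAφ⟩ := exists_contDiff_eventuallyEq
    (φ.isOpen_base.preimage χ.continuous_inv) (fun y hy ↦ D.contDiffAt_coordForm φ χ hy) hφ
  have hcont : ContinuousAt (fun p : ℝ × EuclideanSpace ℝ (Fin n) ↦ p.1 • p.2) (t, y₀) := by
    fun_prop
  have hcontA : Continuous (fun p : ℝ × EuclideanSpace ℝ (Fin n) ↦ ‖A (p.1 • p.2) p.2‖) :=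
    ((hA.continuous.comp (continuous_fst.smul continuous_snd)).clm_apply continuous_snd).norm
  set C := ‖A (t • y₀) y₀‖ + 1 with hC
  have hC0 : 0 < C := by positivity
  have hev : ∀ᶠ p in 𝓝 (t, y₀), (χ.inv (p.1 • p.2) ∈ φ.base ∧
      A (p.1 • p.2) = D.coordForm φ χ (p.1 • p.2)) ∧ ‖A (p.1 • p.2) p.2‖ < C :=
    ((hcont.eventually ((φ.isOpen_base.preimage χ.continuous_inv).mem_nhds hφ)).and
      (hcont.eventually hAφ)).and
      (hcontA.continuousAt.eventually (Iio_mem_nhds (by change ‖A (t • y₀) y₀‖ < C; linarith)))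
  obtain ⟨ε, hε, hball⟩ := Metric.eventually_nhds_iff_ball.1 hev
  -- An interval in a ball of radius `1 / (6C)` has length at most `1 / (3C)`, which is the
  -- smallness that `step` demands.
  refine ⟨min ε (1 / (6 * C)), by positivity, fun a b ha hab hsub h ↦ ?_⟩
  have hmem : ∀ τ ∈ Icc a b, ∀ y ∈ Metric.ball y₀ ε, (τ, y) ∈ Metric.ball (t, y₀) ε := by
    intro τ hτ y hy
    rw [Metric.mem_ball, Prod.dist_eq]
    exact max_lt ((Metric.mem_ball.1 (hsub hτ)).trans_le (min_le_left _ _)) (Metric.mem_ball.1 hy)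
  refine h.step (φ := φ) (A := A) (C := C) ha hab hA Metric.isOpen_ball (Metric.mem_ball_self hε)
    (fun τ hτ y hy ↦ (hball _ (hmem τ hτ y hy)).1) hC0.le
    (fun τ hτ y hy ↦ (hball _ (hmem τ hτ y hy)).2.le) ?_
  have h1 := (Metric.mem_ball.1 (hsub ⟨le_rfl, hab⟩)).trans_le (min_le_right _ _)
  have h2 := (Metric.mem_ball.1 (hsub ⟨hab, le_rfl⟩)).trans_le (min_le_right _ _)
  rw [Real.dist_eq] at h1 h2
  have h3 : b - a ≤ 1 / (6 * C) + 1 / (6 * C) := by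
    have := abs_lt.1 h1
    have := abs_lt.1 h2
    linarith
  calc (b - a) * C ≤ (1 / (6 * C) + 1 / (6 * C)) * C := by gcongr
    _ = 1 / 3 := by field_simp; norm_num

theorem hasParallelFrames_one (hL : IsLieAlgebraBundle (n := n) 𝔤 L) (θ : ∀ x : M, 𝔤 ≃ₗ⁅ℝ⁆ L x)
    (α₀ : LieAut 𝔤) (y₀ : EuclideanSpace ℝ (Fin n)) : D.HasParallelFrames χ θ α₀ y₀ 1 := by
  choose δ hδ hstep using exists_step (D := D) (χ := χ) hL θ α₀ y₀
  -- By compactness, `[0, 1]` is divided into finitely many intervals, each within one ball where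
  -- the continuation step is available.
  obtain ⟨τ, h0, hmono, ⟨m, hm⟩, hτ⟩ := exists_monotone_Icc_subset_open_cover_Icc
    (zero_le_one (α := ℝ)) (c := fun t : ℝ ↦ Subtype.val ⁻¹' Metric.ball t (δ t))
    (fun t ↦ Metric.isOpen_ball.preimage continuous_subtype_val)
    (fun t _ ↦ mem_iUnion.2 ⟨t.1, Metric.mem_ball_self (hδ t)⟩)
  have key (k : ℕ) : D.HasParallelFrames χ θ α₀ y₀ (τ k) := by
    induction k with
    | zero => rw [h0]; exact hasParallelFrames_zero hL
    | succ k ih =>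
      obtain ⟨t, ht⟩ := hτ k
      exact hstep t (τ k) (τ (k + 1)) (τ k).2.1 (hmono (Nat.le_succ k))
        (fun r hr ↦ ht (a := ⟨r, (τ k).2.1.trans hr.1, hr.2.trans (τ (k + 1)).2.2⟩) hr) ih
  have h1 := key m
  rwa [hm m le_rfl] at h1

/-- There are parallel frames along all rays, which depend smoothly on the end point. -/
theorem exists_parallelFrames (hL : IsLieAlgebraBundle (n := n) 𝔤 L) (D : LieConnection n 𝔤 L)
    (χ : FullChart n M) (θ : ∀ x : M, 𝔤 ≃ₗ⁅ℝ⁆ L x) (α₀ : LieAut 𝔤) :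
    ∃ α : EuclideanSpace ℝ (Fin n) → ℝ → LieAut 𝔤, ∀ y, α y 0 = α₀ ∧
      D.IsParallelFrame χ θ y (α y) 1 ∧
      ∀ φ : LieTrivialization (n := n) 𝔤 L, χ.inv y ∈ φ.base →
        ContDiffAt ℝ ∞ (fun z ↦ autCLM (relAut θ φ (χ.inv z)) * autCLM (α z 1)) y := by
  choose W hW hyW α hα using fun y₀ ↦ hasParallelFrames_one (D := D) (χ := χ) hL θ α₀ y₀
  -- Uniqueness makes the local families agree on overlaps, so the diagonal choice coincides near
  -- each point with one smooth family.
  refine ⟨fun y ↦ α y y, fun y ↦ ⟨(hα y y (hyW y)).1, (hα y y (hyW y)).2.1, fun φ hφ ↦ ?_⟩⟩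
  have h1 := (hα y y (hyW y)).2.2 φ (by rwa [one_smul])
  refine h1.congr_of_eventuallyEq ?_
  filter_upwards [(hW y).mem_nhds (hyW y)] with z hz
  rw [one_smul, (hα z z (hyW z)).2.1.unique (hα y z hz).2.1
    ((hα z z (hyW z)).1.trans (hα y z hz).1.symm) ⟨zero_le_one, le_rfl⟩]

/-- Along rays, parallel frames are compatible with scaling. -/
theorem parallelFrame_scale {α : EuclideanSpace ℝ (Fin n) → ℝ → LieAut 𝔤}
    (hα : ∀ y, α y 0 = α₀ ∧ D.IsParallelFrame χ θ y (α y) 1) (y : EuclideanSpace ℝ (Fin n)) {r : ℝ}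
    (hr : r ∈ Icc (0 : ℝ) 1) : α (r • y) 1 = α y r := by
  have hmaps : MapsTo (fun τ ↦ r * τ) (Icc (0 : ℝ) 1) (Icc 0 1) := fun τ hτ ↦
    ⟨mul_nonneg hr.1 hτ.1, mul_le_one₀ hr.2 hτ.1 hτ.2⟩
  have h1 : D.IsParallelFrame χ θ (r • y) (fun τ ↦ α y (r * τ)) 1 := by
    intro t ht
    obtain ⟨φ, hφ, h⟩ := (hα y).2 (r * t) (hmaps ht)
    exact ⟨φ, by rwa [smul_smul, mul_comm], h.scale hmaps⟩
  have h2 := (hα (r • y)).2.unique h1 (by rw [mul_zero, (hα _).1, (hα _).1])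
    ⟨zero_le_one, le_rfl⟩
  rwa [mul_one] at h2

end LieConnection

end RadialFrames

/-! ### One-forms in radial gauge -/

section RadialCalculus

variable {E : Type*} [NormedAddCommGroup E] [NormedSpace ℝ E]
  {V : Type*} [NormedAddCommGroup V] [NormedSpace ℝ V] [FiniteDimensional ℝ V]

/-- A radial 1-form takes values in a subspace if its differential does, contracted with the radial
field. -/
theorem Submodule.mem_of_radial (𝔥 : Submodule ℝ V) {A : E → E →L[ℝ] V}
    (hA : ∀ y, DifferentiableAt ℝ A y) (hrad : ∀ y, A y y = 0)
    (hF : ∀ y v, fderiv ℝ A y y v - fderiv ℝ A y v y ∈ 𝔥) (y v : E) : A y v ∈ 𝔥 := by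
  -- Differentiation of the gauge condition `A(z) z = 0` in the direction `v`.
  have h1 (z v : E) : fderiv ℝ A z v z = -A z v := by
    have h2 := (hA z).hasFDerivAt.clm_apply (hasFDerivAt_id z)
    have h3 : (fun y ↦ A y (id y)) = fun _ ↦ (0 : V) := funext hrad
    rw [h3] at h2
    have h4 := DFunLike.congr_fun (h2.unique (hasFDerivAt_const 0 z)) v
    simp only [add_apply, ContinuousLinearMap.flip_apply, zero_apply, id_eq,
      ContinuousLinearMap.comp_apply, ContinuousLinearMap.id_apply] at h4
    exact eq_neg_of_add_eq_zero_right h4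
  -- By `h1`, the term `A(ty) v` of the product rule becomes the second half of the differential of
  -- `A`. So the derivative lies in `𝔥`; the function is `0` at `t = 0` and `A y v` at `t = 1`.
  have hd (t : ℝ) : HasDerivAt (fun t : ℝ ↦ t • A (t • y) v)
      (fderiv ℝ A (t • y) (t • y) v - fderiv ℝ A (t • y) v (t • y)) t := by
    have hray : HasDerivAt (fun τ : ℝ ↦ τ • y) y t := by
      simpa using (hasDerivAt_id t).smul_const y
    have h2 : HasDerivAt (fun τ : ℝ ↦ A (τ • y)) (fderiv ℝ A (t • y) y) t :=
      (hA (t • y)).hasFDerivAt.comp_hasDerivAt t hray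
    have h3 : HasDerivAt (fun τ : ℝ ↦ A (τ • y) v) (fderiv ℝ A (t • y) y v) t :=
      (ContinuousLinearMap.apply ℝ V v).hasFDerivAt.comp_hasDerivAt t h2
    have h4 := (hasDerivAt_id t).smul h3
    refine h4.congr_deriv ?_
    rw [h1, map_smul, smul_apply, sub_neg_eq_add, one_smul]
    rfl
  have h5 := 𝔥.mem_of_hasDerivWithinAt_mem (f := fun t : ℝ ↦ t • A (t • y) v)
    (fun t _ ↦ (hd t).hasDerivWithinAt) (fun t _ ↦ hF _ _) (by simp)
  simpa using h5

end RadialCalculus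

/-! ### Radial trivializations and their adaptedness -/

section RadialTrivialization

variable {n : ℕ} {M : Type u} [TopologicalSpace M] [ChartedSpace (EuclideanSpace ℝ (Fin n)) M]
  [IsManifold (𝓡 n) ∞ M]
  {𝔤 : Type*} [NormedAddCommGroup 𝔤] [NormedSpace ℝ 𝔤] [FiniteDimensional ℝ 𝔤]
  [RealLieAlgebra 𝔤]
  {L : M → Type*} [∀ x, LieRing (L x)] [∀ x, LieAlgebra ℝ (L x)]
  [∀ x, TopologicalSpace (L x)] [∀ x, IsTopologicalAddGroup (L x)]
  [∀ x, ContinuousSMul ℝ (L x)]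
  [TopologicalSpace (TotalSpace 𝔤 L)] [FiberBundle 𝔤 L] [VectorBundle ℝ 𝔤 L]
  [ContMDiffVectorBundle ∞ 𝔤 L (𝓡 n)]

namespace LieConnection

variable (D : LieConnection n 𝔤 L) (χ : FullChart n M) (φ : LieTrivialization (n := n) 𝔤 L)

/-- The connection is adapted to the trivialization at a point: the connection form takes values
in the inner derivations. -/
def AdaptedAt (x : M) : Prop := ∀ X : TangentSpace (𝓡 n) x, D.connForm φ x X ∈ innerDer 𝔤

/-- The connection is adapted to the trivialization. -/
def Adapted : Prop := ∀ x ∈ φ.base, D.AdaptedAt φ x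

/-- The constant sections of the trivialization are parallel along rays. -/
def IsRadial : Prop := ∀ y, ∀ t ∈ Icc (0 : ℝ) 1, D.coordForm φ χ (t • y) y = 0

/-- The trivialization at `x` is the end value of the parallel frame along the ray to `x`, that is,
`θ(x)` after `α(χ x)(1)`. Scaling shows that it agrees with the frame at the intermediate points of
the ray too. -/
theorem exists_isRadial [T2Space M] (hL : IsLieAlgebraBundle (n := n) 𝔤 L)
    (ψ : 𝔤 ≃ₗ⁅ℝ⁆ L (χ.inv 0)) :
    ∃ φ : LieTrivialization (n := n) 𝔤 L, φ.base = χ.source ∧ φ.toEquiv (χ.inv 0) = ψ ∧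
      D.IsRadial χ φ := by
  choose φ₀ hφ₀ using hL
  let θ (x : M) : 𝔤 ≃ₗ⁅ℝ⁆ L x := (φ₀ x).toEquiv x
  let α₀ : LieAut 𝔤 := AutDelta.ofLieEquiv (ψ.trans (θ (χ.inv 0)).symm)
  obtain ⟨α, hα⟩ := exists_parallelFrames (fun x ↦ ⟨φ₀ x, hφ₀ x⟩) D χ θ α₀
  have hα2 (y) := And.intro (hα y).1 (hα y).2.1
  let φ : LieTrivialization (n := n) 𝔤 L :=
    { base := χ.source
      isOpen_base := χ.isOpen_source
      toEquiv := fun x ↦ (LieAut.toLieEquiv (α (χ.chart x) 1)).trans (θ x)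
      smooth := fun v x hx ↦ by
        refine ContMDiffAt.contMDiffWithinAt ?_
        rw [(φ₀ x).contMDiffAt_section_iff (hφ₀ x)]
        have h1 := (hα (χ.chart x)).2.2 (φ₀ x) (by rw [χ.inv_chart hx]; exact hφ₀ x)
        have h2 := (h1.clm_apply (contDiffAt_const (c := v))).contMDiffAt.comp x
          (χ.contMDiffAt_chart hx)
        refine h2.congr_of_eventuallyEq ?_
        filter_upwards [χ.isOpen_source.mem_nhds hx] with z hz
        rw [Function.comp_apply, χ.inv_chart hz]
        rfl }
  -- In the gauge `φ` the parallel frame is constantly `1`, so the equation of parallel transport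
  -- says that the connection form vanishes along the ray.
  have hrel (y) (t : ℝ) (ht : t ∈ Icc (0 : ℝ) 1) :
      autCLM (relAut θ φ (χ.inv (t • y))) * autCLM (α y t) = 1 := by
    have h1 : α (χ.chart (χ.inv (t • y))) 1 = α y t := by
      rw [χ.chart_inv, parallelFrame_scale hα2 y ht]
    ext v
    rw [mul_apply_eq_comp, autCLM_relAut_apply, ← h1]
    exact (φ.toEquiv (χ.inv (t • y))).symm_apply_apply v
  refine ⟨φ, rfl, ?_, ?_⟩
  · have h0 : α (χ.chart (χ.inv 0)) 1 = α₀ := by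
      have h := parallelFrame_scale hα2 (0 : EuclideanSpace ℝ (Fin n)) (r := 0) (by simp)
      rw [χ.chart_inv, ← (hα 0).1, ← h, smul_zero]
    ext v
    change θ (χ.inv 0) (autCLM (α (χ.chart (χ.inv 0)) 1) v) = ψ v
    rw [h0]
    exact (θ (χ.inv 0)).apply_symm_apply (ψ v)
  · intro y t ht
    have h1 := (hα y).2.1.at ht (φ := φ) (χ.inv_mem _)
    unfold IsParallelFrameAt at h1
    rw [hrel y t ht, mul_one] at h1
    have h2 : HasDerivWithinAt (fun _ : ℝ ↦ (1 : 𝔤 →L[ℝ] 𝔤))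
        (-D.coordForm φ χ (t • y) y) (Icc 0 1) t :=
      h1.congr (fun τ hτ ↦ (hrel y τ hτ).symm) (hrel y t ht).symm
    have h3 := ((uniqueDiffOn_Icc zero_lt_one) t ht).eq_deriv _ h2
      (hasDerivWithinAt_const t (Icc 0 1) 1)
    exact neg_eq_zero.1 h3

variable {D χ φ}

/-- A connection in accordance is adapted to its radial trivializations. -/
theorem IsRadial.adapted [T2Space M] (h : D.IsRadial χ φ) (hbase : φ.base = χ.source)
    (hD : D.InAccordance) : D.Adapted φ := by
  have hmem (y) : χ.inv y ∈ φ.base := by rw [hbase]; exact χ.inv_mem y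
  have h0 (y) : D.coordForm φ χ y y = 0 := by
    simpa using h y 1 ⟨zero_le_one, le_rfl⟩
  -- The gauge condition kills both products in the curvature contracted with the radial field. What
  -- is left is the differential of `A`, the quantity that `mem_of_radial` needs.
  have key := (innerDer 𝔤).mem_of_radial
    (fun y ↦ (D.contDiffAt_coordForm φ χ (hmem y)).differentiableAt (by simp)) h0 (fun y v ↦ by
      have h1 := D.curvForm_mem_innerDer φ χ hD (hmem y) y v
      rwa [curvForm, h0, zero_mul, mul_zero, sub_zero, add_zero] at h1)
  intro x hx X
  rw [hbase] at hx
  obtain ⟨y, rfl⟩ : ∃ y, χ.inv y = x := ⟨_, χ.inv_chart hx⟩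
  have h1 := key y ((mfderiv 𝓘(ℝ, EuclideanSpace ℝ (Fin n)) (𝓡 n) χ.inv y).inverse X)
  have h2 : D.connForm φ (χ.inv y)
      (mfderiv 𝓘(ℝ, EuclideanSpace ℝ (Fin n)) (𝓡 n) χ.inv y
        ((mfderiv 𝓘(ℝ, EuclideanSpace ℝ (Fin n)) (𝓡 n) χ.inv y).inverse X)) ∈ innerDer 𝔤 := h1
  rwa [(χ.isInvertible_mfderiv_inv y).self_apply_inverse] at h2

end LieConnection

end RadialTrivialization

/-! ### Parallel curves in the total space -/

section ParallelTransport

variable {n : ℕ} {M : Type u} [TopologicalSpace M] [ChartedSpace (EuclideanSpace ℝ (Fin n)) M]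
  [IsManifold (𝓡 n) ∞ M]
  {𝔤 : Type*} [NormedAddCommGroup 𝔤] [NormedSpace ℝ 𝔤] [FiniteDimensional ℝ 𝔤]
  [RealLieAlgebra 𝔤]
  {L : M → Type*} [∀ x, LieRing (L x)] [∀ x, LieAlgebra ℝ (L x)]
  [∀ x, TopologicalSpace (L x)] [∀ x, IsTopologicalAddGroup (L x)]
  [∀ x, ContinuousSMul ℝ (L x)]
  [TopologicalSpace (TotalSpace 𝔤 L)] [FiberBundle 𝔤 L] [VectorBundle ℝ 𝔤 L]
  [ContMDiffVectorBundle ∞ 𝔤 L (𝓡 n)]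

/-- The fibre coordinate of a point of the total space. -/
noncomputable def LieTrivialization.coord (φ : LieTrivialization (n := n) 𝔤 L)
    (p : TotalSpace 𝔤 L) : 𝔤 :=
  (φ.toEquiv p.proj).symm p.2

namespace LieConnection

variable (D : LieConnection n 𝔤 L) (φ : LieTrivialization (n := n) 𝔤 L)

/-- The covariant derivative of a curve, in a bundle trivialization and in a Lie trivialization. -/
theorem hasDerivWithinAt_coord_of {γ : ℝ → M} {s : ℝ → TotalSpace 𝔤 L} {t : ℝ} {J : Set ℝ}
    (ht : t ∈ J) (hγ : MDifferentiableAt 𝓘(ℝ, ℝ) (𝓡 n) γ t) (hs : ∀ τ ∈ J, (s τ).proj = γ τ)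
    (hφ : γ t ∈ φ.base) {c' : 𝔤}
    (hc : HasDerivWithinAt (fun τ ↦ (trivializationAt 𝔤 L (γ t) (s τ)).2) c' J t) :
    HasDerivWithinAt (fun τ ↦ φ.coord (s τ))
      ((φ.toEquiv (γ t)).symm ((trivializationAt 𝔤 L (γ t)).symm (γ t) c' +
        D.toFun (fun y ↦ (trivializationAt 𝔤 L (γ t)).symm y
          ((trivializationAt 𝔤 L (γ t) (s t)).2)) (γ t)
          (mfderiv 𝓘(ℝ, ℝ) (𝓡 n) γ t (1 : ℝ))) -
        D.connForm φ (γ t) (mfderiv 𝓘(ℝ, ℝ) (𝓡 n) γ t (1 : ℝ)) (φ.coord (s t))) J t := by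
  set e := trivializationAt 𝔤 L (γ t) with he
  have hb : γ t ∈ e.baseSet := mem_baseSet_trivializationAt 𝔤 L (γ t)
  -- `R` converts bundle coordinates to `φ`-coordinates. The product rule for `R (γ τ) (c τ)` and
  -- the formula `symm_toFun` for the section with constant bundle coordinate contain the same
  -- derivative of `R`, which drops out.
  set R : M → 𝔤 →L[ℝ] 𝔤 := fun y ↦ Ring.inverse (φ.comparison (γ t) y) with hR
  have hRd : MDifferentiableAt (𝓡 n) 𝓘(ℝ, 𝔤 →L[ℝ] 𝔤) R (γ t) :=
    (contMDiffAt_ringInverse (φ.contMDiffAt_comparison hφ)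
      (φ.isUnit_comparison hb)).mdifferentiableAt (by simp)
  set X := mfderiv 𝓘(ℝ, ℝ) (𝓡 n) γ t (1 : ℝ) with hX
  have hRγ : HasDerivAt (fun τ ↦ R (γ τ)) (mvfderiv (𝓡 n) R (γ t) X) t := by
    have h1 : HasFDerivAt (fun τ ↦ R (γ τ))
        ((mvfderiv (𝓡 n) R (γ t)).comp (mfderiv 𝓘(ℝ, ℝ) (𝓡 n) γ t) : ℝ →L[ℝ] 𝔤 →L[ℝ] 𝔤) t :=
      (hRd.hasMFDerivAt.comp t hγ.hasMFDerivAt).hasFDerivAt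
    exact h1.hasDerivAt
  have hcoord (p : TotalSpace 𝔤 L) (hp : p.proj ∈ e.baseSet) :
      φ.coord p = R p.proj ((e p).2) := (φ.ringInverse_comparison hp p.2).symm
  have hu (v : 𝔤) (y : M) (hy : y ∈ e.baseSet) :
      (φ.toEquiv y).symm (e.symm y v) = R y v := by
    have h1 := hcoord ⟨y, e.symm y v⟩ hy
    rw [← TotalSpace.mk', e.apply_mk_symm hy] at h1
    exact h1
  have hev (v : 𝔤) : (fun y ↦ (φ.toEquiv y).symm (e.symm y v)) =ᶠ[𝓝 (γ t)] fun y ↦ R y v := by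
    filter_upwards [e.open_baseSet.mem_nhds hb] with y hy using hu v y hy
  have hRv (v : 𝔤) : HasMFDerivAt (𝓡 n) 𝓘(ℝ, 𝔤) (fun y ↦ R y v) (γ t)
      ((ContinuousLinearMap.apply ℝ 𝔤 v).comp (mfderiv (𝓡 n) 𝓘(ℝ, 𝔤 →L[ℝ] 𝔤) R (γ t))) :=
    (ContinuousLinearMap.apply ℝ 𝔤 v).hasMFDerivAt.comp (γ t) hRd.hasMFDerivAt
  have hsec (v : 𝔤) := (φ.mdifferentiableAt_section_iff hφ (u := fun y ↦ e.symm y v)).2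
    ((hRv v).mdifferentiableAt.congr_of_eventuallyEq (hev v))
  have hst : φ.coord (s t) = R (γ t) ((e (s t)).2) := by
    have h1 := hcoord (s t) (by rw [hs t ht]; exact hb)
    rw [h1, hs t ht]
  have hK := D.symm_toFun φ hφ (hsec ((e (s t)).2)) X
  have hmv : mvfderiv (𝓡 n) (fun y ↦ (φ.toEquiv y).symm (e.symm y ((e (s t)).2))) (γ t) X =
      mvfderiv (𝓡 n) R (γ t) X ((e (s t)).2) := by
    rw [mvfderiv, ((hRv _).congr_of_eventuallyEq (hev _)).mfderiv]
    rfl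
  rw [hmv, hu _ _ hb, ← hst] at hK
  rw [← LieEquiv.coe_toLinearEquiv, map_add, LieEquiv.coe_toLinearEquiv, hK, hu _ _ hb]
  have h2 := hRγ.hasDerivWithinAt.clm_apply hc
  refine (h2.congr_of_eventuallyEq ?_ hst).congr_deriv (by abel)
  have hcont : ∀ᶠ τ in 𝓝[J] t, γ τ ∈ e.baseSet :=
    hγ.continuousAt.continuousWithinAt (e.open_baseSet.mem_nhds hb)
  filter_upwards [hcont, self_mem_nhdsWithin] with τ h1 h2
  rw [hcoord (s τ) (by rw [hs τ h2]; exact h1), hs τ h2]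

/-- The equation of parallel transport in a Lie trivialization. -/
theorem IsParallelAlong.hasDerivWithinAt_coord {D : LieConnection n 𝔤 L} {γ : ℝ → M}
    {s : ℝ → TotalSpace 𝔤 L} (h : D.IsParallelAlong γ s) {t : ℝ} (ht : t ∈ Icc (0 : ℝ) 1)
    (hγ : MDifferentiableAt 𝓘(ℝ, ℝ) (𝓡 n) γ t) (hφ : γ t ∈ φ.base) :
    HasDerivWithinAt (fun τ ↦ φ.coord (s τ))
      (-D.connForm φ (γ t) (mfderiv 𝓘(ℝ, ℝ) (𝓡 n) γ t (1 : ℝ)) (φ.coord (s t)))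
      (Icc 0 1) t := by
  obtain ⟨-, c', hc, h0⟩ := h t ht
  have h1 := D.hasDerivWithinAt_coord_of φ ht hγ (fun τ hτ ↦ (h τ hτ).1) hφ hc
  rw [h0, ← LieEquiv.coe_toLinearEquiv, map_zero, zero_sub] at h1
  exact h1

/-- The bundle coordinate is differentiable because it is `comparison` applied to the
`φ`-coordinate. The general formula for the derivative of the `φ`-coordinate, compared with the
given one, leaves the covariant derivative equal to zero. -/
theorem isParallelAlong_of {γ : ℝ → M} {s : ℝ → TotalSpace 𝔤 L}
    (hs : ∀ t ∈ Icc (0 : ℝ) 1, (s t).proj = γ t)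
    (hγ : ∀ t ∈ Icc (0 : ℝ) 1, MDifferentiableAt 𝓘(ℝ, ℝ) (𝓡 n) γ t)
    (hφ : ∀ t ∈ Icc (0 : ℝ) 1, γ t ∈ φ.base)
    (h : ∀ t ∈ Icc (0 : ℝ) 1, HasDerivWithinAt (fun τ ↦ φ.coord (s τ))
      (-D.connForm φ (γ t) (mfderiv 𝓘(ℝ, ℝ) (𝓡 n) γ t (1 : ℝ)) (φ.coord (s t))) (Icc 0 1) t) :
    D.IsParallelAlong γ s := by
  intro t ht
  refine ⟨hs t ht, ?_⟩
  set e := trivializationAt 𝔤 L (γ t) with he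
  have hb : γ t ∈ e.baseSet := mem_baseSet_trivializationAt 𝔤 L (γ t)
  have hTd := (φ.contMDiffAt_comparison (hφ t ht)).mdifferentiableAt (by simp)
  have h1 : HasFDerivAt (fun τ ↦ φ.comparison (γ t) (γ τ))
      ((mvfderiv (𝓡 n) (φ.comparison (γ t)) (γ t)).comp (mfderiv 𝓘(ℝ, ℝ) (𝓡 n) γ t) :
        ℝ →L[ℝ] 𝔤 →L[ℝ] 𝔤) t :=
    (hTd.hasMFDerivAt.comp t (hγ t ht).hasMFDerivAt).hasFDerivAt
  have h2 := h1.hasDerivAt.hasDerivWithinAt.clm_apply (h t ht)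
  have hcoord (p : TotalSpace 𝔤 L) (hp : p.proj ∈ e.baseSet) :
      (e p).2 = φ.comparison (γ t) p.proj (φ.coord p) := by
    have h3 := φ.comparison_apply hp (φ.coord p)
    rw [h3, LieTrivialization.coord, LieEquiv.apply_symm_apply]
  have hcont : ∀ᶠ τ in 𝓝[Icc (0 : ℝ) 1] t, γ τ ∈ e.baseSet :=
    (hγ t ht).continuousAt.continuousWithinAt (e.open_baseSet.mem_nhds hb)
  have h4 := h2.congr_of_eventuallyEq (f₁ := fun τ ↦ (e (s τ)).2) (by
    filter_upwards [hcont, self_mem_nhdsWithin] with τ h1 h2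
    rw [hcoord (s τ) (by rw [hs τ h2]; exact h1), hs τ h2])
    (by rw [hcoord (s t) (by rw [hs t ht]; exact hb), hs t ht])
  refine ⟨_, h4, ?_⟩
  have h5 := D.hasDerivWithinAt_coord_of φ ht (hγ t ht) hs (hφ t ht) h4
  have h6 := ((uniqueDiffOn_Icc zero_lt_one) t ht).eq_deriv _ h5 (h t ht)
  rw [sub_eq_neg_self] at h6
  refine (φ.toEquiv (γ t)).symm.injective 
    (h6.trans (map_zero (φ.toEquiv (γ t)).symm.toLinearEquiv).symm)

variable {D φ} {χ : FullChart n M}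

theorem mfderiv_ray (y : EuclideanSpace ℝ (Fin n)) (t : ℝ) :
    MDifferentiableAt 𝓘(ℝ, ℝ) (𝓡 n) (fun τ : ℝ ↦ χ.inv (τ • y)) t ∧
    mfderiv 𝓘(ℝ, ℝ) (𝓡 n) (fun τ : ℝ ↦ χ.inv (τ • y)) t (1 : ℝ) =
      mfderiv 𝓘(ℝ, EuclideanSpace ℝ (Fin n)) (𝓡 n) χ.inv (t • y) y := by
  have hray : HasFDerivAt (fun τ : ℝ ↦ τ • y) ((1 : ℝ →L[ℝ] ℝ).smulRight y) t :=
    ((1 : ℝ →L[ℝ] ℝ).smulRight y).hasFDerivAt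
  have h := (χ.mdifferentiableAt_inv (t • y)).hasMFDerivAt.comp t hray.hasMFDerivAt
  refine ⟨h.mdifferentiableAt, ?_⟩
  have h2 : mfderiv 𝓘(ℝ, ℝ) (𝓡 n) (fun τ : ℝ ↦ χ.inv (τ • y)) t = _ := h.mfderiv
  rw [h2]
  change mfderiv 𝓘(ℝ, EuclideanSpace ℝ (Fin n)) (𝓡 n) χ.inv (t • y)
    ((1 : ℝ →L[ℝ] ℝ).smulRight y (1 : ℝ)) = _
  simp

theorem IsRadial.connForm_ray (h : D.IsRadial χ φ) (y : EuclideanSpace ℝ (Fin n)) {t : ℝ}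
    (ht : t ∈ Icc (0 : ℝ) 1) :
    D.connForm φ (χ.inv (t • y))
      (mfderiv 𝓘(ℝ, ℝ) (𝓡 n) (fun τ : ℝ ↦ χ.inv (τ • y)) t (1 : ℝ)) = 0 := by
  rw [(mfderiv_ray y t).2]
  exact h y t ht

/-- The constant sections of a radial trivialization are the radial parallel transports. -/
theorem IsRadial.exists_parallel (h : D.IsRadial χ φ) (hbase : φ.base = χ.source) {x : M}
    (hx : x ∈ χ.source) (v : 𝔤) :
    ∃ s : ℝ → TotalSpace 𝔤 L, D.IsParallelAlong (fun t ↦ χ.inv (t • χ.chart x)) s ∧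
      s 0 = TotalSpace.mk' 𝔤 (χ.inv 0) (φ.toEquiv (χ.inv 0) v) ∧
      s 1 = TotalSpace.mk' 𝔤 x (φ.toEquiv x v) := by
  refine ⟨fun t ↦ TotalSpace.mk' 𝔤 (χ.inv (t • χ.chart x)) (φ.toEquiv _ v), ?_, ?_, ?_⟩
  · refine D.isParallelAlong_of φ (fun t _ ↦ rfl) (fun t _ ↦ (mfderiv_ray _ t).1)
      (fun t _ ↦ by rw [hbase]; exact χ.inv_mem _) fun t ht ↦ ?_
    rw [h.connForm_ray _ ht, zero_apply, neg_zero]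
    refine (hasDerivWithinAt_const t (Icc 0 1) v).congr (fun τ _ ↦ ?_) ?_ <;>
    exact LieEquiv.symm_apply_apply _ _
  · change TotalSpace.mk' 𝔤 (χ.inv ((0 : ℝ) • χ.chart x)) _ = _
    rw [zero_smul]
  · change TotalSpace.mk' 𝔤 (χ.inv ((1 : ℝ) • χ.chart x)) _ = _
    rw [one_smul, χ.inv_chart hx]

/-- The connection form vanishes along the ray, so the `φ`-coordinate of any parallel curve over it
is constant. This is uniqueness of radial transport. -/
theorem IsRadial.eq_of_parallel (h : D.IsRadial χ φ) (hbase : φ.base = χ.source) {x : M}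
    {v : 𝔤} {w : L x} {s : ℝ → TotalSpace 𝔤 L}
    (hs : D.IsParallelAlong (fun t ↦ χ.inv (t • χ.chart x)) s)
    (h0 : s 0 = TotalSpace.mk' 𝔤 (χ.inv 0) (φ.toEquiv (χ.inv 0) v))
    (h1 : s 1 = TotalSpace.mk' 𝔤 x w) : w = φ.toEquiv x v := by
  have hd : ∀ t ∈ Icc (0 : ℝ) 1, HasDerivWithinAt (fun τ ↦ φ.coord (s τ)) 0 (Icc 0 1) t := by
    intro t ht
    have h2 := hs.hasDerivWithinAt_coord φ ht (mfderiv_ray _ t).1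
      (by rw [hbase]; exact χ.inv_mem _)
    rwa [h.connForm_ray _ ht, zero_apply, neg_zero] at h2
  have hc := constant_of_derivWithin_zero (fun t ht ↦ (hd t ht).differentiableWithinAt) (fun t ht ↦
    (hd t (Ico_subset_Icc_self ht)).derivWithin (uniqueDiffOn_Icc zero_lt_one t
      (Ico_subset_Icc_self ht))) 1 ⟨zero_le_one, le_rfl⟩
  have e0 : φ.coord (s 0) = v := by
    rw [h0]
    exact LieEquiv.symm_apply_apply _ _
  have e1 : φ.coord (s 1) = (φ.toEquiv x).symm w := by
    rw [h1]
    rfl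
  rw [e0, e1] at hc
  rw [← hc, LieEquiv.apply_symm_apply]

end LieConnection

end ParallelTransport

/-! ### Existence of charts onto `ℝⁿ` -/

section ChartExistence

variable {n : ℕ} {M : Type u} [TopologicalSpace M] [ChartedSpace (EuclideanSpace ℝ (Fin n)) M]
  [IsManifold (𝓡 n) ∞ M]

variable (n) in
/-- Every point lies in the domain of a chart onto `ℝⁿ`. -/
theorem FullChart.exists_mem (x : M) : ∃ χ : FullChart n M, x ∈ χ.source := by
  set e := chartAt (EuclideanSpace ℝ (Fin n)) x with he
  obtain ⟨r, hr, hball⟩ := Metric.isOpen_iff.1 e.open_target (e x)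
    (e.map_source (mem_chart_source _ x))
  -- A smooth diffeomorphism from `ℝⁿ` onto a ball in the target; its inverse stretches a restricted
  -- chart onto the whole of `ℝⁿ`.
  let b : OpenPartialHomeomorph (EuclideanSpace ℝ (Fin n)) (EuclideanSpace ℝ (Fin n)) :=
    OpenPartialHomeomorph.univBall (e x) r
  have hbs : b.source = univ := OpenPartialHomeomorph.univBall_source _ _
  have hbt : b.target = Metric.ball (e x) r := OpenPartialHomeomorph.univBall_target _ hr
  have htarget : (e.trans b.symm).target = univ := by
    rw [OpenPartialHomeomorph.trans_target, OpenPartialHomeomorph.symm_target, hbs, univ_inter,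
      OpenPartialHomeomorph.symm_symm]
    refine eq_univ_of_forall fun y ↦ hball ?_
    rw [← hbt]
    exact b.map_source (by rw [hbs]; trivial)
  have hb : ContMDiff 𝓘(ℝ, EuclideanSpace ℝ (Fin n)) (𝓡 n) ∞ b :=
    OpenPartialHomeomorph.contDiff_univBall.contMDiff
  have hb' : ContMDiffOn 𝓘(ℝ, EuclideanSpace ℝ (Fin n)) (𝓡 n) ∞ b.symm b.target := by
    rw [hbt]
    exact OpenPartialHomeomorph.contDiffOn_univBall_symm.contMDiffOn
  have hmem := IsManifold.chart_mem_maximalAtlas (I := 𝓡 n) (n := ∞) x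
  refine ⟨⟨e.trans b.symm, ?_, htarget⟩, ?_⟩
  · refine OpenPartialHomeomorph.mem_maximalAtlas_of_contMDiffOn _ ?_ ?_
    · refine hb'.comp ((contMDiffOn_of_mem_maximalAtlas hmem).mono ?_) ?_
      · exact fun y hy ↦ hy.1
      · exact fun y hy ↦ hy.2
    · rw [htarget]
      refine (contMDiffOn_symm_of_mem_maximalAtlas hmem).comp hb.contMDiffOn fun y _ ↦ ?_
      exact hball (by rw [← hbt]; exact b.map_source (by rw [hbs]; trivial))
  · refine ⟨mem_chart_source _ x, ?_⟩
    change e x ∈ b.target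
    rw [hbt]
    exact Metric.mem_ball_self hr

end ChartExistence

/-! ### Continuity in `Aut^δ(𝔤)` -/

section DeltaTopology

variable {𝔤 : Type*} [NormedAddCommGroup 𝔤] [NormedSpace ℝ 𝔤] [FiniteDimensional ℝ 𝔤]
  [RealLieAlgebra 𝔤] {N : Type*} [TopologicalSpace N]

theorem continuousAt_lieAut {a : N → LieAut 𝔤} {x : N}
    (h : ContinuousAt (fun y ↦ autCLM (a y)) x) : ContinuousAt a x := by
  have : CompleteSpace 𝔤 := FiniteDimensional.complete ℝ 𝔤
  rw [Topology.IsInducing.subtypeVal.continuousAt_iff]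
  exact (Units.isOpenEmbedding_val (R := 𝔤 →L[ℝ] 𝔤)).isInducing.continuousAt_iff.2 h

/-- Continuity in `Aut^δ(𝔤)`: continuity in `Aut(𝔤)`, and the class modulo `Inn(𝔤)` is locally
constant. -/
theorem continuousAt_autDelta_iff {a : N → LieAut 𝔤} {x : N} :
    ContinuousAt (Y := AutDelta 𝔤) a x ↔
      ContinuousAt a x ∧ ∀ᶠ y in 𝓝 x, (a x)⁻¹ * a y ∈ LieInn 𝔤 := by
  -- In a discrete quotient, convergence means that the class is eventually constant.
  have h : Filter.Tendsto (fun y ↦ (QuotientGroup.mk (a y) : LieAut 𝔤 ⧸ LieInn 𝔤)) (𝓝 x)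
      (@nhds _ ⊥ (QuotientGroup.mk (a x))) ↔ ∀ᶠ y in 𝓝 x, (a x)⁻¹ * a y ∈ LieInn 𝔤 := by
    have h0 : @nhds (LieAut 𝔤 ⧸ LieInn 𝔤) ⊥ (QuotientGroup.mk (a x)) = pure (QuotientGroup.mk (a x)) :=
      congrFun (@nhds_discrete (LieAut 𝔤 ⧸ LieInn 𝔤) ⊥ (@DiscreteTopology.mk _ ⊥ rfl)) _
    rw [h0, Filter.tendsto_pure]
    refine Filter.eventually_congr (Filter.Eventually.of_forall fun y ↦ ?_)
    rw [← QuotientGroup.eq]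
    exact eq_comm
  have h2 : @nhds (AutDelta 𝔤) _ (a x) = 𝓝 (a x) ⊓
      Filter.comap (QuotientGroup.mk : LieAut 𝔤 → LieAut 𝔤 ⧸ LieInn 𝔤)
        (@nhds _ ⊥ (QuotientGroup.mk (a x))) := by
    rw [← @nhds_induced _ _ ⊥]
    exact @nhds_inf (LieAut 𝔤) _ _ (a x)
  have h3 : ContinuousAt (Y := AutDelta 𝔤) a x ↔ Filter.Tendsto a (𝓝 x) (𝓝 (a x) ⊓
      Filter.comap (QuotientGroup.mk : LieAut 𝔤 → LieAut 𝔤 ⧸ LieInn 𝔤)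
        (@nhds _ ⊥ (QuotientGroup.mk (a x)))) := by
    rw [← h2]
    rfl
  rw [h3, Filter.tendsto_inf, Filter.tendsto_comap_iff, ← h]
  rfl

end DeltaTopology

/-! ### Adapted trivializations and `δ`-compatibility -/

section AdaptedCompatible

variable {n : ℕ} {M : Type u} [TopologicalSpace M] [ChartedSpace (EuclideanSpace ℝ (Fin n)) M]
  [IsManifold (𝓡 n) ∞ M]
  {𝔤 : Type*} [NormedAddCommGroup 𝔤] [NormedSpace ℝ 𝔤] [FiniteDimensional ℝ 𝔤]
  [RealLieAlgebra 𝔤]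
  {L : M → Type*} [∀ x, LieRing (L x)] [∀ x, LieAlgebra ℝ (L x)]
  [∀ x, TopologicalSpace (L x)] [∀ x, IsTopologicalAddGroup (L x)]
  [∀ x, ContinuousSMul ℝ (L x)]
  [TopologicalSpace (TotalSpace 𝔤 L)] [FiberBundle 𝔤 L] [VectorBundle ℝ 𝔤 L]
  [ContMDiffVectorBundle ∞ 𝔤 L (𝓡 n)]
  [T2Space M]

namespace LieConnection

variable {D : LieConnection n 𝔤 L} {φ φ' : LieTrivialization (n := n) 𝔤 L}

theorem hasFDerivAt_transition (χ : FullChart n M) {y : EuclideanSpace ℝ (Fin n)}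
    (hy : χ.inv y ∈ φ.base) (hy' : χ.inv y ∈ φ'.base) :
    HasFDerivAt (fun z ↦ autCLM (φ.transition φ' (χ.inv z) : LieAut 𝔤))
      (fderiv ℝ (fun z ↦ φ.transCLM φ' (χ.inv z)) y) y :=
  ((contDiffAt_transCLM_inv χ φ φ' hy hy').differentiableAt (by simp)).hasFDerivAt

theorem continuousAt_transCLM {x : M} (hx : x ∈ φ.base) (hx' : x ∈ φ'.base) :
    ContinuousAt (fun y ↦ autCLM (φ.transition φ' y : LieAut 𝔤)) x :=
  (φ.contMDiffAt_transCLM φ' hx hx').continuousAt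

/-- Trivializations to which a connection is adapted are `δ`-compatible. -/
theorem Adapted.deltaCompatible (h : D.Adapted φ) (h' : D.Adapted φ') : φ.DeltaCompatible φ' := by
  rintro x ⟨hx, hx'⟩
  refine ContinuousAt.continuousWithinAt (continuousAt_autDelta_iff (a := φ.transition φ') |>.2
    ⟨continuousAt_lieAut (continuousAt_transCLM hx hx'), ?_⟩)
  obtain ⟨χ, hχ⟩ := FullChart.exists_mem n x
  obtain ⟨y₀, rfl⟩ : ∃ y, χ.inv y = x := ⟨_, χ.inv_chart hχ⟩
  have hmem : ∀ᶠ y in 𝓝 y₀, χ.inv y ∈ φ.base ∩ φ'.base :=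
    χ.continuous_inv.continuousAt ((φ.isOpen_base.inter φ'.isOpen_base).mem_nhds ⟨hx, hx'⟩)
  have key : ∀ᶠ y in 𝓝 y₀, ((φ.transition φ' (χ.inv y₀) : LieAut 𝔤)⁻¹ *
      (φ.transition φ' (χ.inv y) : LieAut 𝔤) : LieAut 𝔤) ∈ LieInn 𝔤 := by
    refine eventually_inv_mul_mem_lieInn (α := fun y ↦ (φ.transition φ' (χ.inv y) : LieAut 𝔤)) ?_
    filter_upwards [hmem] with y hy
    refine ⟨_, hasFDerivAt_transition χ hy.1 hy.2, fun v ↦ ?_⟩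
    set a : LieAut 𝔤 := φ.transition φ' (χ.inv y)
    -- The change of gauge `A' a = a A - da`, solved for the logarithmic derivative: `a⁻¹ da = A -
    -- a⁻¹ A' a`.
    refine ⟨D.coordForm φ χ y v - autCLM a⁻¹ * D.coordForm φ' χ y v * autCLM a,
      Submodule.sub_mem _ (h _ hy.1 _) (conj_mem_innerDer a (h' _ hy.2 _)), ?_⟩
    have h1 := D.coordForm_mul_transCLM χ φ φ' hy.1 hy.2 v
    have h2 : fderiv ℝ (fun z ↦ φ.transCLM φ' (χ.inv z)) y v =
        autCLM a * D.coordForm φ χ y v - D.coordForm φ' χ y v * autCLM a := by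
      change D.coordForm φ' χ y v * autCLM a = autCLM a * D.coordForm φ χ y v - _ at h1
      rw [h1, sub_sub_cancel]
    rw [h2, mul_sub, ← mul_assoc, ← mul_assoc, autCLM_mul_inv, one_mul]
  have hc : ContinuousAt χ.chart (χ.inv y₀) := (χ.contMDiffAt_chart hχ).continuousAt
  have hc2 : Filter.Tendsto χ.chart (𝓝 (χ.inv y₀)) (𝓝 y₀) := by
    have := hc.tendsto
    rwa [χ.chart_inv] at this
  filter_upwards [hc2.eventually key, χ.isOpen_source.mem_nhds hχ] with z hz hz2
  rwa [χ.inv_chart hz2] at hz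

/-- The logarithmic derivative of a transition function of `δ`-compatible trivializations. -/
theorem inv_mul_fderiv_mem_of_deltaCompatible (hc : φ.DeltaCompatible φ') (χ : FullChart n M)
    {y : EuclideanSpace ℝ (Fin n)} (hy : χ.inv y ∈ φ.base) (hy' : χ.inv y ∈ φ'.base)
    (v : EuclideanSpace ℝ (Fin n)) :
    autCLM (φ.transition φ' (χ.inv y) : LieAut 𝔤)⁻¹ *
      fderiv ℝ (fun z ↦ φ.transCLM φ' (χ.inv z)) y v ∈ innerDer 𝔤 := by
  have ho := (φ.isOpen_base.inter φ'.isOpen_base).mem_nhds ⟨hy, hy'⟩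
  have hmem : ∀ᶠ y in 𝓝 y, χ.inv y ∈ φ.base ∩ φ'.base := χ.continuous_inv.continuousAt ho
  have h1 := (continuousAt_autDelta_iff.1 (hc.continuousAt ho)).2
  have h2 := χ.continuous_inv.continuousAt.eventually h1
  refine fderiv_mem_of_eventually_inv_mul_mem_lieInn
    (α := fun y ↦ (φ.transition φ' (χ.inv y) : LieAut 𝔤)) (hasFDerivAt_transition χ hy hy')
    ?_ h2 v
  filter_upwards [hmem] with y hy
  exact (hasFDerivAt_transition χ hy.1 hy.2).continuousAt

/-- A trivialization that is `δ`-compatible with one to which the connection is adapted. -/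
theorem Adapted.adaptedAt_of_deltaCompatible (h : D.Adapted φ) (hc : φ.DeltaCompatible φ') {x : M}
    (hx : x ∈ φ.base) (hx' : x ∈ φ'.base) : D.AdaptedAt φ' x := by
  obtain ⟨χ, hχ⟩ := FullChart.exists_mem n x
  obtain ⟨y₀, rfl⟩ : ∃ y, χ.inv y = x := ⟨_, χ.inv_chart hχ⟩
  intro X
  set v := (mfderiv 𝓘(ℝ, EuclideanSpace ℝ (Fin n)) (𝓡 n) χ.inv y₀).inverse X with hv
  have hX : mfderiv 𝓘(ℝ, EuclideanSpace ℝ (Fin n)) (𝓡 n) χ.inv y₀ v = X :=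
    (χ.isInvertible_mfderiv_inv y₀).self_apply_inverse X
  set a : LieAut 𝔤 := φ.transition φ' (χ.inv y₀) with ha
  have h3 := inv_mul_fderiv_mem_of_deltaCompatible hc χ hx hx' v
  have h4 := D.coordForm_mul_transCLM χ φ φ' hx hx' v
  change D.coordForm φ' χ y₀ v * autCLM a = autCLM a * D.coordForm φ χ y₀ v - _ at h4
  -- The same identity solved for `A' = a (A - a⁻¹ da) a⁻¹`; the double inverse puts it in the shape
  -- of `conj_mem_innerDer`.
  have h5 : D.coordForm φ' χ y₀ v = autCLM (a⁻¹)⁻¹ * (D.coordForm φ χ y₀ v -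
      autCLM a⁻¹ * fderiv ℝ (fun z ↦ φ.transCLM φ' (χ.inv z)) y₀ v) * autCLM a⁻¹ := by
    rw [inv_inv, mul_sub, ← mul_assoc (autCLM a) (autCLM a⁻¹), autCLM_mul_inv, one_mul, ← h4,
      mul_assoc, autCLM_mul_inv, mul_one]
  have h6 : D.coordForm φ' χ y₀ v ∈ innerDer 𝔤 := by
    rw [h5]
    refine conj_mem_innerDer a⁻¹ (Submodule.sub_mem _ ?_ h3)
    exact h _ hx _
  rw [← hX]
  exact h6

theorem connForm_of_rel {D D' : AccordantConnection n 𝔤 L} {l : ∀ x : M, TangentSpace (𝓡 n) x →ₗ[ℝ] L x}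
    (hl : ∀ u : (∀ x : M, L x), IsSmoothSection n 𝔤 u → ∀ (x : M) (X : TangentSpace (𝓡 n) x),
      D'.1.toFun u x X = D.1.toFun u x X + ⁅l x X, u x⁆) {x : M} (hx : x ∈ φ.base)
    (X : TangentSpace (𝓡 n) x) :
    D'.1.connForm φ x X = D.1.connForm φ x X + adLinear 𝔤 ((φ.toEquiv x).symm (l x X)) := by
  ext v
  obtain ⟨u, hu, huv⟩ := exists_contMDiff_section_eventuallyEq φ.isOpen_base (φ.smooth v) hx
  have hs := (φ.contMDiffAt_sec v hx).mdifferentiableAt (n := ∞) (by simp)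
  have e (D : LieConnection n 𝔤 L) : D.toFun (φ.sec v) x = D.toFun u x :=
    D.toFun_congr hs ((hu x).mdifferentiableAt (by simp)) (huv.mono fun _ h ↦ h.symm)
  rw [add_apply, D'.1.connForm_eq φ hx, D.1.connForm_eq φ hx, e, e, hl u hu x X,
    huv.self_of_nhds, ← LieEquiv.coe_toLinearEquiv, map_add, LieEquiv.coe_toLinearEquiv,
    LieEquiv.map_lie, LieEquiv.symm_apply_apply, adLinear_apply]

/-- Equivalent connections are adapted to the same trivializations. -/
theorem Adapted.of_rel {D D' : AccordantConnection n 𝔤 L} (h : D.1.Adapted φ) (hr : D.Rel D') :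
    D'.1.Adapted φ := by
  obtain ⟨l, -, hl⟩ := hr
  intro x hx X
  rw [connForm_of_rel hl hx]
  exact Submodule.add_mem _ (h x hx X) (adLinear_mem _)

end LieConnection

end AdaptedCompatible

/-! ### Gluing sections and alternating maps -/

section SectionGluing

variable {n : ℕ} {M : Type u} [TopologicalSpace M]
  [ChartedSpace (EuclideanSpace ℝ (Fin n)) M]
  {F : Type*} [NormedAddCommGroup F] [NormedSpace ℝ F]
  {V : M → Type*} [∀ x, AddCommGroup (V x)] [∀ x, Module ℝ (V x)] [∀ x, TopologicalSpace (V x)]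
  [TopologicalSpace (TotalSpace F V)] [FiberBundle F V] [VectorBundle ℝ F V]

theorem SmoothPartitionOfUnity.sum_finsupport_smul_eq {ι : Type*} {A : Type*} [AddCommGroup A]
    [Module ℝ A] (H : SmoothPartitionOfUnity ι (𝓡 n) M univ) {x : M} {t : Finset ι}
    (ht : H.finsupport x ⊆ t) (a : ι → A) :
    ∑ i ∈ H.finsupport x, H i x • a i = ∑ i ∈ t, H i x • a i := by
  refine Finset.sum_subset ht fun i _ hi ↦ ?_
  rw [SmoothPartitionOfUnity.mem_finsupport, Function.mem_support, not_not] at hi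
  rw [hi, zero_smul]

theorem SmoothPartitionOfUnity.sum_finsupport_smul_of_eq {ι : Type*} {A : Type*} [AddCommGroup A]
    [Module ℝ A] (H : SmoothPartitionOfUnity ι (𝓡 n) M univ) {x : M} {a : A} {b : ι → A}
    (h : ∀ i ∈ H.finsupport x, a = b i) : a = ∑ i ∈ H.finsupport x, H i x • b i := by
  rw [← Finset.sum_congr rfl fun i hi ↦ congrArg (H i x • ·) (h i hi), ← Finset.sum_smul,
    H.sum_finsupport x (mem_univ x), one_smul]

/-- Local smooth sections glue by a subordinate partition of unity. -/
theorem SmoothPartitionOfUnity.IsSubordinate.contMDiff_sum_section {ι : Type*}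
    {H : SmoothPartitionOfUnity ι (𝓡 n) M univ} {U : ι → Set M} (hH : H.IsSubordinate U)
    {s : ι → ∀ x, V x}
    (hs : ∀ i, ∀ x ∈ U i, ContMDiffAt (𝓡 n) ((𝓡 n).prod 𝓘(ℝ, F)) ∞
      (fun x ↦ TotalSpace.mk' F x (s i x)) x) :
    ContMDiff (𝓡 n) ((𝓡 n).prod 𝓘(ℝ, F)) ∞
      (fun x ↦ TotalSpace.mk' F x (∑ i ∈ H.finsupport x, H i x • s i x)) := by
  intro x
  have h1 : ContMDiffAt (𝓡 n) ((𝓡 n).prod 𝓘(ℝ, F)) ∞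
      (fun y ↦ TotalSpace.mk' F y (∑ i ∈ H.fintsupport x, ((H i : M → ℝ) • s i) y)) x :=
    ContMDiffAt.sum_section fun i hi ↦ ContMDiffAt.smul_section ((H i).contMDiff x)
      (hs i x (hH i ((H.mem_fintsupport_iff x i).1 hi)))
  refine h1.congr_of_eventuallyEq ?_
  filter_upwards [H.eventually_finsupport_subset x] with y hy
  congr 1
  exact H.sum_finsupport_smul_eq hy fun i ↦ s i y

theorem AlternatingMap.finset_sum_apply {ι κ : Type*} {A B : Type*} [AddCommGroup A] [Module ℝ A]
    [AddCommGroup B] [Module ℝ B] (t : Finset κ) (f : κ → A [⋀^ι]→ₗ[ℝ] B) (m : ι → A) :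
    (∑ k ∈ t, f k) m = ∑ k ∈ t, f k m := by
  classical
  induction t using Finset.induction_on with
  | empty => simp
  | insert k t hk ih => rw [Finset.sum_insert hk, Finset.sum_insert hk, AlternatingMap.add_apply, ih]

/-- An alternating bilinear function as an alternating map. -/
def AlternatingMap.ofBilin {A B : Type*} [AddCommGroup A] [Module ℝ A]
    [AddCommGroup B] [Module ℝ B] (b : A → A → B) (hadd : ∀ v v' w, b (v + v') w = b v w + b v' w)
    (hsmul : ∀ (c : ℝ) v w, b (c • v) w = c • b v w) (hswap : ∀ v w, b v w = -b w v)
    (hself : ∀ v, b v v = 0) : A [⋀^Fin 2]→ₗ[ℝ] B where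
  toFun m := b (m 0) (m 1)
  map_update_add' {inst} m i v w := by
    obtain rfl : inst = instDecidableEqFin 2 := Subsingleton.elim _ _
    fin_cases i
    · simpa using hadd _ _ _
    · simp only [Fin.mk_one, Function.update_self]
      rw [hswap, hswap _ v, hswap _ w]
      simp [hadd, add_comm]
  map_update_smul' {inst} m i c v := by
    obtain rfl : inst = instDecidableEqFin 2 := Subsingleton.elim _ _
    fin_cases i
    · simpa using hsmul _ _ _
    · simp only [Fin.mk_one, Function.update_self]
      rw [hswap, hswap _ v]
      simp [hsmul]
  map_eq_zero_of_eq' m i j hm hij := by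
    have h : m 0 = m 1 := by
      fin_cases i <;> fin_cases j
      exacts [absurd rfl hij, hm, hm.symm, absurd rfl hij]
    rw [h, hself]

end SectionGluing

/-! ### Regularity of curvature forms -/

section CurvatureRegularity

variable {E : Type*} [NormedAddCommGroup E] [NormedSpace ℝ E]
  {G : Type*} [NormedAddCommGroup G] [NormedSpace ℝ G]

theorem Submodule.fderiv_apply_mem_of_eventually [FiniteDimensional ℝ G] (𝔥 : Submodule ℝ G)
    {A : E → E →L[ℝ] G} {y : E} (hA : DifferentiableAt ℝ A y) {w : E}
    (h : ∀ᶠ z in 𝓝 y, A z w ∈ 𝔥) (v : E) : fderiv ℝ A y v w ∈ 𝔥 := by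
  have h1 := Submodule.fderiv_mem_of_eventually 𝔥
    (hA.hasFDerivAt.clm_apply (hasFDerivAt_const w y)) h v
  simpa using h1

theorem ContDiffAt.fderiv_of_infty {A : E → G} {y : E} (hA : ContDiffAt ℝ ∞ A y) :
    ContDiffAt ℝ ∞ (fderiv ℝ A) y := hA.fderiv_right (by simp)

set_option synthInstance.maxHeartbeats 200000 in
theorem contDiffAt_curvForm {A : E → E →L[ℝ] G →L[ℝ] G} {X Y : E → E} {y : E}
    (hA : ContDiffAt ℝ ∞ A y) (hX : ContDiffAt ℝ ∞ X y) (hY : ContDiffAt ℝ ∞ Y y) :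
    ContDiffAt ℝ ∞ (fun z ↦ curvForm A z (X z) (Y z)) y := by
  have hA' := hA.fderiv_of_infty
  exact (((hA'.clm_apply hX).clm_apply hY).sub ((hA'.clm_apply hY).clm_apply hX)).add
    (((hA.clm_apply hX).clm_comp (hA.clm_apply hY)).sub
      ((hA.clm_apply hY).clm_comp (hA.clm_apply hX)))

end CurvatureRegularity

/-! ### Constructing `l` and `Ω` from inner-derivation-valued forms -/

section Gluing

variable {n : ℕ} {M : Type u} [TopologicalSpace M] [ChartedSpace (EuclideanSpace ℝ (Fin n)) M]
  [IsManifold (𝓡 n) ∞ M]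
  {𝔤 : Type*} [NormedAddCommGroup 𝔤] [NormedSpace ℝ 𝔤] [FiniteDimensional ℝ 𝔤]
  [RealLieAlgebra 𝔤]
  {L : M → Type*} [∀ x, LieRing (L x)] [∀ x, LieAlgebra ℝ (L x)]
  [∀ x, TopologicalSpace (L x)] [∀ x, IsTopologicalAddGroup (L x)]
  [∀ x, ContinuousSMul ℝ (L x)]
  [TopologicalSpace (TotalSpace 𝔤 L)] [FiberBundle 𝔤 L] [VectorBundle ℝ 𝔤 L]
  [ContMDiffVectorBundle ∞ 𝔤 L (𝓡 n)]
  [T2Space M] [SigmaCompactSpace M]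

/-- Connections adapted to a common covering family of trivializations are equivalent. -/
theorem AccordantConnection.rel_of_adapted {ι : Type*} {D D' : AccordantConnection n 𝔤 L}
    {φ : ι → LieTrivialization (n := n) 𝔤 L} (hφ : ∀ x, ∃ i, x ∈ (φ i).base)
    (h : ∀ i, D.1.Adapted (φ i)) (h' : ∀ i, D'.1.Adapted (φ i)) : D.Rel D' := by
  obtain ⟨H, hH⟩ := SmoothPartitionOfUnity.exists_isSubordinate (𝓡 n) isClosed_univ
    (fun i ↦ (φ i).base) (fun i ↦ (φ i).isOpen_base) (fun x _ ↦ mem_iUnion.2 (hφ x))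
  obtain ⟨σ, hσ⟩ := exists_innerDer_section 𝔤
  have hmem {i x} (hi : i ∈ H.finsupport x) : x ∈ (φ i).base :=
    hH i (subset_tsupport _ ((H.mem_finsupport x).1 hi))
  -- The difference of the connection forms lies in `ad 𝔤`, and `σ` picks a preimage under `ad`,
  -- determined only modulo the centre. Linearity of `σ` makes `l i` linear in the vector and
  -- smooth.
  let l (i : ι) (x : M) : TangentSpace (𝓡 n) x →ₗ[ℝ] L x :=
    (((φ i).toEquiv x).toLinearEquiv.toLinearMap ∘ₗ σ.toLinearMap) ∘ₗ
      (D'.1.connForm (φ i) x - D.1.connForm (φ i) x)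
  have hl (i : ι) (x : M) (X : TangentSpace (𝓡 n) x) : l i x X = (φ i).toEquiv x
      (σ (D'.1.connForm (φ i) x X - D.1.connForm (φ i) x X)) := rfl
  refine ⟨fun x ↦ ∑ i ∈ H.finsupport x, H i x • l i x, fun X hX ↦ ?_, fun u hu x X ↦ ?_⟩
  · have h1 := hH.contMDiff_sum_section (F := 𝔤) (s := fun i x ↦ l i x (X x)) (fun i x hx ↦ by
      rw [(φ i).contMDiffAt_section_iff hx]
      simp only [hl, LieEquiv.symm_apply_apply]
      exact σ.contMDiff.contMDiffAt.comp x ((D'.1.contMDiffAt_connForm (φ i) hx (hX x)).sub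
        (D.1.contMDiffAt_connForm (φ i) hx (hX x))))
    simpa only [IsSmoothSection, LinearMap.sum_apply, LinearMap.smul_apply] using h1
  -- Each `l i` with nonzero weight at `x` satisfies the required relation there; as the weights sum
  -- to one, so does their average, whatever the central ambiguity.
  · have h1 (i) (hi : i ∈ H.finsupport x) :
        D'.1.toFun u x X = D.1.toFun u x X + ⁅l i x X, u x⁆ := by
      have hx := hmem hi
      have hu' := (hu x).mdifferentiableAt (by simp)
      apply ((φ i).toEquiv x).symm.injective
      change ((φ i).toEquiv x).symm _ = ((φ i).toEquiv x).symm _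
      have e := hσ _ (Submodule.sub_mem _ (h' i x hx X) (h i x hx X))
      rw [D'.1.symm_toFun (φ i) hx hu' X, ← LieEquiv.coe_toLinearEquiv, map_add,
        LieEquiv.coe_toLinearEquiv, D.1.symm_toFun (φ i) hx hu' X, LieEquiv.map_lie, hl,
        LieEquiv.symm_apply_apply, ← adLinear_apply, e, sub_apply]
      abel
    rw [← sub_eq_iff_eq_add', LinearMap.sum_apply, sum_lie]
    refine (H.sum_finsupport_smul_of_eq (b := fun i ↦ ⁅l i x X, u x⁆) fun i hi ↦ ?_).trans
      (Finset.sum_congr rfl fun i _ ↦ ?_)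
    · rw [h1 i hi, add_sub_cancel_left]
    · rw [LinearMap.smul_apply, smul_lie]

theorem commutator_mem_innerDer {S T : 𝔤 →L[ℝ] 𝔤} (hS : S ∈ innerDer 𝔤) (hT : T ∈ innerDer 𝔤) :
    S * T - T * S ∈ innerDer 𝔤 := by
  obtain ⟨u, rfl⟩ := mem_innerDer.1 hS
  obtain ⟨v, rfl⟩ := mem_innerDer.1 hT
  refine mem_innerDer.2 ⟨⁅u, v⁆, ?_⟩
  ext w
  rw [sub_apply, mul_apply_eq_comp, mul_apply_eq_comp]
  simp only [adLinear_apply]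
  exact lie_lie u v w

/-- A subspace contains the derivatives of maps with values in it, and `ad 𝔤` is closed under
commutators. -/
theorem curvForm_mem_innerDer_of_eventually {E : Type*} [NormedAddCommGroup E] [NormedSpace ℝ E]
    {A : E → E →L[ℝ] 𝔤 →L[ℝ] 𝔤} {y : E} (hA : DifferentiableAt ℝ A y)
    (h : ∀ᶠ z in 𝓝 y, ∀ v, A z v ∈ innerDer 𝔤) (v w : E) :
    curvForm A y v w ∈ innerDer 𝔤 := by
  have h1 (v w : E) : fderiv ℝ A y v w ∈ innerDer 𝔤 :=
    Submodule.fderiv_apply_mem_of_eventually _ hA (h.mono fun z hz ↦ hz w) v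
  exact Submodule.add_mem _ (Submodule.sub_mem _ (h1 v w) (h1 w v))
    (commutator_mem_innerDer (h.self_of_nhds v) (h.self_of_nhds w))

namespace LieConnection

/-- A connection adapted to trivializations near every point is in accordance with `Aut^δ(𝔤)`. -/
theorem inAccordance_of_adapted {D : LieConnection n 𝔤 L}
    (h : ∀ x, ∃ φ : LieTrivialization (n := n) 𝔤 L, x ∈ φ.base ∧ D.Adapted φ) :
    D.InAccordance := by
  choose φ hφ hD using h
  choose χ hχ using fun x : M ↦ FullChart.exists_mem n x
  obtain ⟨σ, hσ⟩ := exists_innerDer_section 𝔤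
  obtain ⟨H, hH⟩ := SmoothPartitionOfUnity.exists_isSubordinate (𝓡 n) isClosed_univ
    (fun p ↦ (χ p).source ∩ (φ p).base)
    (fun p ↦ (χ p).isOpen_source.inter (φ p).isOpen_base)
    (fun x _ ↦ mem_iUnion.2 ⟨x, hχ x, hφ x⟩)
  have hmem {p x} (hp : p ∈ H.finsupport x) : x ∈ (χ p).source ∩ (φ p).base :=
    hH p (subset_tsupport _ ((H.mem_finsupport x).1 hp))
  let J (p x : M) : EuclideanSpace ℝ (Fin n) →L[ℝ] EuclideanSpace ℝ (Fin n) :=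
    (mfderiv 𝓘(ℝ, EuclideanSpace ℝ (Fin n)) (𝓡 n) (χ p).inv ((χ p).chart x)).inverse
  have hJ (p) (X : ∀ x : M, TangentSpace (𝓡 n) x) {x} (hx : x ∈ (χ p).source) :
      J p x (X x) = (χ p).comp X ((χ p).chart x) := by
    obtain ⟨y, rfl⟩ : ∃ y, (χ p).inv y = x := ⟨_, (χ p).inv_chart hx⟩
    have h1 (y') (hy' : y' = y) : (mfderiv 𝓘(ℝ, EuclideanSpace ℝ (Fin n)) (𝓡 n) (χ p).inv y').inverse
        (X ((χ p).inv y)) = (χ p).comp X y' := by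
      subst hy'
      rfl
    exact h1 _ ((χ p).chart_inv y)
  -- The coordinate curvature, with the differential of the chart applied to its arguments. It takes
  -- values in `ad 𝔤` over the common domain, so `σ` turns it into a local 2-form with values in
  -- `L`.
  let C (p x : M) (v w : EuclideanSpace ℝ (Fin n)) : 𝔤 →L[ℝ] 𝔤 :=
    curvForm (D.coordForm (φ p) (χ p)) ((χ p).chart x) (J p x v) (J p x w)
  let lin (p x : M) : (𝔤 →L[ℝ] 𝔤) →ₗ[ℝ] L x :=
    ((φ p).toEquiv x).toLinearEquiv.toLinearMap ∘ₗ σ.toLinearMap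
  let Ω (p x : M) : (TangentSpace (𝓡 n) x) [⋀^Fin 2]→ₗ[ℝ] L x :=
    AlternatingMap.ofBilin (fun v w ↦ lin p x (C p x v w))
      (fun v v' w ↦ by
        rw [← map_add]
        exact congrArg _ ((congrArg (fun z ↦ curvForm _ _ z _) (map_add (J p x) v v')).trans
          (curvForm_add_left _ _ _ _ _)))
      (fun c v w ↦ by
        rw [← map_smul]
        exact congrArg _ ((congrArg (fun z ↦ curvForm _ _ z _) (map_smul (J p x) c v)).trans
          (curvForm_smul_left _ _ _ _ _)))
      (fun v w ↦ by
        rw [← map_neg]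
        exact congrArg _ (curvForm_swap _ _ _ _))
      (fun v ↦ by
        rw [← map_zero (lin p x)]
        exact congrArg _ (curvForm_self _ _ _))
  have hΩ (p x : M) (v w : TangentSpace (𝓡 n) x) :
      Ω p x ![v, w] = (φ p).toEquiv x (σ (C p x v w)) := rfl
  have hsum (X Y : ∀ x : M, TangentSpace (𝓡 n) x) (x : M) :
      (∑ p ∈ H.finsupport x, H p x • Ω p x) ![X x, Y x] =
        ∑ p ∈ H.finsupport x, H p x • Ω p x ![X x, Y x] := by
    rw [AlternatingMap.finset_sum_apply]
    rfl
  refine ⟨fun x ↦ ∑ p ∈ H.finsupport x, H p x • Ω p x, fun X Y hX hY ↦ ?_,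
    fun X Y u hX hY hu x ↦ ?_⟩
  · have h1 := hH.contMDiff_sum_section (F := 𝔤) (s := fun p x ↦ Ω p x ![X x, Y x])
      (fun p x hx ↦ by
        rw [(φ p).contMDiffAt_section_iff hx.2]
        simp only [hΩ, LieEquiv.symm_apply_apply]
        refine σ.contMDiff.contMDiffAt.comp x ?_
        have hy : (χ p).inv ((χ p).chart x) ∈ (φ p).base := by
          rw [(χ p).inv_chart hx.1]; exact hx.2
        have hA := D.contDiffAt_coordForm (φ p) (χ p) hy
        have hX' := (χ p).contDiffAt_comp (hX _ : ContMDiffAt _ _ _ _ ((χ p).inv ((χ p).chart x)))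
        have hY' := (χ p).contDiffAt_comp (hY _ : ContMDiffAt _ _ _ _ ((χ p).inv ((χ p).chart x)))
        have h2 := contDiffAt_curvForm hA hX' hY'
        refine (h2.contMDiffAt.comp x ((χ p).contMDiffAt_chart hx.1)).congr_of_eventuallyEq ?_
        filter_upwards [(χ p).isOpen_source.mem_nhds hx.1] with z hz
        simp only [C, Function.comp, hJ p X hz, hJ p Y hz])
    simpa only [IsSmoothSection, hsum] using h1
  · have h1 (p) (hp : p ∈ H.finsupport x) : D.curvature X Y u x = ⁅Ω p x ![X x, Y x], u x⁆ := by
      obtain ⟨hx, hx'⟩ := hmem hp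
      apply ((φ p).toEquiv x).symm.injective
      change ((φ p).toEquiv x).symm _ = ((φ p).toEquiv x).symm _
      rw [LieEquiv.map_lie, hΩ, LieEquiv.symm_apply_apply, ← adLinear_apply]
      simp only [C, hJ p X hx, hJ p Y hx]
      obtain ⟨y, rfl⟩ : ∃ y, (χ p).inv y = x := ⟨_, (χ p).inv_chart hx⟩
      rw [(χ p).chart_inv, hσ, D.symm_curvature (φ p) (χ p) hx' hX hY hu]
      refine curvForm_mem_innerDer_of_eventually
        ((D.contDiffAt_coordForm (φ p) (χ p) hx').differentiableAt (by simp)) ?_ _ _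
      filter_upwards [(χ p).continuous_inv.continuousAt ((φ p).isOpen_base.mem_nhds hx')]
        with z hz v
      exact hD p _ hz _
    rw [hsum, sum_lie]
    refine (H.sum_finsupport_smul_of_eq h1).trans (Finset.sum_congr rfl fun p _ ↦ ?_)
    rw [smul_lie]

end LieConnection

end Gluing

/-! ### The flat connection of a trivialization -/

section FlatDerivative

variable {n : ℕ} {M : Type u} [TopologicalSpace M] [ChartedSpace (EuclideanSpace ℝ (Fin n)) M]
  [IsManifold (𝓡 n) ∞ M]

theorem FullChart.mvfderiv_mfderiv_inv {F : Type*} [NormedAddCommGroup F] [NormedSpace ℝ F]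
    (χ : FullChart n M) {c : M → F} {y : EuclideanSpace ℝ (Fin n)}
    (hc : MDifferentiableAt (𝓡 n) 𝓘(ℝ, F) c (χ.inv y)) (e : EuclideanSpace ℝ (Fin n)) :
    mvfderiv (𝓡 n) c (χ.inv y) (mfderiv 𝓘(ℝ, EuclideanSpace ℝ (Fin n)) (𝓡 n) χ.inv y e) =
      fderiv ℝ (fun z ↦ c (χ.inv z)) y e := by
  have h : HasFDerivAt (fun z ↦ c (χ.inv z))
      ((mvfderiv (𝓡 n) c (χ.inv y)).comp
        (mfderiv 𝓘(ℝ, EuclideanSpace ℝ (Fin n)) (𝓡 n) χ.inv y) :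
          EuclideanSpace ℝ (Fin n) →L[ℝ] F) y :=
    (hc.hasMFDerivAt.comp y (χ.mdifferentiableAt_inv y).hasMFDerivAt).hasFDerivAt
  rw [h.fderiv]
  rfl

theorem FullChart.mvfderiv_field {F : Type*} [NormedAddCommGroup F] [NormedSpace ℝ F]
    (χ : FullChart n M) {c : M → F} {y : EuclideanSpace ℝ (Fin n)}
    (hc : MDifferentiableAt (𝓡 n) 𝓘(ℝ, F) c (χ.inv y)) (X : ∀ x : M, TangentSpace (𝓡 n) x) :
    mvfderiv (𝓡 n) c (χ.inv y) (X (χ.inv y)) =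
      fderiv ℝ (fun z ↦ c (χ.inv z)) y (χ.comp X y) := by
  rw [← χ.mvfderiv_mfderiv_inv hc, χ.mfderiv_inv_comp]

/-- The derivative of a smooth function along a smooth vector field is smooth. -/
theorem contMDiffAt_mvfderiv_apply {F : Type*} [NormedAddCommGroup F] [NormedSpace ℝ F]
    {c : M → F} {x : M} (hc : ContMDiffAt (𝓡 n) 𝓘(ℝ, F) ∞ c x) {X : ∀ x : M, TangentSpace (𝓡 n) x}
    (hX : ContMDiffAt (𝓡 n) (𝓡 n).tangent ∞
      (fun x ↦ (TotalSpace.mk x (X x) : TangentBundle (𝓡 n) M)) x) :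
    ContMDiffAt (𝓡 n) 𝓘(ℝ, F) ∞ (fun y ↦ mvfderiv (𝓡 n) c y (X y)) x := by
  obtain ⟨χ, hχ⟩ := FullChart.exists_mem n x
  have hx := χ.inv_chart hχ
  have h1 : ContDiffAt ℝ ∞ (fun z ↦ c (χ.inv z)) (χ.chart x) := by
    rw [← contMDiffAt_iff_contDiffAt]
    rw [← hx] at hc
    exact hc.comp _ (χ.contMDiff_inv _)
  have h2 : ContDiffAt ℝ ∞ (χ.comp X) (χ.chart x) := χ.contDiffAt_comp (by rwa [hx])
  refine ((h1.fderiv_of_infty.clm_apply h2).contMDiffAt.comp x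
    (χ.contMDiffAt_chart hχ)).congr_of_eventuallyEq ?_
  have h3 : ∀ᶠ y in 𝓝 x, ContMDiffAt (𝓡 n) 𝓘(ℝ, F) 1 c y :=
    (contMDiffAt_iff_contMDiffAt_nhds (by simp)).1 (hc.of_le (by simp))
  filter_upwards [h3, χ.isOpen_source.mem_nhds hχ] with z hz hz'
  obtain ⟨y, rfl⟩ : ∃ y, χ.inv y = z := ⟨_, χ.inv_chart hz'⟩
  rw [χ.mvfderiv_field (hz.mdifferentiableAt (by simp)), Function.comp_apply, χ.chart_inv]

variable {𝔤 : Type*} [NormedAddCommGroup 𝔤] [NormedSpace ℝ 𝔤] [FiniteDimensional ℝ 𝔤]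
  [RealLieAlgebra 𝔤]
  {L : M → Type*} [∀ x, LieRing (L x)] [∀ x, LieAlgebra ℝ (L x)]
  [∀ x, TopologicalSpace (L x)] [∀ x, IsTopologicalAddGroup (L x)]
  [∀ x, ContinuousSMul ℝ (L x)]
  [TopologicalSpace (TotalSpace 𝔤 L)] [FiberBundle 𝔤 L] [VectorBundle ℝ 𝔤 L]
  [ContMDiffVectorBundle ∞ 𝔤 L (𝓡 n)]

theorem hasFDerivAt_lie {E : Type*} [NormedAddCommGroup E] [NormedSpace ℝ E] {c d : E → 𝔤} {y : E}
    (hc : DifferentiableAt ℝ c y) (hd : DifferentiableAt ℝ d y) (e : E) :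
    fderiv ℝ (fun z ↦ ⁅c z, d z⁆) y e = ⁅fderiv ℝ c y e, d y⁆ + ⁅c y, fderiv ℝ d y e⁆ := by
  have h := (adLinear 𝔤).hasFDerivAt_of_bilinear hc.hasFDerivAt hd.hasFDerivAt
  have h2 := congrArg (fun T : E →L[ℝ] 𝔤 ↦ T e) h.fderiv
  simp only [adLinear_apply] at h2
  rw [h2, add_comm]
  rfl

theorem mvfderiv_lie {c d : M → 𝔤} {x : M} (hc : MDifferentiableAt (𝓡 n) 𝓘(ℝ, 𝔤) c x)
    (hd : MDifferentiableAt (𝓡 n) 𝓘(ℝ, 𝔤) d x) (X : TangentSpace (𝓡 n) x) :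
    MDifferentiableAt (𝓡 n) 𝓘(ℝ, 𝔤) (fun y ↦ ⁅c y, d y⁆) x ∧
    mvfderiv (𝓡 n) (fun y ↦ ⁅c y, d y⁆) x X =
      ⁅mvfderiv (𝓡 n) c x X, d x⁆ + ⁅c x, mvfderiv (𝓡 n) d x X⁆ := by
  have hm : MDifferentiableAt (𝓡 n) 𝓘(ℝ, 𝔤) (fun y ↦ ⁅c y, d y⁆) x :=
    MDifferentiableAt.clm_apply (((adLinear 𝔤).differentiableAt).mdifferentiableAt.comp x hc) hd
  refine ⟨hm, ?_⟩
  obtain ⟨χ, hχ⟩ := FullChart.exists_mem n x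
  obtain ⟨y, rfl⟩ : ∃ y, χ.inv y = x := ⟨_, χ.inv_chart hχ⟩
  obtain ⟨e, rfl⟩ : ∃ e : EuclideanSpace ℝ (Fin n),
      mfderiv 𝓘(ℝ, EuclideanSpace ℝ (Fin n)) (𝓡 n) χ.inv y e = X :=
    ⟨_, (χ.isInvertible_mfderiv_inv y).self_apply_inverse X⟩
  have h (c : M → 𝔤) (hc : MDifferentiableAt (𝓡 n) 𝓘(ℝ, 𝔤) c (χ.inv y)) :
      DifferentiableAt ℝ (fun z ↦ c (χ.inv z)) y :=
    (hc.comp y (χ.mdifferentiableAt_inv y)).differentiableAt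
  rw [χ.mvfderiv_mfderiv_inv hm, χ.mvfderiv_mfderiv_inv hc, χ.mvfderiv_mfderiv_inv hd]
  exact hasFDerivAt_lie (h c hc) (h d hd) e

/-- A bundle map `TM → L` is smooth if its values on smooth vector fields are. -/
theorem contMDiffAt_hom_of_apply {f : ∀ x : M, TangentSpace (𝓡 n) x →L[ℝ] L x} {x : M}
    (h : ∀ X : (∀ x : M, TangentSpace (𝓡 n) x), ContMDiffAt (𝓡 n) (𝓡 n).tangent ∞
        (fun x ↦ (TotalSpace.mk x (X x) : TangentBundle (𝓡 n) M)) x →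
      ContMDiffAt (𝓡 n) ((𝓡 n).prod 𝓘(ℝ, 𝔤)) ∞ (fun y ↦ TotalSpace.mk' 𝔤 y (f y (X y))) x) :
    ContMDiffAt (𝓡 n) ((𝓡 n).prod 𝓘(ℝ, EuclideanSpace ℝ (Fin n) →L[ℝ] 𝔤)) ∞
      (fun y ↦ TotalSpace.mk' (EuclideanSpace ℝ (Fin n) →L[ℝ] 𝔤)
        (E := fun y ↦ TangentSpace (𝓡 n) y →L[ℝ] L y) y (f y)) x := by
  rw [contMDiffAt_hom_bundle]
  refine ⟨contMDiffAt_id, contMDiffAt_clm_of_apply fun v ↦ ?_⟩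
  set e := trivializationAt (EuclideanSpace ℝ (Fin n)) (TangentSpace (𝓡 n) : M → Type _) x
  set e' := trivializationAt 𝔤 L x
  have he : ∀ᶠ y in 𝓝 x, y ∈ e.baseSet :=
    e.open_baseSet.mem_nhds (FiberBundle.mem_baseSet_trivializationAt' x)
  have he' : ∀ᶠ y in 𝓝 x, y ∈ e'.baseSet :=
    e'.open_baseSet.mem_nhds (FiberBundle.mem_baseSet_trivializationAt' x)
  -- The field with constant coordinate `v` is an admissible test field; its image under `f` has as
  -- coordinate the value at `v` of the coordinate operator of `f`.
  have hX : ContMDiffAt (𝓡 n) (𝓡 n).tangent ∞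
      (fun y ↦ (TotalSpace.mk y (e.symm y v) : TangentBundle (𝓡 n) M)) x := by
    refine (contMDiffAt_section x).2 (contMDiffAt_const (c := v) |>.congr_of_eventuallyEq ?_)
    filter_upwards [he] with y hy
    exact congrArg Prod.snd (e.apply_mk_symm hy v)
  refine ((contMDiffAt_section x).1 (h _ hX)).congr_of_eventuallyEq ?_
  filter_upwards [he, he'] with y hy hy'
  rw [ContinuousLinearMap.inCoordinates_eq hy hy']
  rfl

namespace LieTrivialization

variable (φ : LieTrivialization (n := n) 𝔤 L)

/-- The flat connection of a trivialization, as a continuous linear map on tangent vectors. -/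
noncomputable def flatCLM (u : ∀ x : M, L x) (x : M) : TangentSpace (𝓡 n) x →L[ℝ] L x :=
  (LinearMap.toContinuousLinearMap (φ.toEquiv x).toLinearEquiv.toLinearMap).comp
    (mvfderiv (𝓡 n) (fun y ↦ (φ.toEquiv y).symm (u y)) x)

theorem flatCLM_apply (u : ∀ x : M, L x) (x : M) (X : TangentSpace (𝓡 n) x) :
    φ.flatCLM u x X =
      φ.toEquiv x (mvfderiv (𝓡 n) (fun y ↦ (φ.toEquiv y).symm (u y)) x X) := rfl

variable {u v : ∀ x : M, L x} {x : M}

theorem flatCLM_add (hx : x ∈ φ.base)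
    (hu : MDifferentiableAt (𝓡 n) ((𝓡 n).prod 𝓘(ℝ, 𝔤)) (fun y ↦ TotalSpace.mk' 𝔤 y (u y)) x)
    (hv : MDifferentiableAt (𝓡 n) ((𝓡 n).prod 𝓘(ℝ, 𝔤)) (fun y ↦ TotalSpace.mk' 𝔤 y (v y)) x) :
    φ.flatCLM (u + v) x = φ.flatCLM u x + φ.flatCLM v x := by
  have h1 : (fun y ↦ (φ.toEquiv y).symm ((u + v) y)) =
      (fun y ↦ (φ.toEquiv y).symm (u y)) + fun y ↦ (φ.toEquiv y).symm (v y) :=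
    funext fun y ↦ map_add (φ.toEquiv y).symm.toLinearEquiv _ _
  rw [flatCLM, h1, mvfderiv_add ((φ.mdifferentiableAt_section_iff hx).1 hu)
    ((φ.mdifferentiableAt_section_iff hx).1 hv), ContinuousLinearMap.comp_add]
  rfl

theorem flatCLM_smul (hx : x ∈ φ.base) {g : M → ℝ}
    (hu : MDifferentiableAt (𝓡 n) ((𝓡 n).prod 𝓘(ℝ, 𝔤)) (fun y ↦ TotalSpace.mk' 𝔤 y (u y)) x)
    (hg : MDifferentiableAt (𝓡 n) 𝓘(ℝ, ℝ) g x) :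
    φ.flatCLM (g • u) x = g x • φ.flatCLM u x + (mvfderiv (𝓡 n) g x).smulRight (u x) := by
  have h1 : (fun y ↦ (φ.toEquiv y).symm ((g • u) y)) =
      g • fun y ↦ (φ.toEquiv y).symm (u y) :=
    funext fun y ↦ map_smul (φ.toEquiv y).symm.toLinearEquiv _ _
  ext X
  rw [flatCLM_apply, h1, mvfderiv_smul hg ((φ.mdifferentiableAt_section_iff hx).1 hu), add_apply,
    add_apply, smul_apply, smul_apply, flatCLM_apply, ← LieEquiv.coe_toLinearEquiv, map_add,
    map_smul, ContinuousLinearMap.smulRight_apply, ContinuousLinearMap.smulRight_apply, map_smul]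
  congr 2
  exact (φ.toEquiv x).apply_symm_apply _

theorem flatCLM_lie (hx : x ∈ φ.base)
    (hu : MDifferentiableAt (𝓡 n) ((𝓡 n).prod 𝓘(ℝ, 𝔤)) (fun y ↦ TotalSpace.mk' 𝔤 y (u y)) x)
    (hv : MDifferentiableAt (𝓡 n) ((𝓡 n).prod 𝓘(ℝ, 𝔤)) (fun y ↦ TotalSpace.mk' 𝔤 y (v y)) x)
    (X : TangentSpace (𝓡 n) x) :
    φ.flatCLM (fun y ↦ ⁅u y, v y⁆) x X = ⁅φ.flatCLM u x X, v x⁆ + ⁅u x, φ.flatCLM v x X⁆ := by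
  simp only [flatCLM_apply, LieEquiv.map_lie]
  rw [(mvfderiv_lie ((φ.mdifferentiableAt_section_iff hx).1 hu)
    ((φ.mdifferentiableAt_section_iff hx).1 hv) X).2, ← LieEquiv.coe_toLinearEquiv, map_add]
  simp only [LieEquiv.coe_toLinearEquiv, LieEquiv.map_lie, LieEquiv.apply_symm_apply]

theorem contMDiffAt_flatCLM (hx : x ∈ φ.base)
    (hu : ContMDiffAt (𝓡 n) ((𝓡 n).prod 𝓘(ℝ, 𝔤)) ∞ (fun y ↦ TotalSpace.mk' 𝔤 y (u y)) x) :
    ContMDiffAt (𝓡 n) ((𝓡 n).prod 𝓘(ℝ, EuclideanSpace ℝ (Fin n) →L[ℝ] 𝔤)) ∞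
      (fun y ↦ TotalSpace.mk' (EuclideanSpace ℝ (Fin n) →L[ℝ] 𝔤)
        (E := fun y ↦ TangentSpace (𝓡 n) y →L[ℝ] L y) y (φ.flatCLM u y)) x := by
  refine contMDiffAt_hom_of_apply fun X hX ↦ (φ.contMDiffAt_section_iff hx).2 ?_
  simp only [flatCLM_apply, LieEquiv.symm_apply_apply]
  exact contMDiffAt_mvfderiv_apply ((φ.contMDiffAt_section_iff hx).1 hu) hX

end LieTrivialization

end FlatDerivative

/-! ### The glued connection -/

section GluedConnection

variable {n : ℕ} {M : Type u} [TopologicalSpace M] [ChartedSpace (EuclideanSpace ℝ (Fin n)) M]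
  [IsManifold (𝓡 n) ∞ M]
  {𝔤 : Type*} [NormedAddCommGroup 𝔤] [NormedSpace ℝ 𝔤] [FiniteDimensional ℝ 𝔤]
  [RealLieAlgebra 𝔤]
  {L : M → Type*} [∀ x, LieRing (L x)] [∀ x, LieAlgebra ℝ (L x)]
  [∀ x, TopologicalSpace (L x)] [∀ x, IsTopologicalAddGroup (L x)]
  [∀ x, ContinuousSMul ℝ (L x)]
  [TopologicalSpace (TotalSpace 𝔤 L)] [FiberBundle 𝔤 L] [VectorBundle ℝ 𝔤 L]
  [ContMDiffVectorBundle ∞ 𝔤 L (𝓡 n)]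

/-- This is the derivative of the constant function `∑ h_α = 1`, which is a fixed finite sum near
`x`. -/
theorem SmoothPartitionOfUnity.sum_mvfderiv_eq_zero {ι : Type*}
    (H : SmoothPartitionOfUnity ι (𝓡 n) M univ) (x : M) (X : TangentSpace (𝓡 n) x) :
    ∑ α ∈ H.fintsupport x, mvfderiv (𝓡 n) (H α) x X = 0 := by
  have hd (α : ι) : MDifferentiableAt (𝓡 n) 𝓘(ℝ, ℝ) (H α) x :=
    ((H α).contMDiff x).mdifferentiableAt (by simp)
  have h1 (t : Finset ι) : MDifferentiableAt (𝓡 n) 𝓘(ℝ, ℝ) (fun y ↦ ∑ α ∈ t, H α y) x ∧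
      mvfderiv (𝓡 n) (fun y ↦ ∑ α ∈ t, H α y) x X = ∑ α ∈ t, mvfderiv (𝓡 n) (H α) x X := by
    classical
    induction t using Finset.induction_on with
    | empty =>
      simp only [Finset.sum_empty]
      exact ⟨mdifferentiableAt_const, by rw [mvfderiv_const, zero_apply]⟩
    | insert α t hα ih =>
      simp only [Finset.sum_insert hα]
      refine ⟨(hd α).add ih.1, ?_⟩
      rw [← ih.2, ← add_apply, ← mvfderiv_add (hd α) ih.1]
      rfl
  have h2 : (fun y ↦ ∑ α ∈ H.fintsupport x, H α y) =ᶠ[𝓝 x] fun _ ↦ (1 : ℝ) := by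
    filter_upwards [H.eventually_finsupport_subset x] with y hy
    exact H.sum_finsupport' y (mem_univ y) hy
  have h3 : mvfderiv (𝓡 n) (fun y ↦ ∑ α ∈ H.fintsupport x, H α y) x X =
      mfderiv (𝓡 n) 𝓘(ℝ, ℝ) (fun y ↦ ∑ α ∈ H.fintsupport x, H α y) x X := rfl
  rw [← (h1 _).2, h3, h2.mfderiv_eq, mfderiv_const]
  rfl

namespace DeltaStructure

variable {ι : Type w} (Φ : DeltaStructure n 𝔤 L ι) (H : SmoothPartitionOfUnity ι (𝓡 n) M univ)

/-- The convex combination of the flat connections of the trivializations. -/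
noncomputable def glueCLM (u : ∀ x : M, L x) (x : M) : TangentSpace (𝓡 n) x →L[ℝ] L x :=
  ∑ α ∈ H.finsupport x, H α x • (Φ.triv α).flatCLM u x

variable {H}

theorem mem_base_of_mem_fintsupport (hH : H.IsSubordinate fun α ↦ (Φ.triv α).base) {α : ι} {x : M} (hα : α ∈ H.fintsupport x) :
    x ∈ (Φ.triv α).base :=
  hH α ((H.mem_fintsupport_iff x α).1 hα)

theorem glueCLM_apply (u : ∀ x : M, L x) (x : M) (X : TangentSpace (𝓡 n) x) :
    Φ.glueCLM H u x X = ∑ α ∈ H.finsupport x, H α x • (Φ.triv α).flatCLM u x X := by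
  simp only [glueCLM, sum_apply, smul_apply]

/-- The Leibniz rule gives `∇^α (h_α u) = h_α ∇^α u + dh_α u`, and `∑ dh_α = 0`. So the weights may
be taken out of the derivative, which makes the formula a convex combination of connections. -/
theorem glueCLM_eq_glue (hH : H.IsSubordinate fun α ↦ (Φ.triv α).base) {u : ∀ x : M, L x} {x : M}
    (hu : MDifferentiableAt (𝓡 n) ((𝓡 n).prod 𝓘(ℝ, 𝔤)) (fun y ↦ TotalSpace.mk' 𝔤 y (u y)) x)
    (X : TangentSpace (𝓡 n) x) : Φ.glueCLM H u x X = Φ.glue H u x X := by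
  have h0 (α) (hα : α ∉ H.fintsupport x) :
      (Φ.triv α).flatDeriv (fun y ↦ H α y • u y) x X = 0 := by
    rw [H.mem_fintsupport_iff, notMem_tsupport_iff_eventuallyEq] at hα
    have h1 : (fun y ↦ ((Φ.triv α).toEquiv y).symm (H α y • u y)) =ᶠ[𝓝 x] fun _ ↦ (0 : 𝔤) := by
      filter_upwards [hα] with y hy
      rw [hy, Pi.zero_apply, zero_smul]
      exact map_zero ((Φ.triv α).toEquiv y).symm.toLinearEquiv
    rw [LieTrivialization.flatDeriv, h1.mfderiv_eq, mfderiv_const]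
    exact map_zero ((Φ.triv α).toEquiv x).toLinearEquiv
  rw [glue, finsum_eq_sum_of_support_subset (s := H.fintsupport x) _ (fun α hα ↦ by
    by_contra h
    exact hα (h0 α h)), glueCLM_apply, H.sum_finsupport_smul_eq (H.finsupport_subset_fintsupport x)]
  have h1 (α) (hα : α ∈ H.fintsupport x) : (Φ.triv α).flatDeriv (fun y ↦ H α y • u y) x X =
      H α x • (Φ.triv α).flatCLM u x X + mvfderiv (𝓡 n) (H α) x X • u x := by
    have h2 := (Φ.triv α).flatCLM_smul (Φ.mem_base_of_mem_fintsupport hH hα) hu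
      (((H α).contMDiff x).mdifferentiableAt (by simp))
    exact congrArg (fun T : TangentSpace (𝓡 n) x →L[ℝ] L x ↦ T X) h2
  rw [Finset.sum_congr rfl h1, Finset.sum_add_distrib, ← Finset.sum_smul,
    H.sum_mvfderiv_eq_zero, zero_smul, add_zero]

variable [T2Space M]

/-- The connection glued from the flat connections of the trivializations. -/
noncomputable def glueConnection (hH : H.IsSubordinate fun α ↦ (Φ.triv α).base) :
    LieConnection n 𝔤 L where
  toFun := Φ.glueCLM H
  isCovariantDerivativeOnUniv :=
    { add := fun {u v x} hu hv _ ↦ by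
        rw [glueCLM, glueCLM, glueCLM, ← Finset.sum_add_distrib]
        refine Finset.sum_congr rfl fun α hα ↦ ?_
        rw [← smul_add, (Φ.triv α).flatCLM_add (Φ.mem_base_of_mem_fintsupport hH
          (H.finsupport_subset_fintsupport x hα)) hu hv]
      leibniz := fun {u g x} hu hg _ ↦ by
        -- Each flat derivative contributes the full term `dg u`; the weighted terms add up to one
        -- copy because the weights sum to one.
        have h1 : (mvfderiv (𝓡 n) g x).smulRight (u x) = ∑ α ∈ H.finsupport x,
            H α x • (mvfderiv (𝓡 n) g x).smulRight (u x) :=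
          H.sum_finsupport_smul_of_eq fun _ _ ↦ rfl
        rw [h1, glueCLM, glueCLM, Finset.smul_sum, ← Finset.sum_add_distrib]
        refine Finset.sum_congr rfl fun α hα ↦ ?_
        rw [(Φ.triv α).flatCLM_smul (Φ.mem_base_of_mem_fintsupport hH
          (H.finsupport_subset_fintsupport x hα)) hu hg, smul_add, smul_comm] }
  smooth := ⟨⟨fun {u} hu ↦ by
    rw [contMDiffOn_univ] at hu ⊢
    exact hH.contMDiff_sum_section (F := EuclideanSpace ℝ (Fin n) →L[ℝ] 𝔤)
      (V := fun y ↦ TangentSpace (𝓡 n) y →L[ℝ] L y) (s := fun α ↦ (Φ.triv α).flatCLM u)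
      fun α x hx ↦ (Φ.triv α).contMDiffAt_flatCLM hx ((hu x).of_le (by simp))⟩⟩
  map_lie u v hu hv x X := by
    change Φ.glueCLM H _ x X = ⁅Φ.glueCLM H u x X, v x⁆ + ⁅u x, Φ.glueCLM H v x X⁆
    rw [glueCLM_apply, glueCLM_apply, glueCLM_apply, sum_lie, lie_sum, ← Finset.sum_add_distrib]
    refine Finset.sum_congr rfl fun α hα ↦ ?_
    rw [(Φ.triv α).flatCLM_lie (Φ.mem_base_of_mem_fintsupport hH
      (H.finsupport_subset_fintsupport x hα)) ((hu x).mdifferentiableAt (by simp))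
      ((hv x).mdifferentiableAt (by simp)), smul_add, smul_lie, lie_smul]

theorem glueConnection_toFun (hH : H.IsSubordinate fun α ↦ (Φ.triv α).base) (u : ∀ x : M, L x)
    (x : M) (X : TangentSpace (𝓡 n) x) : (Φ.glueConnection hH).toFun u x X =
      ∑ α ∈ H.finsupport x, H α x • (Φ.triv α).flatCLM u x X :=
  Φ.glueCLM_apply u x X

/-- The glued connection is adapted to the given trivializations. -/
theorem adapted_glueConnection (hH : H.IsSubordinate fun α ↦ (Φ.triv α).base) (β : ι) :
    (Φ.glueConnection hH).Adapted (Φ.triv β) := by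
  intro x hx X
  obtain ⟨χ, hχ⟩ := FullChart.exists_mem n x
  obtain ⟨y, rfl⟩ : ∃ y, χ.inv y = x := ⟨_, χ.inv_chart hχ⟩
  obtain ⟨e, rfl⟩ : ∃ e : EuclideanSpace ℝ (Fin n),
      mfderiv 𝓘(ℝ, EuclideanSpace ℝ (Fin n)) (𝓡 n) χ.inv y e = X :=
    ⟨_, (χ.isInvertible_mfderiv_inv y).self_apply_inverse X⟩
  set φ := Φ.triv β
  have hmem {α} (hα : α ∈ H.finsupport (χ.inv y)) : χ.inv y ∈ (Φ.triv α).base :=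
    Φ.mem_base_of_mem_fintsupport hH (H.finsupport_subset_fintsupport _ hα)
  -- The form of the `α`-th flat connection in the gauge `φ_β` is `a⁻¹ da` with `a = φ_α⁻¹ φ_β`; the
  -- glued connection has the weighted sum of these, and `δ`-compatibility puts each summand in `ad
  -- 𝔤`.
  have h1 : (Φ.glueConnection hH).connForm φ (χ.inv y)
      (mfderiv 𝓘(ℝ, EuclideanSpace ℝ (Fin n)) (𝓡 n) χ.inv y e) =
      ∑ α ∈ H.finsupport (χ.inv y), H α (χ.inv y) •
        (autCLM (φ.transition (Φ.triv α) (χ.inv y) : LieAut 𝔤)⁻¹ *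
          fderiv ℝ (fun z ↦ φ.transCLM (Φ.triv α) (χ.inv z)) y e) := by
    ext v
    rw [(Φ.glueConnection hH).connForm_eq φ hx, glueConnection_toFun, ← LieEquiv.coe_toLinearEquiv,
      map_sum, sum_apply]
    refine Finset.sum_congr rfl fun α hα ↦ ?_
    set φ' := Φ.triv α
    have hd := (φ.contMDiffAt_transCLM φ' hx (hmem hα)).mdifferentiableAt (n := ∞) (by simp)
    have hd' := (LieConnection.contDiffAt_transCLM_inv χ φ φ' hx (hmem hα)).differentiableAt (by simp)
    have h2 : (fun z ↦ (φ'.toEquiv z).symm (φ.sec v z)) = fun z ↦ φ.transCLM φ' z v :=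
      funext fun z ↦ (φ.transCLM_apply φ' z v).symm
    have h3 : MDifferentiableAt (𝓡 n) 𝓘(ℝ, 𝔤) (fun z ↦ φ.transCLM φ' z v) (χ.inv y) :=
      hd.clm_apply mdifferentiableAt_const
    have h4 : fderiv ℝ (fun z ↦ φ.transCLM φ' (χ.inv z) v) y e =
        fderiv ℝ (fun z ↦ φ.transCLM φ' (χ.inv z)) y e v := by
      rw [(hd'.hasFDerivAt.clm_apply (hasFDerivAt_const v y)).fderiv]
      simp
    rw [map_smul, smul_apply, LieTrivialization.flatCLM_apply, h2, χ.mvfderiv_mfderiv_inv h3, h4]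
    rfl
  rw [h1]
  exact Submodule.sum_mem _ fun α hα ↦ Submodule.smul_mem _ _
    (LieConnection.inv_mul_fderiv_mem_of_deltaCompatible (Φ.compatible β α) χ hx (hmem hα) e)

end DeltaStructure

end GluedConnection

/-! ### The correspondence through adapted pairs -/

section Correspondence

variable {n : ℕ} {M : Type u} [TopologicalSpace M] [ChartedSpace (EuclideanSpace ℝ (Fin n)) M]
  [IsManifold (𝓡 n) ∞ M]
  {𝔤 : Type*} [NormedAddCommGroup 𝔤] [NormedSpace ℝ 𝔤] [FiniteDimensional ℝ 𝔤]
  [RealLieAlgebra 𝔤]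
  {L : M → Type*} [∀ x, LieRing (L x)] [∀ x, LieAlgebra ℝ (L x)]
  [∀ x, TopologicalSpace (L x)] [∀ x, IsTopologicalAddGroup (L x)]
  [∀ x, ContinuousSMul ℝ (L x)]
  [TopologicalSpace (TotalSpace 𝔤 L)] [FiberBundle 𝔤 L] [VectorBundle ℝ 𝔤 L]
  [ContMDiffVectorBundle ∞ 𝔤 L (𝓡 n)]
  [T2Space M]

/-- A connection is adapted to a locally trivial structure if it is adapted to all of its
trivializations. -/
def AccordantConnection.AdaptedTo {ι : Type w} (D : AccordantConnection n 𝔤 L)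
    (Φ : DeltaStructure n 𝔤 L ι) : Prop :=
  ∀ α, D.1.Adapted (Φ.triv α)

namespace AccordantConnection

variable {D D' : AccordantConnection n 𝔤 L} {ι κ : Type w} {Φ : DeltaStructure n 𝔤 L ι}
  {Ψ : DeltaStructure n 𝔤 L κ}

theorem AdaptedTo.equivalent (h : D.AdaptedTo Φ) (h' : D.AdaptedTo Ψ) : Φ.Equivalent Ψ :=
  fun α β ↦ (h α).deltaCompatible (h' β)

theorem AdaptedTo.of_rel (h : D.AdaptedTo Φ) (hr : D.Rel D') : D'.AdaptedTo Φ :=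
  fun α ↦ (h α).of_rel hr

theorem AdaptedTo.of_equivalent (h : D.AdaptedTo Φ) (he : Φ.Equivalent Ψ) : D.AdaptedTo Ψ := by
  intro β x hx
  obtain ⟨α, hα⟩ := Φ.cover x
  exact (h α).adaptedAt_of_deltaCompatible (he α β) hα hx

end AccordantConnection

/-- A chart of a radial atlas. -/
def RadialAtlas.fullChart {ι : Type w} (𝒜 : RadialAtlas n 𝔤 L ι) (α : ι) : FullChart n M :=
  ⟨𝒜.chart α, 𝒜.mem_maximalAtlas α, 𝒜.target_eq α⟩

/-- Indexing by the points of `M` keeps the index type in the universe over which `LABDelta` is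
formed. -/
theorem RadialAtlas.exists_of_isLieAlgebraBundle (hL : IsLieAlgebraBundle (n := n) 𝔤 L) :
    Nonempty (RadialAtlas n 𝔤 L M) := by
  choose χ hχ using fun x : M ↦ FullChart.exists_mem n x
  choose φ hφ using hL
  exact ⟨⟨fun x ↦ (χ x).chart, fun x ↦ (χ x).mem_maximalAtlas, fun x ↦ (χ x).target_eq,
    fun x ↦ ⟨x, hχ x⟩, fun x ↦ (φ ((χ x).inv 0)).toEquiv _⟩⟩

namespace DeltaStructure

variable {ι : Type w} {𝒜 : RadialAtlas n 𝔤 L ι} {D : AccordantConnection n 𝔤 L}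

theorem exists_isRadialTransport (hL : IsLieAlgebraBundle (n := n) 𝔤 L) (𝒜 : RadialAtlas n 𝔤 L ι)
    (D : AccordantConnection n 𝔤 L) :
    ∃ Φ : DeltaStructure n 𝔤 L ι, Φ.IsRadialTransport 𝒜 D.1 ∧ D.AdaptedTo Φ := by
  choose φ hb hψ hr using fun α ↦
    LieConnection.exists_isRadial D.1 (𝒜.fullChart α) hL (𝒜.frame α)
  have ha (α) : D.1.Adapted (φ α) := (hr α).adapted (hb α) D.2
  refine ⟨⟨φ, fun x ↦ ?_, fun α β ↦ (ha α).deltaCompatible (ha β)⟩, fun α ↦ ⟨hb α, fun x hx v ↦ ?_⟩,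
    ha⟩
  · obtain ⟨α, hα⟩ := 𝒜.cover x
    exact ⟨α, by rw [hb α]; exact hα⟩
  · obtain ⟨s, hs, h0, h1⟩ := (hr α).exists_parallel (hb α) hx v
    rw [hψ α] at h0
    exact ⟨s, hs, h0, h1⟩

/-- The transport condition is stated by existence of parallel curves, but uniqueness of radial
transport identifies `Φ` over each chart with the radial trivialization constructed from `D`. The
transition function is then constantly `1`, and adaptedness carries over. -/
theorem IsRadialTransport.adaptedTo (hL : IsLieAlgebraBundle (n := n) 𝔤 L)
    {Φ : DeltaStructure n 𝔤 L ι} (hΦ : Φ.IsRadialTransport 𝒜 D.1) : D.AdaptedTo Φ := by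
  intro α x hx
  obtain ⟨φ, hb, hψ, hr⟩ := LieConnection.exists_isRadial D.1 (𝒜.fullChart α) hL (𝒜.frame α)
  obtain ⟨hb', h⟩ := hΦ α
  have heq {y : M} (hy : y ∈ (𝒜.fullChart α).source) : (Φ.triv α).toEquiv y = φ.toEquiv y := by
    ext v
    obtain ⟨s, hs, h0, h1⟩ := h y hy v
    rw [← hψ] at h0
    exact hr.eq_of_parallel hb hs h0 h1
  have hx' : x ∈ φ.base := by
    rw [hb]
    exact hb'.subset hx
  refine (hr.adapted hb D.2).adaptedAt_of_deltaCompatible ?_ hx' hx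
  refine (continuousOn_const (c := 1)).congr fun y hy ↦ ?_
  rw [LieTrivialization.transition, heq (hb ▸ hy.1), ← AutDelta.ofLieEquiv_refl]
  congr 1
  ext v
  exact (φ.toEquiv y).symm_apply_apply v

variable [SigmaCompactSpace M]

theorem exists_isSubordinate (Φ : DeltaStructure n 𝔤 L ι) :
    ∃ H : SmoothPartitionOfUnity ι (𝓡 n) M univ, H.IsSubordinate fun α ↦ (Φ.triv α).base :=
  SmoothPartitionOfUnity.exists_isSubordinate (𝓡 n) isClosed_univ _
    (fun α ↦ (Φ.triv α).isOpen_base) fun x _ ↦ mem_iUnion.2 (Φ.cover x)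

theorem exists_adaptedTo_eq_glue (Φ : DeltaStructure n 𝔤 L ι)
    {H : SmoothPartitionOfUnity ι (𝓡 n) M univ}
    (hH : H.IsSubordinate fun α ↦ (Φ.triv α).base) :
    ∃ D : AccordantConnection n 𝔤 L,
      (∀ u : (∀ x : M, L x), IsSmoothSection n 𝔤 u → ∀ (x : M) (X : TangentSpace (𝓡 n) x),
        D.1.toFun u x X = Φ.glue H u x X) ∧ D.AdaptedTo Φ := by
  refine ⟨⟨Φ.glueConnection hH, LieConnection.inAccordance_of_adapted fun x ↦ ?_⟩,
    fun u hu x X ↦ Φ.glueCLM_eq_glue hH ((hu x).mdifferentiableAt (by simp)) X,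
    Φ.adapted_glueConnection hH⟩
  obtain ⟨α, hα⟩ := Φ.cover x
  exact ⟨_, hα, Φ.adapted_glueConnection hH α⟩

/-- The formula fixes `D` on smooth sections only, which suffices: `D` is related to the constructed
glued connection with `l = 0`. -/
theorem adaptedTo_of_eq_glue {Φ : DeltaStructure n 𝔤 L ι}
    {H : SmoothPartitionOfUnity ι (𝓡 n) M univ}
    (hH : H.IsSubordinate fun α ↦ (Φ.triv α).base)
    (h : ∀ u : (∀ x : M, L x), IsSmoothSection n 𝔤 u → ∀ (x : M) (X : TangentSpace (𝓡 n) x),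
        D.1.toFun u x X = Φ.glue H u x X) : D.AdaptedTo Φ := by
  obtain ⟨D', hD', ha⟩ := Φ.exists_adaptedTo_eq_glue hH
  refine ha.of_rel ⟨0, fun X _ ↦ contMDiff_zeroSection ℝ L, fun u hu x X ↦ ?_⟩
  rw [h u hu, hD' u hu]
  simp

end DeltaStructure

theorem AccordantConnection.AdaptedTo.rel [SigmaCompactSpace M] {ι : Type w}
    {Φ : DeltaStructure n 𝔤 L ι} {D D' : AccordantConnection n 𝔤 L} (hD : D.AdaptedTo Φ)
    (hD' : D'.AdaptedTo Φ) : D.Rel D' :=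
  AccordantConnection.rel_of_adapted (φ := Φ.triv) (h' := hD') (hφ := Φ.cover) (h := hD)

/-- A parallel transport map sends a connection to the structures to which it is adapted. -/
theorem IsParallelTransportMap.eq_of_adaptedTo (hL : IsLieAlgebraBundle (n := n) 𝔤 L)
    {f : Coup n 𝔤 L → LABDelta n 𝔤 L} (hf : IsParallelTransportMap f)
    {D : AccordantConnection n 𝔤 L} {ι : Type u} {Φ : DeltaStructure n 𝔤 L ι}
    (h : D.AdaptedTo Φ) : f (Quotient.mk _ D) = Quotient.mk _ ⟨ι, Φ⟩ := by
  obtain ⟨𝒜⟩ := RadialAtlas.exists_of_isLieAlgebraBundle hL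
  obtain ⟨Ψ, hΨ, hfΨ⟩ := hf M 𝒜 D
  rw [hfΨ]
  exact Quotient.sound ((hΨ.adaptedTo hL).equivalent h)

/-- A gluing map sends a locally trivial structure to the connections adapted to it. -/
theorem IsGluingMap.eq_of_adaptedTo [SigmaCompactSpace M]
    {g : LABDelta n 𝔤 L → Coup n 𝔤 L} (hg : IsGluingMap g)
    {D : AccordantConnection n 𝔤 L} {ι : Type u} {Φ : DeltaStructure n 𝔤 L ι}
    (h : D.AdaptedTo Φ) : g (Quotient.mk _ ⟨ι, Φ⟩) = Quotient.mk _ D := by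
  obtain ⟨H, hH⟩ := Φ.exists_isSubordinate
  obtain ⟨D', hD', hgD'⟩ := hg ι Φ H hH
  rw [hgD']
  exact Quotient.sound ((DeltaStructure.adaptedTo_of_eq_glue hH hD').rel h)

/-- One atlas is fixed to define the map. Adaptedness shows both that the class of the structure
depends only on the coupling and that any other radial data yield the same class. -/
theorem exists_isParallelTransportMap (hL : IsLieAlgebraBundle (n := n) 𝔤 L) :
    ∃ f : Coup n 𝔤 L → LABDelta n 𝔤 L, IsParallelTransportMap f := by
  obtain ⟨𝒜⟩ := RadialAtlas.exists_of_isLieAlgebraBundle hL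
  choose Φ _ hΦ using DeltaStructure.exists_isRadialTransport hL 𝒜
  refine ⟨Quotient.lift (fun D ↦ Quotient.mk _ ⟨M, Φ D⟩) fun D D' h ↦
    Quotient.sound (((hΦ D).of_rel h).equivalent (hΦ D')), fun ι ℬ D ↦ ?_⟩
  obtain ⟨Ψ, hΨ, ha⟩ := DeltaStructure.exists_isRadialTransport hL ℬ D
  exact ⟨Ψ, hΨ, Quotient.sound ((hΦ D).equivalent ha)⟩

/-- Any choice of subordinate partitions works: equivalent structures have the same adapted
connections, and connections adapted to one structure are related. -/
theorem exists_isGluingMap [SigmaCompactSpace M] :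
    ∃ g : LABDelta n 𝔤 L → Coup n 𝔤 L, IsGluingMap g := by
  choose H hH using fun Φ : Σ ι : Type u, DeltaStructure n 𝔤 L ι ↦ Φ.2.exists_isSubordinate
  choose D _ hD using fun Φ : Σ ι : Type u, DeltaStructure n 𝔤 L ι ↦
    Φ.2.exists_adaptedTo_eq_glue (hH Φ)
  refine ⟨Quotient.lift (fun Φ ↦ Quotient.mk _ (D Φ)) fun Φ Ψ h ↦
    Quotient.sound (((hD Φ).of_equivalent h).rel (hD Ψ)), fun ι Φ K hK ↦ ?_⟩
  obtain ⟨D', hD', ha⟩ := Φ.exists_adaptedTo_eq_glue hK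
  exact ⟨D', hD', Quotient.sound ((hD ⟨ι, Φ⟩).rel ha)⟩

theorem AccordantConnection.exists_adaptedTo (hL : IsLieAlgebraBundle (n := n) 𝔤 L)
    (D : AccordantConnection n 𝔤 L) : ∃ Φ : DeltaStructure n 𝔤 L M, D.AdaptedTo Φ := by
  obtain ⟨𝒜⟩ := RadialAtlas.exists_of_isLieAlgebraBundle hL
  obtain ⟨Φ, -, h⟩ := DeltaStructure.exists_isRadialTransport hL 𝒜 D
  exact ⟨Φ, h⟩

theorem DeltaStructure.exists_adaptedTo [SigmaCompactSpace M] {ι : Type w}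
    (Φ : DeltaStructure n 𝔤 L ι) : ∃ D : AccordantConnection n 𝔤 L, D.AdaptedTo Φ := by
  obtain ⟨H, hH⟩ := Φ.exists_isSubordinate
  obtain ⟨D, -, h⟩ := Φ.exists_adaptedTo_eq_glue hH
  exact ⟨D, h⟩

end Correspondence

theorem mainTheorem1 {n : ℕ} {M : Type u} [TopologicalSpace M] [T2Space M] [SigmaCompactSpace M]
    [ChartedSpace (EuclideanSpace ℝ (Fin n)) M] [IsManifold (𝓡 n) ∞ M]
    {𝔤 : Type*} [NormedAddCommGroup 𝔤] [NormedSpace ℝ 𝔤] [FiniteDimensional ℝ 𝔤]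
    [RealLieAlgebra 𝔤]
    {L : M → Type*} [∀ x, LieRing (L x)] [∀ x, LieAlgebra ℝ (L x)]
    [∀ x, TopologicalSpace (L x)] [∀ x, IsTopologicalAddGroup (L x)]
    [∀ x, ContinuousSMul ℝ (L x)]
    [TopologicalSpace (TotalSpace 𝔤 L)] [FiberBundle 𝔤 L] [VectorBundle ℝ 𝔤 L]
    [ContMDiffVectorBundle ∞ 𝔤 L (𝓡 n)]
    (hL : IsLieAlgebraBundle (n := n) 𝔤 L) :
    (∃! f : Coup n 𝔤 L → LABDelta n 𝔤 L, IsParallelTransportMap f) ∧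
    (∃! g : LABDelta n 𝔤 L → Coup n 𝔤 L, IsGluingMap g) ∧
    ∀ (f : Coup n 𝔤 L → LABDelta n 𝔤 L) (g : LABDelta n 𝔤 L → Coup n 𝔤 L),
      IsParallelTransportMap f → IsGluingMap g →
      Function.LeftInverse g f ∧ Function.RightInverse g f := by
  obtain ⟨f, hf⟩ := exists_isParallelTransportMap hL
  obtain ⟨g, hg⟩ := exists_isGluingMap (n := n) (𝔤 := 𝔤) (L := L)
  refine ⟨⟨f, hf, fun f' hf' ↦ ?_⟩, ⟨g, hg, fun g' hg' ↦ ?_⟩, fun f g hf hg ↦ ⟨?_, ?_⟩⟩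
  -- Each class on either side has a representative that belongs to an adapted pair, and the
  -- defining property of `f` or `g` forces its value on that class.
  · funext c
    induction c using Quotient.inductionOn with | _ D
    obtain ⟨Φ, h⟩ := D.exists_adaptedTo hL
    rw [hf.eq_of_adaptedTo hL h, hf'.eq_of_adaptedTo hL h]
  · funext c
    induction c using Quotient.inductionOn with | _ Φ
    obtain ⟨D, h⟩ := Φ.2.exists_adaptedTo
    exact (hg'.eq_of_adaptedTo h).trans (hg.eq_of_adaptedTo h).symm
  -- An adapted pair `(D, Φ)` is sent by `f` from left to right and by `g` from right to left, so
  -- the composites are identities.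
  · intro c
    induction c using Quotient.inductionOn with | _ D
    obtain ⟨Φ, h⟩ := D.exists_adaptedTo hL
    rw [hf.eq_of_adaptedTo hL h, hg.eq_of_adaptedTo h]
  · intro c
    induction c using Quotient.inductionOn with | _ Φ
    obtain ⟨D, h⟩ := Φ.2.exists_adaptedTo
    exact (congrArg f (hg.eq_of_adaptedTo h)).trans (hf.eq_of_adaptedTo hL h)
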